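/- Let $p$ be a prime and let $G$ be a finite Camina $p$-group of nilpotency class $3$ (Camina: every conjugacy class of $G$ outside the derived subgroup $G'$ is a coset of $G'$). Suppose $|G:G'|=p^{2n}$, $|G':Z(G)|=p^n$ and $|Z(G)|=p^k$, and let $\zeta\in\mathbb{C}$ be a primitive $p$-th root of unity. For a conjugacy class $C$ of $G$ let $A_C$ be the $G\times G$ matrix with $(A_C)_{xy}=1$ if $yx^{-1}\in C$ and $0$ otherwise, and let $E_C^*$ be the diagonal matrix with $(E_C^*)_{yy}=1$ if $y\in C$ and $0$ otherwise. Let $T(G)$ be the Terwilliger algebra of the group association scheme of $G$ with base point $e$, that is, the subalgebra of $M_{|G|}(\mathbb{C})$ generated by all $A_C$ and all $E_C^*$. Let $V$, the primary component, be the two-sided ideal of $T(G)$ generated by the all-ones matrix $J$. There are exactly $p^n-1$ conjugacy classes contained in $G'\setminus Z(G)$, and exactly $p^{2n}-1$ conjugacy classes outside $G'$. The ideal $V$ is a minimal two-sided ideal of $T(G)$, and its dimension is the square of the number of conjugacy classes of $G$. There are elements $z_1,\dots,z_k$ that generate $Z(G)$, and elements $h_1,\dots,h_n\in G'$ whose cosets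 generate $G'/Z(G)$. For every such choice write $A_j$ for the adjacency matrix of the class of $z_j$ $(1\le j\le k)$ and $B_j$ for that of the class of $h_j$ $(1\le j\le n)$. Then \[T(G)=V\oplus\bigoplus_{i}\bigoplus_{\alpha}\mathcal{W}_i(\alpha)\oplus\bigoplus_{t}\bigoplus_{\beta}\mathcal{X}_t(\beta)\oplus\bigoplus_{s}\bigoplus_{\gamma}\mathcal{Y}_s(\gamma)\] as an internal direct sum of two-sided ideals. Here $i$ runs over the classes contained in $G'\setminus Z(G)$, $t$ and $s$ run over the classes outside $G'$, $\alpha,\beta$ run over the nonzero elements of $\{0,\dots,p-1\}^k$, and $\gamma$ runs over the nonzero elements of $\{0,\dots,p-1\}^n$. All $\mathcal{W}_i(\alpha)$, $\mathcal{X}_t(\beta)$, $\mathcal{Y}_s(\gamma)$ are one-dimensional two-sided ideals, generated respectively by \[W_i(\alpha)=\frac1{p^k}\sum_{a\in\{0,\dots,p-1\}^k}\prod_{j=1}^k\zeta^{\alpha_ja_j}(E_i^*A_jE_i^*)^{a_j},\qquad X_t(\beta)=\frac1{p^k}\sum_{a\in\{0,\dots,p-1\}^k}\prod_{j=1}^k\zeta^{\beta_ja_j}(E_t^*A_jE_t^*)^{a_j},\]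 \[Y_s(\gamma)=\frac1{p^{n+k}}\Bigl(\sum_{z\in Z(G)}E_s^*A_{\{z\}}E_s^*+\sum_{0\ne a\in\{0,\dots,p-1\}^n}p^k\prod_{j=1}^n\frac{\zeta^{\gamma_ja_j}}{p^{a_jk}}(E_s^*B_jE_s^*)^{a_j}\Bigr),\] where the zeroth power of a matrix $E^*AE^*$ means $E^*$. -/

import Mathlib

open scoped Pointwise

noncomputable section

/-- A Camina group: every conjugacy class outside the derived subgroup `G'` is a coset of `G'`. -/
def IsCaminaGroup (G : Type*) [Group G] : Prop :=
  ∀ g : G, g ∉ commutator G →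
    ∃ x : G, conjugatesOf g = x • ((commutator G : Subgroup G) : Set G)

/-- The conjugacy classes contained in `G' \ Z(G)`. -/
abbrev InnerClass (G : Type*) [Group G] : Type _ :=
  {c : ConjClasses G //
    c.carrier ⊆ ((commutator G : Subgroup G) : Set G) \ (Subgroup.center G : Set G)}

/-- The conjugacy classes lying outside `G'`. -/
abbrev OuterClass (G : Type*) [Group G] : Type _ :=
  {c : ConjClasses G // c.carrier ⊆ ((commutator G : Subgroup G) : Set G)ᶜ}

/-- The tuples in `{0, 1, …, p - 1} ^ m` whose entries are not all zero. -/
abbrev NonzeroTuple (p m : ℕ) : Type :=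
  {a : Fin m → Fin p // ∃ j, (a j : ℕ) ≠ 0}

section Matrices

variable {G : Type*} [Group G]

open Classical in
/-- The adjacency matrix of a conjugacy class `c` in the group association scheme:
the `(x, y)` entry is `1` if `y x⁻¹ ∈ c` and `0` otherwise. -/
def adjacencyMatrix (c : ConjClasses G) : Matrix G G ℂ :=
  Matrix.of fun x y => if y * x⁻¹ ∈ c.carrier then 1 else 0

open Classical in
/-- The diagonal matrix `E_c^*`, with base point the identity: the `(y, y)` entry is the
`(e, y)` entry of the adjacency matrix of `c`. -/
def dualIdempotentMatrix (c : ConjClasses G) : Matrix G G ℂ :=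
  Matrix.diagonal fun y => adjacencyMatrix c 1 y

variable (G) in
/-- The Bose-Mesner algebra of the group association scheme (as a subspace). -/
def boseMesner : Submodule ℂ (Matrix G G ℂ) :=
  Submodule.span ℂ (Set.range (adjacencyMatrix (G := G)))

variable (G) in
/-- The dual Bose-Mesner algebra with base point the identity (as a subspace). -/
def dualBoseMesner : Submodule ℂ (Matrix G G ℂ) :=
  Submodule.span ℂ (Set.range (dualIdempotentMatrix (G := G)))

variable [Fintype G] [DecidableEq G]

variable (G) in
/-- The Terwilliger algebra `T(G)` of the group association scheme, with base point the identity: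
the subalgebra of the matrix algebra generated by the Bose-Mesner algebra and its dual. -/
def terwilliger : Subalgebra ℂ (Matrix G G ℂ) :=
  Algebra.adjoin ℂ ((boseMesner G : Set (Matrix G G ℂ)) ∪ (dualBoseMesner G : Set (Matrix G G ℂ)))

/-- The adjacency matrix `A_c` as an element of `T(G)`. -/
def adj (c : ConjClasses G) : terwilliger G :=
  ⟨adjacencyMatrix c,
    Algebra.subset_adjoin (Or.inl (Submodule.subset_span (Set.mem_range_self c)))⟩

/-- The matrix `E_c^*` as an element of `T(G)`. -/
def dualIdem (c : ConjClasses G) : terwilliger G :=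
  ⟨dualIdempotentMatrix c,
    Algebra.subset_adjoin (Or.inr (Submodule.subset_span (Set.mem_range_self c)))⟩

/-- The block `E_c^* A_b E_c^*`. -/
def block (c b : ConjClasses G) : terwilliger G :=
  dualIdem c * adj b * dualIdem c

/-- The power `(E_c^* A_b E_c^*) ^ a`, taken in the algebra `E_c^* T(G) E_c^*` with identity
element `E_c^*`. For `a ≥ 1` it is the usual power, and for `a = 0` it is `E_c^*`. -/
def blockPow (c b : ConjClasses G) (a : ℕ) : terwilliger G :=
  dualIdem c * block c b ^ a

variable (G) in
open Classical in
/-- The all-ones matrix `J`, the sum of all adjacency matrices, as an element of `T(G)`. -/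
def allOnes : terwilliger G :=
  ∑ c : ConjClasses G, adj c

/-- The complex vector space underlying a two-sided ideal of `T(G)`. -/
def idealSpace (I : TwoSidedIdeal (terwilliger G)) : Submodule ℂ (terwilliger G) :=
  (TwoSidedIdeal.asIdeal I).restrictScalars ℂ

variable (G) in
/-- The primary component of `T(G)`: the two-sided ideal generated by `J`, in other words the
span of the matrices `E_c^* J E_b^*`. (The matrix `J` maps the base vector to the all-ones vector,
so this ideal acts nontrivially on the primary module.) -/
def primaryComponent : TwoSidedIdeal (terwilliger G) :=
  TwoSidedIdeal.span {allOnes G}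

/-- The matrix
`p⁻ᵏ ∑_a ∏_j ζ ^ (α_j a_j) (E_c^* A_j E_c^*) ^ (a_j)`, with `a` ranging over `{0, …, p-1} ^ k` and
`A_j` the adjacency matrix of the class of `z_j`. -/
def centralGenerator {p k : ℕ} (ζ : ℂ) (z : Fin k → G) (c : ConjClasses G)
    (α : Fin k → Fin p) : terwilliger G :=
  (1 / (p : ℂ) ^ k) • ∑ a : Fin k → Fin p,
    (List.ofFn fun j : Fin k =>
      ζ ^ ((α j : ℕ) * (a j : ℕ)) • blockPow c (ConjClasses.mk (z j)) (a j)).prod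

open Classical in
/-- The matrix
`p⁻⁽ⁿ⁺ᵏ⁾ (∑_z E_c^* A_z E_c^* + ∑_a p ^ k ∏_j (ζ ^ (γ_j a_j) / p ^ (a_j k)) (E_c^* B_j E_c^*) ^ (a_j))`
with `z` ranging over the centre, `A_z` the adjacency matrix of the class `{z}`, `a` ranging over
the nonzero elements of `{0, …, p-1} ^ n`, and `B_j` the adjacency matrix of the class of `h_j`. -/
def derivedGenerator {p n : ℕ} (k : ℕ) (ζ : ℂ) (h : Fin n → G) (c : ConjClasses G)
    (γ : Fin n → Fin p) : terwilliger G :=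
  (1 / (p : ℂ) ^ (n + k)) •
    ((∑ z : Subgroup.center G, block c (ConjClasses.mk (z : G))) +
      ∑ a : NonzeroTuple p n, (p : ℂ) ^ k •
        (List.ofFn fun j : Fin n =>
          (ζ ^ ((γ j : ℕ) * (a.1 j : ℕ)) / (p : ℂ) ^ ((a.1 j : ℕ) * k)) •
            blockPow c (ConjClasses.mk (h j)) (a.1 j)).prod)

end Matrices

/-- The index set of the summands in the decomposition. -/
inductive SummandIndex (G : Type*) [Group G] (p n k : ℕ)
  | primary : SummandIndex G p n k
  | W (i : InnerClass G) (α : NonzeroTuple p k) : SummandIndex G p n k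
  | X (t : OuterClass G) (β : NonzeroTuple p k) : SummandIndex G p n k
  | Y (s : OuterClass G) (γ : NonzeroTuple p n) : SummandIndex G p n k

/-- The summands: the primary component, and the two-sided ideals generated by the matrices
`W_i(α)`, `X_t(β)` and `Y_s(γ)`. -/
def summand {G : Type*} [Group G] [Fintype G] [DecidableEq G] {p n k : ℕ} (ζ : ℂ)
    (z : Fin k → G) (h : Fin n → G) : SummandIndex G p n k → TwoSidedIdeal (terwilliger G)
  | .primary => primaryComponent G
  | .W i α => TwoSidedIdeal.span {centralGenerator ζ z i.1 α.1}
  | .X t β => TwoSidedIdeal.span {centralGenerator ζ z t.1 β.1}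
  | .Y s γ => TwoSidedIdeal.span {derivedGenerator k ζ h s.1 γ.1}

/-- `T(G)` is the internal direct sum of the given family of two-sided ideals. -/
def IsInternalSum {G : Type*} [Group G] [Fintype G] [DecidableEq G] {ι : Type*}
    (I : ι → TwoSidedIdeal (terwilliger G)) : Prop :=
  iSupIndep (fun i => idealSpace (I i)) ∧ ⨆ i, idealSpace (I i) = ⊤

/-- The elements `z_1, …, z_k` generate `Z(G)`. -/
def GeneratesCenter {G : Type*} [Group G] {k : ℕ} (z : Fin k → G) : Prop :=
  Subgroup.closure (Set.range z) = Subgroup.center G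

/-- The `h_j` lie in `G'`, and together with `Z(G)` they generate `G'`, which is to say that
(for `Z(G) ≤ G'`) their cosets generate `G' / Z(G)`. -/
def GeneratesDerivedModCenter {G : Type*} [Group G] {n : ℕ} (h : Fin n → G) : Prop :=
  Subgroup.closure (Set.range h) ⊔ Subgroup.center G = commutator G

end

/-! The group enters through one fact, recorded in `IsCaminaShape`: noncentral classes inside G' are
cosets of Z(G), and classes outside G' are cosets of G'. The latter is the Camina hypothesis. The
former says that [g, G] = Z(G) for every noncentral g in G', and takes linear algebra over the field
with p elements.

Put V = G/G', W = G'/γ₃. Commutation induces an alternating bilinear map b : V × V → W and a pairing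
F : W × V → γ₃. The Camina condition makes b(x, ·) surjective for x ≠ 0, and the Hall–Witt identity
becomes a Jacobi identity for b and F. The Pfaffian of the generic combination of the coordinates of
b has degree at most n in dim W variables and vanishes only at 0, so Chevalley–Warning gives dim W ≤
n (`two_mul_finrank_le_of_surjective`); since |G' : Z(G)| = p^n, this forces γ₃ = Z(G). A dimension
count from Jacobi (`injective_of_jacobi`) shows that φ ∘ F is injective on W for every nonzero
functional φ, so for noncentral g in G' the image [g, G] lies in no hyperplane of Z(G).

For the algebra, cut each A_b into blocks E_c^* A_b E_d^*. If c ≠ d, the class of y x⁻¹ depends only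
on c and d, so the block is zero or all ones. If c = d is noncentral, the differences y x⁻¹ lie in
Z(G) or in G', and a nonzero block is left translation on c by a central element, or the sum of the
translations by a coset of Z(G) in G'. These commute, so Fourier inversion over Z(G) ≅ (Z/p)^k and
G'/Z(G) ≅ (Z/p)^n replaces them by orthogonal idempotents. On an inner class the trivial character
of Z(G) gives a multiple of the all-ones block; on an outer class it gives the mean over Z(G), which
splits further under G'/Z(G), and there the trivial character gives the all-ones block. The matrices
W, X, Y are the idempotents at nontrivial characters.

The all-ones blocks are matrix units up to scalars and are orthogonal to these idempotents. All of
them lie in T(G), and their span is a subalgebra containing its generators, hence equal to T(G)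
(`IsMatrixUnitDecomposition`). Ideals, dimensions and directness follow from the multiplication
table. -/

/-! ### Alternating forms over a finite field: Pfaffians, Chevalley–Warning, Jacobi -/

/-- An alternating matrix over a field has square determinant. -/
theorem Matrix.isSquare_det_of_alternating {K : Type*} [Field K] (N : ℕ) :
    ∀ {ι : Type} [Fintype ι] [DecidableEq ι] (A : Matrix ι ι K), Fintype.card ι = N →
      (∀ i, A i i = 0) → (∀ i j, A i j = -A j i) → IsSquare A.det := by
  induction N using Nat.strong_induction_on with
  | _ N ih =>
  intro ι _ _ A hN hd ha
  by_cases hA : A = 0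
  · subst hA
    cases isEmpty_or_nonempty ι
    · rw [Matrix.det_isEmpty]; exact ⟨1, by simp⟩
    · rw [Matrix.det_zero]; exact ⟨0, by simp⟩
  obtain ⟨i, j, hij⟩ : ∃ i j, A i j ≠ 0 := by
    by_contra! h
    exact hA (by ext i j; exact h i j)
  have hne : i ≠ j := by
    rintro rfl
    exact hij (hd i)
  -- Reordering puts the nonzero entry a = A i j into a leading block [[0, a], [-a, 0]] of
  -- determinant a². Its Schur complement is again alternating and has two rows fewer.
  let f : Fin 2 ⊕ {x : ι // x ≠ i ∧ x ≠ j} → ι := Sum.elim ![i, j] Subtype.val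
  have hf : Function.Bijective f := by
    clear ih ha hd hij hA
    constructor
    · rintro (a | ⟨a, ha1, ha2⟩) (b | ⟨b, hb1, hb2⟩) h
      · have hne' := hne.symm
        fin_cases a <;> fin_cases b <;> simp_all [f]
      · have ha1' := hb1.symm
        have ha2' := hb2.symm
        fin_cases a <;> simp_all [f]
      · fin_cases b <;> simp_all [f]
      · simpa [f] using h
    · intro x
      by_cases h1 : x = i
      · exact ⟨Sum.inl 0, by simp [f, h1]⟩
      by_cases h2 : x = j
      · exact ⟨Sum.inl 1, by simp [f, h2]⟩
      exact ⟨Sum.inr ⟨x, h1, h2⟩, rfl⟩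
  let e := Equiv.ofBijective f hf
  rw [← Matrix.det_submatrix_equiv_self e A]
  set B := A.submatrix e e with hB
  rw [← Matrix.fromBlocks_toBlocks B]
  have h11 : B.toBlocks₁₁ = !![0, A i j; -A i j, 0] := by
    ext a b
    fin_cases a <;> fin_cases b <;> simp [hB, e, f, Matrix.toBlocks₁₁, hd, ← ha j i]
  have hdet : B.toBlocks₁₁.det = A i j * A i j := by
    rw [h11, Matrix.det_fin_two_of]; ring
  let I : Matrix (Fin 2) (Fin 2) K := !![0, -(A i j)⁻¹; (A i j)⁻¹, 0]
  let _ : Invertible B.toBlocks₁₁ := ⟨I, by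
    rw [h11]; ext a b
    fin_cases a <;> fin_cases b <;> simp [I, Matrix.mul_apply, hij], by
    rw [h11]; ext a b
    fin_cases a <;> fin_cases b <;> simp [I, Matrix.mul_apply, hij]⟩
  have hinv : ⅟B.toBlocks₁₁ = I := rfl
  rw [Matrix.det_fromBlocks₁₁, hdet, hinv]
  have hS : ∀ k l, (B.toBlocks₂₂ - B.toBlocks₂₁ * I * B.toBlocks₁₂) k l =
      A k l - (A i j)⁻¹ * (A k j * A i l - A k i * A j l) := by
    intro k l
    simp only [Matrix.sub_apply, Matrix.mul_apply, Fin.sum_univ_two]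
    simp [hB, e, f, Matrix.toBlocks₂₂, Matrix.toBlocks₁₂, Matrix.toBlocks₂₁, I]
    ring
  refine IsSquare.mul ⟨_, rfl⟩ (ih _ ?_ _ rfl ?_ ?_)
  · rw [← hN, ← Fintype.card_congr e, Fintype.card_sum, Fintype.card_fin]
    omega
  · intro k
    rw [hS, hd, ha i k, ha j k]; ring
  · intro k l
    rw [hS, hS, ha k l, ha k j, ha i l, ha k i, ha j l]; ring

/-- Over the fraction field the determinant is r². Then r is integral over the polynomial ring,
which is integrally closed, so r is itself a polynomial. -/
theorem MvPolynomial.isSquare_det_of_alternating {σ K : Type} [Field K]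
    {ι : Type} [Fintype ι] [DecidableEq ι] (A : Matrix ι ι (MvPolynomial σ K))
    (hd : ∀ i, A i i = 0) (ha : ∀ i j, A i j = -A j i) : IsSquare A.det := by
  let F := FractionRing (MvPolynomial σ K)
  have h := Matrix.isSquare_det_of_alternating _ (A.map (algebraMap (MvPolynomial σ K) F)) rfl
    (fun i => by simp [hd]) (fun i j => by simp [ha i j])
  obtain ⟨r, hr⟩ := h
  have hdet : (A.map (algebraMap (MvPolynomial σ K) F)).det = algebraMap _ F A.det := by
    rw [RingHom.map_det]; rfl
  rw [hdet] at hr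
  have hint : IsIntegral (MvPolynomial σ K) r := by
    have h2 : IsIntegral (MvPolynomial σ K) (r ^ 2) := by
      rw [pow_two, ← hr]; exact isIntegral_algebraMap
    exact h2.of_pow (by norm_num)
  obtain ⟨s, hs⟩ := IsIntegrallyClosed.isIntegral_iff.mp hint
  refine ⟨s, IsFractionRing.injective (MvPolynomial σ K) F ?_⟩
  rw [map_mul, hs, hr]

theorem MvPolynomial.totalDegree_det_le {σ K ι : Type*} [Field K] [Fintype ι] [DecidableEq ι]
    (A : Matrix ι ι (MvPolynomial σ K)) (hA : ∀ i j, (A i j).totalDegree ≤ 1) :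
    A.det.totalDegree ≤ Fintype.card ι := by
  rw [Matrix.det_apply]
  refine MvPolynomial.totalDegree_finsetSum_le fun g _ => ?_
  have h1 : (∏ i, A (g i) i).totalDegree ≤ Fintype.card ι := by
    refine (MvPolynomial.totalDegree_finsetProd _ _).trans ?_
    refine (Finset.sum_le_card_nsmul _ _ 1 fun i _ => hA _ _).trans ?_
    simp
  rcases Int.units_eq_one_or (Equiv.Perm.sign g) with h | h <;> rw [h]
  · simpa using h1
  · simpa using h1

/-- A space of alternating forms over a finite prime field, all of whose nonzero members are
nondegenerate, has dimension at most half the dimension of the underlying space. -/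
theorem two_mul_finrank_le_of_surjective {p : ℕ} [Fact p.Prime] {V W : Type*}
    [AddCommGroup V] [Module (ZMod p) V] [AddCommGroup W] [Module (ZMod p) W]
    [FiniteDimensional (ZMod p) V] [FiniteDimensional (ZMod p) W] [Nontrivial V]
    (b : V →ₗ[ZMod p] V →ₗ[ZMod p] W) (halt : ∀ x, b x x = 0)
    (hsurj : ∀ x, x ≠ 0 → Function.Surjective (b x)) :
    2 * Module.finrank (ZMod p) W ≤ Module.finrank (ZMod p) V := by
  have hanti : ∀ x y, b x y = -b y x := by
    intro x y
    have h := halt (x + y)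
    simp only [map_add, LinearMap.add_apply, halt, zero_add, add_zero] at h
    exact eq_neg_of_add_eq_zero_right h
  by_contra! hlt
  set d := Module.finrank (ZMod p) W
  set N := Module.finrank (ZMod p) V
  have hNpos : 0 < N := Module.finrank_pos
  let v : Module.Basis (Fin N) (ZMod p) V := Module.finBasis (ZMod p) V
  let w : Module.Basis (Fin d) (ZMod p) W := Module.finBasis (ZMod p) W
  -- The generic combination of the coordinate forms of b, with the indeterminates as coefficients.
  -- The square root r of its determinant plays the role of the Pfaffian.
  let M : Matrix (Fin N) (Fin N) (MvPolynomial (Fin d) (ZMod p)) := Matrix.of fun i j =>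
    ∑ l, MvPolynomial.C (w.repr (b (v i) (v j)) l) * MvPolynomial.X l
  obtain ⟨r, hr⟩ : IsSquare M.det := by
    refine MvPolynomial.isSquare_det_of_alternating M (fun i => ?_) (fun i j => ?_)
    · simp [M, halt]
    · simp only [M, Matrix.of_apply]
      rw [← Finset.sum_neg_distrib]
      refine Finset.sum_congr rfl fun l _ => ?_
      rw [hanti]; simp
  have hdeg : M.det.totalDegree ≤ N := by
    have hM : ∀ i j, (M i j).totalDegree ≤ 1 := by
      intro i j
      simp only [M, Matrix.of_apply]
      refine MvPolynomial.totalDegree_finsetSum_le fun l _ => ?_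
      exact (MvPolynomial.totalDegree_mul _ _).trans (by simp)
    simpa using MvPolynomial.totalDegree_det_le M hM
  have hev : ∀ c : Fin d → ZMod p, MvPolynomial.eval c M.det =
      (Matrix.of fun i j => ∑ l, w.repr (b (v i) (v j)) l * c l : Matrix _ _ _).det := by
    intro c
    rw [RingHom.map_det]
    congr 1
    ext i j
    simp [M]
  have hzero : ∀ c : Fin d → ZMod p, MvPolynomial.eval c r = 0 ↔ c = 0 := by
    intro c
    have h2 : MvPolynomial.eval c M.det = MvPolynomial.eval c r * MvPolynomial.eval c r := by
      rw [hr, map_mul]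
    constructor
    · intro h
      rw [h, zero_mul, hev] at h2
      -- A kernel vector of the specialised Gram matrix is some x ≠ 0 with lam ∘ b(x, ·) = 0. As
      -- b(x, ·) is onto, lam = 0, so c = 0.
      obtain ⟨a, ha0, ha⟩ := Matrix.exists_vecMul_eq_zero_iff.mpr h2
      let x : V := ∑ i, a i • v i
      have hx : x ≠ 0 := by
        intro hx
        exact ha0 (funext fun i => Fintype.linearIndependent_iff.mp v.linearIndependent a hx i)
      let lam : W →ₗ[ZMod p] ZMod p := ∑ l, c l • w.coord l
      have hlam : ∀ y, lam y = ∑ l, w.repr y l * c l := by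
        intro y; simp [lam, mul_comm (c _)]
      have hxj : ∀ j, lam (b x (v j)) = 0 := by
        intro j
        have := congrFun ha j
        simp only [Matrix.vecMul, dotProduct, Matrix.of_apply, Pi.zero_apply] at this
        simp only [x, map_sum, map_smul, LinearMap.sum_apply, LinearMap.smul_apply, smul_eq_mul]
        simpa only [hlam] using this
      have hxy : ∀ y, lam (b x y) = 0 := by
        have : lam ∘ₗ b x = 0 := v.ext fun j => by simpa using hxj j
        intro y; exact LinearMap.congr_fun this y
      ext l
      obtain ⟨y, hy⟩ := hsurj x hx (w l)
      have h3 := hxy y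
      rw [hy, hlam] at h3
      simpa [Finsupp.single_apply] using h3
    · rintro rfl
      have : MvPolynomial.eval (0 : Fin d → ZMod p) M.det = 0 := by
        rw [hev]
        have : Nonempty (Fin N) := ⟨⟨0, hNpos⟩⟩
        convert Matrix.det_zero (n := Fin N) using 2
        ext i j; simp
      rw [h2] at this
      exact mul_self_eq_zero.mp this
  have hr0 : r ≠ 0 := by
    rintro rfl
    have hd : 0 < d := by omega
    have := (hzero (fun _ => 1)).mp (by simp)
    exact one_ne_zero (congrFun this ⟨0, hd⟩)
  have hrdeg : r.totalDegree < Fintype.card (Fin d) := by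
    rw [hr, MvPolynomial.totalDegree_mul_of_isDomain hr0 hr0] at hdeg
    rw [Fintype.card_fin]; omega
  -- Chevalley–Warning applies because 2 deg r ≤ N < 2d. It makes p divide the number of zeros of r,
  -- which is 1.
  have hcw := char_dvd_card_solutions p hrdeg
  have hcard : Fintype.card {c : Fin d → ZMod p // MvPolynomial.eval c r = 0} = 1 := by
    rw [Fintype.card_eq_one_iff]
    exact ⟨⟨0, (hzero 0).mpr rfl⟩, fun y => Subtype.ext ((hzero _).mp y.2)⟩
  rw [hcard] at hcw
  exact (Fact.out : p.Prime).one_lt.ne' (Nat.dvd_one.mp hcw)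

/-- A nonzero pairing satisfying a Jacobi identity with a bilinear map `b` that is surjective in
its second argument is left nondegenerate. -/
theorem injective_of_jacobi {K V W : Type*} [Field K]
    [AddCommGroup V] [Module K V] [AddCommGroup W] [Module K W]
    [FiniteDimensional K V] [FiniteDimensional K W]
    (b : V →ₗ[K] V →ₗ[K] W) (f : W →ₗ[K] V →ₗ[K] K)
    (hsurj : ∀ x, x ≠ 0 → Function.Surjective (b x))
    (hjac : ∀ x y z, f (b x y) z + f (b y z) x + f (b z x) y = 0)
    (hf : f ≠ 0) (hdim : 2 * Module.finrank K W ≤ Module.finrank K V) :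
    Function.Injective f := by
  -- U is the right radical of f. Comparing ranks bounds dim V/U by dim W − dim ker f, and Jacobi
  -- bounds dim U by dim V/U. Hence dim V ≤ 2 (dim W − dim ker f), and `hdim` leaves no room for a
  -- kernel.
  set U := LinearMap.ker f.flip with hU
  have memU : ∀ {u}, u ∈ U ↔ ∀ w, f w u = 0 := by
    intro u
    rw [hU, LinearMap.mem_ker, LinearMap.ext_iff]; rfl
  obtain ⟨y, hy⟩ : ∃ y, y ∉ U := by
    by_contra! h
    exact hf (LinearMap.ext fun w => LinearMap.ext fun v => memU.mp (h v) w)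
  have h1 : Module.finrank K (V ⧸ U) ≤ Module.finrank K (W ⧸ LinearMap.ker f) := by
    let g : V →ₗ[K] Module.Dual K (W ⧸ LinearMap.ker f) := LinearMap.flip
      ((LinearMap.ker f).liftQ f le_rfl)
    have hg : ∀ w v, g v (Submodule.Quotient.mk w) = f w v := fun w v => rfl
    have hle : U = LinearMap.ker g := by
      ext u
      rw [memU, LinearMap.mem_ker]
      constructor
      · intro h
        exact Submodule.linearMap_qext _ (LinearMap.ext fun w => h w)
      · intro h w; rw [← hg, h]; rfl
    rw [hle, ← Subspace.dual_finrank_eq (V := W ⧸ LinearMap.ker f), g.quotKerEquivRange.finrank_eq]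
    exact Submodule.finrank_le _
  have h2 : Module.finrank K U ≤ Module.finrank K (V ⧸ U) := by
    let g0 : V →ₗ[K] V →ₗ[K] K := b.compr₂ (f.flip y)
    have hg0 : ∀ u x, g0 u x = f (b u x) y := fun u x => rfl
    -- For u and x both in the radical, two of the three Jacobi terms vanish, so x ↦ f(b u x) y
    -- descends to V/U.
    have hker : ∀ u : U, U ≤ LinearMap.ker (g0 u) := by
      intro u x hx
      rw [LinearMap.mem_ker, hg0]
      have := hjac u x y
      rwa [memU.mp u.2, memU.mp hx, add_zero, add_zero] at this
    let g : U →ₗ[K] Module.Dual K (V ⧸ U) :=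
      { toFun := fun u => U.liftQ (g0 u) (hker u)
        map_add' := fun u u' => by
          refine Submodule.linearMap_qext _ (LinearMap.ext fun x => ?_)
          simp
        map_smul' := fun c u => by
          refine Submodule.linearMap_qext _ (LinearMap.ext fun x => ?_)
          simp }
    have hg : ∀ u x, g u (Submodule.Quotient.mk x) = f (b u x) y := fun u x => rfl
    rw [← Subspace.dual_finrank_eq (V := V ⧸ U)]
    refine LinearMap.finrank_le_finrank_of_injective (f := g) ?_
    rw [← LinearMap.ker_eq_bot, LinearMap.ker_eq_bot']
    intro u hu
    by_contra hne
    -- A nonzero u sent to 0 would make f(·) y vanish on the range of b u, which is all of W,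
    -- contradicting y ∉ U.
    refine hy (memU.mpr fun w => ?_)
    obtain ⟨x, rfl⟩ := hsurj u (fun h => hne (Subtype.ext h)) w
    rw [← hg, hu]; rfl
  have h3 := U.finrank_quotient_add_finrank
  have h4 := (LinearMap.ker f).finrank_quotient_add_finrank
  rw [← LinearMap.ker_eq_bot, ← Submodule.finrank_eq_zero (R := K)]
  omega

/-! ### Commutators in Camina p-groups of class three -/

section CaminaClassThree

universe u

open scoped commutatorElement

/-- An elementary abelian `p`-quotient, viewed as a vector space over `ZMod p`. -/
theorem exists_zmod_module_quotient {p : ℕ} {A : Type u} [Group A] (N : Subgroup A) [N.Normal]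
    (hcomm : ∀ a b : A, (a * b)⁻¹ * (b * a) ∈ N) (hexp : ∀ a : A, a ^ p ∈ N) :
    ∃ (V : Type u) (_ : AddCommGroup V) (_ : Module (ZMod p) V) (π : A → V),
      Function.Surjective π ∧ (∀ a b, π (a * b) = π a + π b) ∧ (∀ a, π a = 0 ↔ a ∈ N) ∧
      Nat.card V = N.index := by
  let _ : CommGroup (A ⧸ N) :=
    { (inferInstance : Group (A ⧸ N)) with
      mul_comm := by
        rintro ⟨a⟩ ⟨b⟩
        exact QuotientGroup.eq.mpr (hcomm a b) }
  refine ⟨Additive (A ⧸ N), inferInstance, AddCommGroup.zmodModule ?_,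
    fun a => Additive.ofMul (QuotientGroup.mk a : A ⧸ N), ?_, fun a b => rfl, ?_, rfl⟩
  · rintro ⟨a⟩
    exact (QuotientGroup.eq_one_iff (a ^ p)).mpr (hexp a)
  · rintro ⟨a⟩
    exact ⟨a, rfl⟩
  · intro a
    exact QuotientGroup.eq_one_iff a

/-- A biadditive function on groups descends to a bilinear map on vector space quotients. -/
theorem exists_bilinear_lift {p : ℕ} {A B V V' W : Type*} [Group A] [Group B]
    [AddCommGroup V] [Module (ZMod p) V] [AddCommGroup V'] [Module (ZMod p) V']
    [AddCommGroup W] [Module (ZMod p) W]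
    (π : A → V) (π' : B → V') (hπ : Function.Surjective π) (hπ' : Function.Surjective π')
    (hmul : ∀ a b, π (a * b) = π a + π b) (hmul' : ∀ a b, π' (a * b) = π' a + π' b)
    (c : A → B → W) (hl : ∀ x y z, c (x * y) z = c x z + c y z)
    (hr : ∀ x y z, c x (y * z) = c x y + c x z)
    (hkl : ∀ x, π x = 0 → ∀ y, c x y = 0) (hkr : ∀ y, π' y = 0 → ∀ x, c x y = 0) :
    ∃ b : V →ₗ[ZMod p] V' →ₗ[ZMod p] W, ∀ x y, b (π x) (π' y) = c x y := by
  have hwl : ∀ x x' y, π x = π x' → c x y = c x' y := by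
    intro x x' y h
    have h1 : π (x * x'⁻¹) = 0 := by
      have h2 := hmul (x * x'⁻¹) x'
      rw [inv_mul_cancel_right, h] at h2
      simpa using h2
    have h3 := hl (x * x'⁻¹) x' y
    rwa [inv_mul_cancel_right, hkl _ h1, zero_add] at h3
  have hwr : ∀ x y y', π' y = π' y' → c x y = c x y' := by
    intro x y y' h
    have h1 : π' (y * y'⁻¹) = 0 := by
      have h2 := hmul' (y * y'⁻¹) y'
      rw [inv_mul_cancel_right, h] at h2
      simpa using h2
    have h3 := hr x (y * y'⁻¹) y'
    rwa [inv_mul_cancel_right, hkr _ h1, zero_add] at h3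
  choose s hs using hπ
  choose t ht using hπ'
  let b0 : V →+ V' →+ W := AddMonoidHom.mk' (fun v => AddMonoidHom.mk' (fun w => c (s v) (t w))
    (fun w w' => by rw [← hr]; exact hwr _ _ _ (by rw [hmul', ht, ht, ht])))
    (fun v v' => by
      ext w
      exact (hwl _ (s v * s v') _ (by rw [hmul, hs, hs, hs])).trans (hl _ _ _))
  let b1 : V →+ (V' →ₗ[ZMod p] W) := AddMonoidHom.mk' (fun v => (b0 v).toZModLinearMap p)
    (fun v v' => by ext w; simp)
  refine ⟨b1.toZModLinearMap p, fun x y => ?_⟩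
  exact (hwl _ x _ (hs _)).trans (hwr _ _ y (ht _))

variable {G : Type*} [Group G]

/-- When the triple commutators are central the outer conjugations disappear, and this becomes the
Jacobi identity. -/
theorem hall_witt (x y z : G) :
    y * ⁅⁅y⁻¹, x⁆, z⁆ * y⁻¹ * (z * ⁅⁅z⁻¹, y⁆, x⁆ * z⁻¹) * (x * ⁅⁅x⁻¹, z⁆, y⁆ * x⁻¹) = 1 := by
  simp only [commutatorElement_def]; group

theorem commutatorElement_mem_commutator (x y : G) : ⁅x, y⁆ ∈ commutator G :=
  Subgroup.commutator_mem_commutator (Subgroup.mem_top x) (Subgroup.mem_top y)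

theorem commutatorElement_mul_left' (x y z : G) : ⁅x * y, z⁆ = ⁅x, ⁅y, z⁆⁆ * ⁅y, z⁆ * ⁅x, z⁆ := by
  simp only [commutatorElement_def]; group

theorem commutatorElement_mul_right' (x y z : G) :
    ⁅x, y * z⁆ = ⁅x, y⁆ * ⁅y, ⁅x, z⁆⁆ * ⁅x, z⁆ := by
  simp only [commutatorElement_def]; group

/-- The class of x is a coset of G' containing x, so it contains a⁻¹x. If c conjugates x to a⁻¹x
then [c, x] = a⁻¹, and inverting gives [x, c] = a. -/
theorem IsCaminaGroup.exists_commutatorElement_eq (hG : IsCaminaGroup G) {x a : G}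
    (hx : x ∉ commutator G) (ha : a ∈ commutator G) : ∃ y, ⁅x, y⁆ = a := by
  obtain ⟨u, hu⟩ := hG x hx
  have hxu : x ∈ u • ((commutator G : Subgroup G) : Set G) := hu ▸ mem_conjugatesOf_self
  have hnx : a⁻¹ * x ∈ u • ((commutator G : Subgroup G) : Set G) := by
    rw [Set.mem_smul_set_iff_inv_smul_mem, smul_eq_mul, SetLike.mem_coe] at hxu ⊢
    have h1 : x⁻¹ * a⁻¹ * x ∈ commutator G := by
      have := Subgroup.Normal.conj_mem (inferInstance : (commutator G).Normal) a⁻¹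
        (inv_mem ha) x⁻¹
      simpa using this
    have h2 := mul_mem hxu h1
    convert h2 using 1
    group
  rw [← hu] at hnx
  obtain ⟨c, hc⟩ := isConj_iff.mp hnx
  refine ⟨c, ?_⟩
  have h3 : c * x * c⁻¹ * x⁻¹ = a⁻¹ := by rw [hc]; group
  rw [← inv_inj, ← h3, commutatorElement_def]; group

variable (G) in
/-- The third term of the lower central series. -/
abbrev gammaThree : Subgroup G := ⁅commutator G, (⊤ : Subgroup G)⁆

/-- Three subgroups lemma: [[G', G], G] = 1 implies [[G, G], G'] = 1. -/
theorem commute_of_mem_commutator (hZ : gammaThree G ≤ Subgroup.center G) {a b : G}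
    (ha : a ∈ commutator G) (hb : b ∈ commutator G) : a * b = b * a := by
  have h1 : ⁅⁅commutator G, (⊤ : Subgroup G)⁆, (⊤ : Subgroup G)⁆ = ⊥ := by
    rw [Subgroup.commutator_eq_bot_iff_le_centralizer, Subgroup.coe_top,
      Subgroup.centralizer_univ]
    exact hZ
  have h2 : ⁅⁅(⊤ : Subgroup G), (⊤ : Subgroup G)⁆, commutator G⁆ = ⊥ := by
    refine Subgroup.commutator_commutator_eq_bot_of_rotate ?_ h1
    rwa [Subgroup.commutator_comm ⊤ (commutator G)]
  have h3 : ⁅a, b⁆ ∈ ⁅⁅(⊤ : Subgroup G), (⊤ : Subgroup G)⁆, commutator G⁆ :=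
    Subgroup.commutator_mem_commutator ha hb
  rw [h2, Subgroup.mem_bot] at h3
  exact commutatorElement_eq_one_iff_mul_comm.mp h3

theorem commutatorElement_mem_gammaThree {g : G} (hg : g ∈ commutator G) (x : G) :
    ⁅g, x⁆ ∈ gammaThree G :=
  Subgroup.commutator_mem_commutator hg (Subgroup.mem_top x)

theorem commutatorElement_mem_gammaThree' {g : G} (hg : g ∈ commutator G) (x : G) :
    ⁅x, g⁆ ∈ gammaThree G := by
  rw [gammaThree, Subgroup.commutator_comm]
  exact Subgroup.commutator_mem_commutator (Subgroup.mem_top x) hg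

/-- The commutator of two elements, as an element of the derived subgroup. -/
def commElem (x y : G) : commutator G := ⟨⁅x, y⁆, commutatorElement_mem_commutator x y⟩

/-- The correction term [x^m, [x, y]] lies in γ₃, so commutation with y is multiplicative in powers
of x modulo γ₃. -/
theorem mk_commElem_pow (x y : G) (m : ℕ) :
    (QuotientGroup.mk (commElem (x ^ m) y) : commutator G ⧸ (gammaThree G).subgroupOf _) =
      (QuotientGroup.mk (commElem x y)) ^ m := by
  induction m with
  | zero =>
    have : commElem (x ^ 0) y = 1 := Subtype.ext (by simp [commElem])
    rw [this, pow_zero, QuotientGroup.mk_one]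
  | succ m ih =>
    have : commElem (x ^ (m + 1)) y =
        commElem (x ^ m) ⁅x, y⁆ * commElem x y * commElem (x ^ m) y :=
      Subtype.ext (by rw [pow_succ]; exact commutatorElement_mul_left' _ _ _)
    rw [this, QuotientGroup.mk_mul, QuotientGroup.mk_mul, ih, pow_succ',
      (QuotientGroup.eq_one_iff (commElem (x ^ m) ⁅x, y⁆)).mpr, one_mul]
    exact commutatorElement_mem_gammaThree' (commutatorElement_mem_commutator x y) _

/-- If x^p were outside G', every element of G'/γ₃ would have the form [x^p, y] = [x, y]^p. The p-th
power map would be onto, hence injective, on a finite p-group, which would therefore be trivial. -/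
theorem IsCaminaGroup.pow_mem_commutator [Finite G] {p : ℕ} [Fact p.Prime] (hp : IsPGroup p G)
    (hG : IsCaminaGroup G) (hne : ¬ commutator G ≤ gammaThree G) (x : G) :
    x ^ p ∈ commutator G := by
  by_contra hx
  have hsurj : Function.Surjective
      (fun q : commutator G ⧸ (gammaThree G).subgroupOf (commutator G) => q ^ p) := by
    rintro ⟨a, ha⟩
    obtain ⟨y, rfl⟩ := hG.exists_commutatorElement_eq hx ha
    exact ⟨_, (mk_commElem_pow x y p).symm⟩
  have hinj := Finite.injective_iff_surjective.mpr hsurj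
  refine hne fun a ha => ?_
  have hq : IsPGroup p (commutator G ⧸ (gammaThree G).subgroupOf (commutator G)) :=
    (hp.to_subgroup _).to_quotient _
  have hone : ∀ (m : ℕ) (q : commutator G ⧸ (gammaThree G).subgroupOf (commutator G)),
      q ^ p ^ m = 1 → q = 1 := by
    intro m
    induction m with
    | zero => intro q h; simpa using h
    | succ m ih =>
      intro q h
      rw [pow_succ, pow_mul] at h
      exact ih q (hinj (h.trans (one_pow p).symm))
  obtain ⟨m, hm⟩ := hq (QuotientGroup.mk ⟨a, ha⟩)
  exact (QuotientGroup.eq_one_iff (⟨a, ha⟩ : commutator G)).mp (hone m _ hm)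

/-- If G = G' then G' = [G, G] = [G', G] = γ₃. -/
theorem exists_notMem_commutator (hne : ¬ commutator G ≤ gammaThree G) :
    ∃ x : G, x ∉ commutator G := by
  by_contra! h
  have htop : commutator G = ⊤ := eq_top_iff.mpr fun x _ => h x
  refine hne ?_
  conv_lhs => rw [commutator_def]
  exact Subgroup.commutator_mono htop.ge le_rfl

/-- Write g = [x, y] with x outside G'. Modulo γ₃, g^p = [x^p, y], and this lies in γ₃ because x^p
lies in G'. -/
theorem IsCaminaGroup.pow_mem_gammaThree [Finite G] {p : ℕ} [Fact p.Prime] (hp : IsPGroup p G)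
    (hG : IsCaminaGroup G) (hne : ¬ commutator G ≤ gammaThree G) {g : G}
    (hg : g ∈ commutator G) : g ^ p ∈ gammaThree G := by
  obtain ⟨x, hx⟩ := exists_notMem_commutator hne
  obtain ⟨y, rfl⟩ := hG.exists_commutatorElement_eq hx hg
  have h := mk_commElem_pow x y p
  rw [← QuotientGroup.mk_pow, (QuotientGroup.eq_one_iff (commElem (x ^ p) y)).mpr] at h
  · exact (QuotientGroup.eq_one_iff (commElem x y ^ p)).mp h.symm
  · exact commutatorElement_mem_gammaThree (hG.pow_mem_commutator hp hne x) y

theorem commutatorElement_mul_right_of_mem (hZ : gammaThree G ≤ Subgroup.center G) {g : G}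
    (hg : g ∈ commutator G) (x y : G) : ⁅g, x * y⁆ = ⁅g, x⁆ * ⁅g, y⁆ := by
  rw [commutatorElement_mul_right', commutatorElement_eq_one_iff_mul_comm.mpr
    (Subgroup.mem_center_iff.mp (hZ (commutatorElement_mem_gammaThree hg y)) x), mul_one]

theorem commutatorElement_mul_left_of_mem (hZ : gammaThree G ≤ Subgroup.center G) {g h : G}
    (hh : h ∈ commutator G) (x : G) :
    ⁅g * h, x⁆ = ⁅g, x⁆ * ⁅h, x⁆ := by
  have h1 := Subgroup.mem_center_iff.mp (hZ (commutatorElement_mem_gammaThree hh x))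
  rw [commutatorElement_mul_left', commutatorElement_eq_one_iff_mul_comm.mpr (h1 g), one_mul]
  exact (h1 _).symm

/-- On generators, [g, x]^p = [g, x^p] = 1, since x^p lies in G' and G' is abelian. -/
theorem IsCaminaGroup.pow_eq_one_of_mem_gammaThree [Finite G] {p : ℕ} [Fact p.Prime]
    (hp : IsPGroup p G) (hG : IsCaminaGroup G) (hne : ¬ commutator G ≤ gammaThree G)
    (hZ : gammaThree G ≤ Subgroup.center G) {a : G} (ha : a ∈ gammaThree G) : a ^ p = 1 := by
  have hsub : gammaThree G = Subgroup.closure {a | ∃ g ∈ commutator G, ∃ x ∈ (⊤ : Subgroup G),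
    ⁅g, x⁆ = a} := Subgroup.commutator_def _ _
  rw [hsub] at ha
  induction ha using Subgroup.closure_induction with
  | mem a h =>
    obtain ⟨g, hg, x, -, rfl⟩ := h
    have hpow : ∀ m : ℕ, ⁅g, x ^ m⁆ = ⁅g, x⁆ ^ m := by
      intro m
      induction m with
      | zero => simp
      | succ m ih => rw [pow_succ, pow_succ, commutatorElement_mul_right_of_mem hZ hg, ih]
    rw [← hpow, commutatorElement_eq_one_iff_mul_comm]
    exact commute_of_mem_commutator hZ hg (hG.pow_mem_commutator hp hne x)
  | one => exact one_pow p
  | mul a b ha hb iha ihb =>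
    rw [← hsub] at ha hb
    have hc : Commute a b := (Subgroup.mem_center_iff.mp (hZ hb) a)
    rw [hc.mul_pow, iha, ihb, one_mul]
  | inv a ha ih =>
    rw [inv_pow, ih, inv_one]

/-- In a Camina `p`-group of class three with `|G : G'| = p ^ (2 n)` and `|G' : Z(G)| = p ^ n`, the
centre is the third term of the lower central series, and commutation with a noncentral element
of `G'` maps onto the centre. -/
theorem IsCaminaGroup.center_eq_gammaThree_and_surjective [Finite G] {p n : ℕ} [Fact p.Prime]
    (hp : IsPGroup p G) (hG : IsCaminaGroup G) (hZ : gammaThree G ≤ Subgroup.center G)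
    (hne : ¬ commutator G ≤ gammaThree G)
    (hZG : Subgroup.center G ≤ commutator G)
    (hn₂ : (commutator G).index = p ^ (2 * n))
    (hn₁ : (Subgroup.center G).relIndex (commutator G) = p ^ n) :
    Subgroup.center G = gammaThree G ∧
      ∀ g ∈ commutator G, g ∉ Subgroup.center G → ∀ z ∈ Subgroup.center G, ∃ x, ⁅g, x⁆ = z := by
  have hpp : p.Prime := Fact.out
  obtain ⟨V, _, _, π, hπ, hπmul, hπ0, hVcard⟩ := exists_zmod_module_quotient (p := p)
    (commutator G) (fun a b => by
      have : (a * b)⁻¹ * (b * a) = ⁅b⁻¹, a⁻¹⁆ := by rw [commutatorElement_def]; group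
      rw [this]; exact commutatorElement_mem_commutator _ _)
    (hG.pow_mem_commutator hp hne)
  obtain ⟨W, _, _, ρ, hρ, hρmul, hρ0, hWcard⟩ := exists_zmod_module_quotient (p := p)
    ((gammaThree G).subgroupOf (commutator G)) (fun a b => by
      have : (a * b)⁻¹ * (b * a) = 1 := by
        rw [inv_mul_eq_one]
        exact Subtype.ext (commute_of_mem_commutator hZ a.2 b.2)
      rw [this]; exact one_mem _)
    (fun a => hG.pow_mem_gammaThree hp hne a.2)
  obtain ⟨Z, _, _, σ, hσ, hσmul, hσ0, -⟩ := exists_zmod_module_quotient (p := p)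
    (⊥ : Subgroup (gammaThree G)) (fun a b => by
      rw [Subgroup.mem_bot, inv_mul_eq_one]
      exact Subtype.ext (Subgroup.mem_center_iff.mp (hZ b.2) a))
    (fun a => Subtype.ext (hG.pow_eq_one_of_mem_gammaThree hp hne hZ a.2))
  have : Finite V :=
    Nat.finite_of_card_ne_zero (by rw [hVcard]; exact Subgroup.index_ne_zero_of_finite)
  have : Finite W :=
    Nat.finite_of_card_ne_zero (by rw [hWcard]; exact Subgroup.index_ne_zero_of_finite)
  have : FiniteDimensional (ZMod p) V := Module.Finite.of_finite
  have : FiniteDimensional (ZMod p) W := Module.Finite.of_finite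
  have hVdim : Module.finrank (ZMod p) V = 2 * n := by
    have := Module.natCard_eq_pow_finrank (K := ZMod p) (V := V)
    rw [hVcard, hn₂, Nat.card_zmod] at this
    exact (Nat.pow_right_injective hpp.two_le this).symm
  have hWdim : (gammaThree G).relIndex (commutator G) = p ^ Module.finrank (ZMod p) W := by
    have := Module.natCard_eq_pow_finrank (K := ZMod p) (V := W)
    rwa [hWcard, Nat.card_zmod] at this
  obtain ⟨x₀, hx₀⟩ := exists_notMem_commutator hne
  have : Nontrivial V := ⟨⟨π x₀, 0, fun h => hx₀ ((hπ0 x₀).mp h)⟩⟩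
  obtain ⟨b, hb⟩ := exists_bilinear_lift (p := p) π π hπ hπ hπmul hπmul
    (fun x y => ρ (commElem x y))
    (fun x y z => by
      have : commElem (x * y) z = commElem x ⁅y, z⁆ * commElem y z * commElem x z :=
        Subtype.ext (commutatorElement_mul_left' _ _ _)
      rw [this, hρmul, hρmul, (hρ0 (commElem x ⁅y, z⁆)).mpr, zero_add, add_comm]
      exact commutatorElement_mem_gammaThree' (commutatorElement_mem_commutator y z) _)
    (fun x y z => by
      have : commElem x (y * z) = commElem x y * commElem y ⁅x, z⁆ * commElem x z :=
        Subtype.ext (commutatorElement_mul_right' _ _ _)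
      rw [this, hρmul, hρmul, (hρ0 (commElem y ⁅x, z⁆)).mpr, add_zero]
      exact commutatorElement_mem_gammaThree' (commutatorElement_mem_commutator x z) _)
    (fun x hx y => (hρ0 _).mpr (commutatorElement_mem_gammaThree ((hπ0 x).mp hx) y))
    (fun y hy x => (hρ0 _).mpr (commutatorElement_mem_gammaThree' ((hπ0 y).mp hy) x))
  have halt : ∀ x, b x x = 0 := by
    intro v
    obtain ⟨x, rfl⟩ := hπ v
    rw [hb, hρ0, show commElem x x = 1 from Subtype.ext (commutatorElement_self x)]
    exact one_mem _
  have hsurj : ∀ v, v ≠ 0 → Function.Surjective (b v) := by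
    intro v hv w
    obtain ⟨x, rfl⟩ := hπ v
    obtain ⟨⟨a, ha⟩, rfl⟩ := hρ w
    obtain ⟨y, rfl⟩ := hG.exists_commutatorElement_eq (fun h => hv ((hπ0 x).mpr h)) ha
    exact ⟨π y, hb x y⟩
  have hanti : ∀ x y, b x y = -b y x := by
    intro x y
    have h := halt (x + y)
    simp only [map_add, LinearMap.add_apply, halt, zero_add, add_zero] at h
    exact eq_neg_of_add_eq_zero_right h
  have hdim : 2 * Module.finrank (ZMod p) W ≤ Module.finrank (ZMod p) V :=
    two_mul_finrank_le_of_surjective b halt hsurj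
  have hcenter : Subgroup.center G = gammaThree G := by
    refine le_antisymm ?_ hZ
    rw [← Subgroup.relIndex_eq_one]
    -- |Z(G) : γ₃| · p^n = |G' : γ₃| = p^(dim W) ≤ p^n, so the first factor is 1.
    have h1 := Subgroup.relIndex_mul_relIndex _ _ _ hZ hZG
    rw [hn₁, hWdim] at h1
    have h2 : p ^ Module.finrank (ZMod p) W ≤ p ^ n := Nat.pow_le_pow_right hpp.pos (by omega)
    have h3 : 0 < p ^ n := pow_pos hpp.pos _
    have h4 : (gammaThree G).relIndex (Subgroup.center G) ≠ 0 := Subgroup.index_ne_zero_of_finite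
    have h5 : (gammaThree G).relIndex (Subgroup.center G) * p ^ n ≤ 1 * p ^ n := by
      rw [h1, one_mul]; exact h2
    have := Nat.le_of_mul_le_mul_right h5 h3
    omega
  refine ⟨hcenter, fun g hg hgZ => ?_⟩
  let κ : commutator G → G → gammaThree G := fun a x => ⟨⁅(a : G), x⁆,
    commutatorElement_mem_gammaThree a.2 x⟩
  have hκl : ∀ a a' x, κ (a * a') x = κ a x * κ a' x := fun a a' x =>
    Subtype.ext (commutatorElement_mul_left_of_mem hZ a'.2 x)
  have hκr : ∀ a x y, κ a (x * y) = κ a x * κ a y := fun a x y =>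
    Subtype.ext (commutatorElement_mul_right_of_mem hZ a.2 x y)
  obtain ⟨F, hF⟩ := exists_bilinear_lift (p := p) ρ π hρ hπ hρmul hπmul (fun a x => σ (κ a x))
    (fun a a' x => by rw [hκl, hσmul]) (fun a x y => by rw [hκr, hσmul])
    (fun a ha x => (hσ0 _).mpr (Subgroup.mem_bot.mpr (Subtype.ext
      (commutatorElement_eq_one_iff_mul_comm.mpr
        (Subgroup.mem_center_iff.mp (hZ ((hρ0 a).mp ha)) x).symm))))
    (fun x hx a => (hσ0 _).mpr (Subgroup.mem_bot.mpr (Subtype.ext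
      (commutatorElement_eq_one_iff_mul_comm.mpr
        (commute_of_mem_commutator hZ a.2 ((hπ0 x).mp hx))))))
  have hjac : ∀ x y z, F (b x y) z + F (b y z) x + F (b z x) y = 0 := by
    intro u v w
    obtain ⟨x, rfl⟩ := hπ u
    obtain ⟨y, rfl⟩ := hπ v
    obtain ⟨z, rfl⟩ := hπ w
    have hinv : ∀ x, π x⁻¹ = -π x := by
      intro x
      have h0 : π 1 = 0 := (hπ0 1).mpr (one_mem _)
      have := hπmul x⁻¹ x
      rw [inv_mul_cancel, h0] at this
      exact eq_neg_of_add_eq_zero_left this.symm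
    have hconj : ∀ (t : G) (a : gammaThree G), t * a * t⁻¹ = a := by
      intro t a
      rw [Subgroup.mem_center_iff.mp (hZ a.2) t, mul_inv_cancel_right]
    -- The inverses in Hall–Witt turn into signs, which antisymmetry of b absorbs: b(−y, x) = b(x,
    -- y).
    have hw := hall_witt x y z
    have hw' : κ (commElem y⁻¹ x) z * κ (commElem z⁻¹ y) x * κ (commElem x⁻¹ z) y = 1 := by
      refine Subtype.ext (Eq.trans ?_ hw)
      exact (congrArg₂ _ (congrArg₂ _ (hconj y (κ (commElem y⁻¹ x) z))
        (hconj z (κ (commElem z⁻¹ y) x))) (hconj x (κ (commElem x⁻¹ z) y))).symm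
    have h1 := congrArg σ hw'
    rw [hσmul, hσmul, (hσ0 1).mpr (one_mem _), ← hF, ← hF, ← hF, ← hb, ← hb, ← hb, hinv, hinv,
      hinv, map_neg, map_neg, map_neg] at h1
    simp only [LinearMap.neg_apply] at h1
    rw [← hanti, ← hanti, ← hanti] at h1
    rw [← h1]
  rw [hcenter]
  -- If [g, G] misses some z, then F(g, ·) has proper image and some functional φ ≠ 0 kills it.
  -- Injectivity of φ ∘ F then places g in γ₃ = Z(G).
  by_contra! hcon
  obtain ⟨z, hz, hzx⟩ := hcon
  let S : Submodule (ZMod p) Z := LinearMap.range (F (ρ ⟨g, hg⟩))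
  have hS : σ ⟨z, hz⟩ ∉ S := by
    rintro ⟨v, hv⟩
    obtain ⟨x, rfl⟩ := hπ v
    rw [hF] at hv
    have h0 : σ ((κ ⟨g, hg⟩ x)⁻¹ * ⟨z, hz⟩) = 0 := by
      have := hσmul (κ ⟨g, hg⟩ x) ((κ ⟨g, hg⟩ x)⁻¹ * ⟨z, hz⟩)
      rw [mul_inv_cancel_left, ← hv] at this
      simpa using this
    rw [hσ0, Subgroup.mem_bot, inv_mul_eq_one] at h0
    exact hzx x (congrArg Subtype.val h0)
  obtain ⟨φ, hφ, hφS⟩ := Submodule.exists_le_ker_of_lt_top S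
    (lt_top_iff_ne_top.mpr fun h => hS (h ▸ Submodule.mem_top))
  have hinj : Function.Injective (F.compr₂ φ) := by
    refine injective_of_jacobi b (F.compr₂ φ) hsurj (fun x y z => ?_) (fun h0 => hφ ?_) hdim
    · simp only [LinearMap.compr₂_apply]
      rw [← map_add, ← map_add, hjac, map_zero]
    -- If φ ∘ F were zero, φ would vanish on the commutators generating γ₃, hence everywhere.
    · have hsub : gammaThree G = Subgroup.closure {a | ∃ g ∈ commutator G,
        ∃ x ∈ (⊤ : Subgroup G), ⁅g, x⁆ = a} := Subgroup.commutator_def _ _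
      have key : ∀ a (ha : a ∈ gammaThree G), φ (σ ⟨a, ha⟩) = 0 := by
        intro a ha
        have ha' := ha
        rw [hsub] at ha'
        induction ha' using Subgroup.closure_induction with
        | mem a h =>
          obtain ⟨g', hg', x, -, rfl⟩ := h
          have := LinearMap.congr_fun (LinearMap.congr_fun h0 (ρ ⟨g', hg'⟩)) (π x)
          rwa [LinearMap.compr₂_apply, hF] at this
        | one =>
          have : σ ⟨1, ha⟩ = 0 := (hσ0 _).mpr (one_mem _)
          rw [this, map_zero]
        | mul a b ha1 hb1 iha ihb =>
          rw [← hsub] at ha1 hb1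
          have : σ ⟨a * b, ha⟩ = σ ⟨a, ha1⟩ + σ ⟨b, hb1⟩ := hσmul ⟨a, ha1⟩ ⟨b, hb1⟩
          rw [this, map_add, iha, ihb, add_zero]
        | inv a ha1 ih =>
          rw [← hsub] at ha1
          have h2 : σ (⟨a⁻¹, ha⟩ * ⟨a, ha1⟩) = 0 := (hσ0 _).mpr
            (Subgroup.mem_bot.mpr (Subtype.ext (inv_mul_cancel a)))
          rw [hσmul] at h2
          have h3 := congrArg φ h2
          rw [map_add, ih, add_zero, map_zero] at h3
          exact h3
      ext v
      obtain ⟨⟨a, ha⟩, rfl⟩ := hσ v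
      exact key a ha
  have hg0 : ρ ⟨g, hg⟩ = 0 := by
    refine hinj ?_
    rw [map_zero]
    ext v
    exact hφS ⟨v, rfl⟩
  exact hgZ (hcenter ▸ (hρ0 _).mp hg0)

end CaminaClassThree

/-! ### Conjugacy classes as cosets, and their number -/

section CaminaShape

open scoped commutatorElement

/-- The structure of a Camina `p`-group of class three that determines its group association
scheme: the classes in `G' \ Z(G)` are cosets of `Z(G)`, those outside `G'` are cosets of `G'`. -/
structure IsCaminaShape (G : Type*) [Group G] (p n k : ℕ) : Prop where
  center_le : Subgroup.center G ≤ commutator G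
  comm : ∀ a ∈ commutator G, ∀ b ∈ commutator G, a * b = b * a
  pow_center : ∀ z ∈ Subgroup.center G, z ^ p = 1
  pow_derived : ∀ g ∈ commutator G, g ^ p ∈ Subgroup.center G
  isConj_inner : ∀ g ∈ commutator G, g ∉ Subgroup.center G →
    ∀ h, IsConj g h ↔ h * g⁻¹ ∈ Subgroup.center G
  isConj_outer : ∀ g ∉ commutator G, ∀ h, IsConj g h ↔ h * g⁻¹ ∈ commutator G
  card_center : Nat.card (Subgroup.center G) = p ^ k
  card_derived : (Subgroup.center G).relIndex (commutator G) = p ^ n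
  card_top : (commutator G).index = p ^ (2 * n)
  center_ne_bot : Subgroup.center G ≠ ⊥

theorem isConj_iff_exists_commutatorElement {G : Type*} [Group G] {g h : G} :
    IsConj g h ↔ ∃ x : G, ⁅x, g⁆ = h * g⁻¹ := by
  rw [isConj_iff]
  simp only [commutatorElement_def, mul_left_inj]

theorem IsCaminaGroup.isCaminaShape {G : Type*} [Group G] [Finite G] [Group.IsNilpotent G]
    {p n k : ℕ} [Fact p.Prime] (hp : IsPGroup p G) (hG : IsCaminaGroup G)
    (hclass : Group.nilpotencyClass G = 3)
    (hn₂ : (commutator G).index = p ^ (2 * n))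
    (hn₁ : (Subgroup.center G).relIndex (commutator G) = p ^ n)
    (hk : Nat.card (Subgroup.center G) = p ^ k) : IsCaminaShape G p n k := by
  have hl1 : (⊤ : Subgroup G).lowerCentralSeries 1 = commutator G := by
    rw [Subgroup.lowerCentralSeries_succ, Subgroup.lowerCentralSeries_zero]; rfl
  have hl2 : (⊤ : Subgroup G).lowerCentralSeries 2 = gammaThree G := by
    rw [Subgroup.lowerCentralSeries_succ, hl1]
  have hl3 : (⊤ : Subgroup G).lowerCentralSeries 3 = ⁅gammaThree G, (⊤ : Subgroup G)⁆ := by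
    rw [Subgroup.lowerCentralSeries_succ, hl2]
  have hbot : ∀ m, (⊤ : Subgroup G).lowerCentralSeries m = ⊥ ↔ 3 ≤ m := fun m => by
    rw [Subgroup.lowerCentralSeries_eq_bot_iff_nilpotencyClass_le, hclass]
  have h3 := (hbot 3).mpr le_rfl
  have hZ : gammaThree G ≤ Subgroup.center G := by
    rw [hl3, Subgroup.commutator_eq_bot_iff_le_centralizer, Subgroup.coe_top,
      Subgroup.centralizer_univ] at h3
    exact h3
  have hγ : gammaThree G ≠ ⊥ := fun h => by
    have := (hbot 2).mp (hl2.trans h)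
    omega
  -- G' ≤ γ₃ would give γ₃ = [G', G] ≤ [γ₃, G] = 1, against class exactly three.
  have hne : ¬ commutator G ≤ gammaThree G := by
    intro h
    refine hγ (le_bot_iff.mp ?_)
    rw [← h3, hl3]
    exact Subgroup.commutator_mono h le_rfl
  have hZG : Subgroup.center G ≤ commutator G := by
    intro z hz
    by_contra hzG
    refine hne fun a ha => ?_
    -- A central z outside G' would make every element of G' a commutator [z, y] = 1.
    obtain ⟨y, rfl⟩ := hG.exists_commutatorElement_eq hzG ha
    rw [commutatorElement_eq_one_iff_mul_comm.mpr (Subgroup.mem_center_iff.mp hz y).symm]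
    exact one_mem _
  obtain ⟨hc, hs⟩ := hG.center_eq_gammaThree_and_surjective hp hZ hne hZG hn₂ hn₁
  refine ⟨hZG, fun a ha b hb => commute_of_mem_commutator hZ ha hb,
    fun z hz => hG.pow_eq_one_of_mem_gammaThree hp hne hZ (hc ▸ hz),
    fun g hg => hc ▸ hG.pow_mem_gammaThree hp hne hg, fun g hg hgZ h => ?_, fun g hg h => ?_,
    hk, hn₁, hn₂, hc ▸ hγ⟩
  · rw [isConj_iff_exists_commutatorElement]
    constructor
    · rintro ⟨x, hx⟩
      rw [← hx]
      exact hZ (commutatorElement_mem_gammaThree' hg x)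
    · intro hh
      -- Surjectivity is known for [g, ·] while conjugacy is expressed by [·, g]. Solving for the
      -- inverse element exchanges the two.
      obtain ⟨x, hx⟩ := hs g hg hgZ _ (inv_mem hh)
      exact ⟨x, by rw [← inv_inj, commutatorElement_inv, hx]⟩
  · rw [isConj_iff_exists_commutatorElement]
    constructor
    · rintro ⟨x, hx⟩
      rw [← hx]
      exact commutatorElement_mem_commutator x g
    · intro hh
      obtain ⟨x, hx⟩ := hG.exists_commutatorElement_eq hg (inv_mem hh)
      exact ⟨x, by rw [← inv_inj, commutatorElement_inv, hx]⟩

/-- Both targets are the quotient of X by the same relation. This counts classes: X is a set of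
group elements, A the classes, B the nontrivial cosets. -/
theorem Nat.card_eq_of_surjective_of_surjective {X A B : Type*} (f : X → A) (g : X → B)
    (hf : Function.Surjective f) (hg : Function.Surjective g)
    (h : ∀ x y, f x = f y ↔ g x = g y) : Nat.card A = Nat.card B := by
  have hker : Setoid.ker f = Setoid.ker g := Setoid.ext h
  have e := Setoid.quotientKerEquivOfSurjective f hf
  rw [hker] at e
  exact Nat.card_congr (e.symm.trans (Setoid.quotientKerEquivOfSurjective g hg))

theorem Nat.card_ne_one {Q : Type*} [One Q] [Finite Q] :
    Nat.card {q : Q // q ≠ 1} = Nat.card Q - 1 := by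
  have := Set.ncard_compl ({1} : Set Q)
  rw [Set.ncard_singleton] at this
  exact this

namespace IsCaminaShape

variable {G : Type*} [Group G] {p n k : ℕ} (hS : IsCaminaShape G p n k)
include hS

theorem card_innerClass [Finite G] : Nat.card (InnerClass G) = p ^ n - 1 := by
  have hQ : Nat.card (commutator G ⧸ (Subgroup.center G).subgroupOf (commutator G)) = p ^ n :=
    hS.card_derived
  rw [← hQ, ← Nat.card_ne_one]
  refine Nat.card_eq_of_surjective_of_surjective
    (X := {g : commutator G // (g : G) ∉ Subgroup.center G})
    (fun g => ⟨ConjClasses.mk (g.1 : G), fun x hx => ?_⟩)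
    (fun g => ⟨QuotientGroup.mk g.1, fun h => g.2 ((QuotientGroup.eq_one_iff g.1).mp h)⟩)
    ?_ ?_ ?_
  · rw [ConjClasses.mem_carrier_iff_mk_eq, ConjClasses.mk_eq_mk_iff_isConj] at hx
    have h1 := (hS.isConj_inner g.1 g.1.2 g.2 x).mp hx.symm
    constructor
    · have := mul_mem (hS.center_le h1) g.1.2
      rwa [inv_mul_cancel_right] at this
    · intro h
      refine g.2 ?_
      have := mul_mem (inv_mem h1) h
      simpa using this
  · rintro ⟨c, hc⟩
    obtain ⟨g, rfl⟩ := ConjClasses.mk_surjective c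
    have := hc (ConjClasses.mem_carrier_mk)
    exact ⟨⟨⟨g, this.1⟩, this.2⟩, rfl⟩
  · rintro ⟨⟨g⟩, hg⟩
    exact ⟨⟨g, fun h => hg ((QuotientGroup.eq_one_iff g).mpr h)⟩, rfl⟩
  · rintro ⟨g, hg⟩ ⟨h, hh⟩
    refine (Subtype.ext_iff.trans ?_).trans Subtype.ext_iff.symm
    change ConjClasses.mk (g : G) = ConjClasses.mk (h : G) ↔ (QuotientGroup.mk g :
      commutator G ⧸ (Subgroup.center G).subgroupOf (commutator G)) = QuotientGroup.mk h
    rw [ConjClasses.mk_eq_mk_iff_isConj,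
      hS.isConj_inner g g.2 hg, QuotientGroup.eq, Subgroup.mem_subgroupOf, Subgroup.coe_mul,
      Subgroup.coe_inv, hS.comm _ h.2 _ (inv_mem g.2)]

theorem card_outerClass [Finite G] : Nat.card (OuterClass G) = p ^ (2 * n) - 1 := by
  have hQ : Nat.card (G ⧸ commutator G) = p ^ (2 * n) := hS.card_top
  rw [← hQ, ← Nat.card_ne_one]
  refine Nat.card_eq_of_surjective_of_surjective
    (X := {g : G // g ∉ commutator G})
    (fun g => ⟨ConjClasses.mk g.1, fun x hx => ?_⟩)
    (fun g => ⟨QuotientGroup.mk g.1, fun h => g.2 ((QuotientGroup.eq_one_iff g.1).mp h)⟩)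
    ?_ ?_ ?_
  · rw [ConjClasses.mem_carrier_iff_mk_eq, ConjClasses.mk_eq_mk_iff_isConj] at hx
    have h1 := (hS.isConj_outer g.1 g.2 x).mp hx.symm
    intro h
    refine g.2 ?_
    have := mul_mem (inv_mem h1) h
    simpa using this
  · rintro ⟨c, hc⟩
    obtain ⟨g, rfl⟩ := ConjClasses.mk_surjective c
    exact ⟨⟨g, hc (ConjClasses.mem_carrier_mk)⟩, rfl⟩
  · rintro ⟨⟨g⟩, hg⟩
    exact ⟨⟨g, fun h => hg ((QuotientGroup.eq_one_iff g).mpr h)⟩, rfl⟩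
  · rintro ⟨g, hg⟩ ⟨h, hh⟩
    refine (Subtype.ext_iff.trans ?_).trans Subtype.ext_iff.symm
    change ConjClasses.mk g = ConjClasses.mk h ↔
      (QuotientGroup.mk g : G ⧸ commutator G) = QuotientGroup.mk h
    rw [ConjClasses.mk_eq_mk_iff_isConj,
      hS.isConj_outer g hg, QuotientGroup.eq]
    exact (inferInstance : (commutator G).Normal).mem_comm_iff

end IsCaminaShape

end CaminaShape

/-! ### Algebras spanned by matrix units and orthogonal idempotents -/

section MatrixUnits

theorem iSupIndep_of_projections {R M ι : Type*} [Ring R] [AddCommGroup M] [Module R M]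
    (t : ι → Submodule R M) (L : ι → M →ₗ[R] M) (hid : ∀ i, ∀ x ∈ t i, L i x = x)
    (hzero : ∀ i j, j ≠ i → ∀ x ∈ t j, L i x = 0) : iSupIndep t := by
  intro i
  rw [Submodule.disjoint_def]
  intro x hx hx'
  have hle : ⨆ j, ⨆ (_ : j ≠ i), t j ≤ LinearMap.ker (L i) :=
    iSup₂_le fun j hj y hy => hzero i j hj y hy
  rw [← hid i x hx]
  exact hle hx'

variable {A : Type*} [Ring A] [Algebra ℂ A]

theorem TwoSidedIdeal.smul_mem' (I : TwoSidedIdeal A) (c : ℂ) {x : A} (hx : x ∈ I) : c • x ∈ I := by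
  rw [← one_mul x, ← smul_mul_assoc]
  exact I.mul_mem_left _ _ hx

theorem TwoSidedIdeal.mem_of_smul_mem (I : TwoSidedIdeal A) {c : ℂ} (hc : c ≠ 0) {x : A}
    (hx : c • x ∈ I) : x ∈ I := by
  have := I.smul_mem' c⁻¹ hx
  rwa [inv_smul_smul₀ hc] at this

/-- A subspace closed under multiplication from both sides contains the two-sided ideal generated
by each of its elements. -/
theorem TwoSidedIdeal.mem_of_mem_span_singleton (P : Submodule ℂ A) (hl : ∀ a, ∀ x ∈ P, a * x ∈ P)
    (hr : ∀ a, ∀ x ∈ P, x * a ∈ P) {y x : A} (hy : y ∈ P) (hx : x ∈ TwoSidedIdeal.span {y}) :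
    x ∈ P := by
  let I : TwoSidedIdeal A := TwoSidedIdeal.mk' P P.zero_mem P.add_mem P.neg_mem
    (fun {a b} hb => hl a b hb) (fun {a b} ha => hr b a ha)
  have hI : ∀ z, z ∈ I ↔ z ∈ P := fun z => TwoSidedIdeal.mem_mk' ..
  rw [← hI]
  refine TwoSidedIdeal.mem_span_iff.mp hx I ?_
  rintro _ rfl
  exact (hI _).mpr hy

/-- A system of matrix units `u c d`, up to the scalars `w`, together with idempotents `e k` that
are orthogonal to each other and to the matrix units. -/
structure IsMatrixUnitSystem {ι κ : Type*} (u : ι → ι → A) (w : ι → ℂ) (e : κ → A) : Prop where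
  w_ne_zero : ∀ c, w c ≠ 0
  u_ne_zero : ∀ c d, u c d ≠ 0
  u_mul_u : ∀ c d f, u c d * u d f = w d • u c f
  u_mul_u_of_ne : ∀ c d d' f, d ≠ d' → u c d * u d' f = 0
  e_ne_zero : ∀ k, e k ≠ 0
  e_mul_e : ∀ k, e k * e k = e k
  e_mul_e_of_ne : ∀ k l, k ≠ l → e k * e l = 0
  e_mul_u : ∀ k c d, e k * u c d = 0
  u_mul_e : ∀ k c d, u c d * e k = 0

/-- A system of matrix units and orthogonal idempotents that spans the algebra. -/
structure IsMatrixUnitDecomposition {ι κ : Type*} (u : ι → ι → A) (w : ι → ℂ) (e : κ → A) : Prop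
    extends IsMatrixUnitSystem u w e where
  span_eq_top : Submodule.span ℂ (Set.range (fun q : ι × ι => u q.1 q.2) ∪ Set.range e) = ⊤

namespace IsMatrixUnitSystem

variable {ι κ : Type*} {u : ι → ι → A} {w : ι → ℂ} {e : κ → A}

/-- The product of two generators is a multiple of a generator or zero, so the span only lacks the
identity to be known as a subalgebra. -/
theorem mul_mem_span (h : IsMatrixUnitSystem u w e) {x y : A}
    (hx : x ∈ Submodule.span ℂ (Set.range (fun q : ι × ι => u q.1 q.2) ∪ Set.range e))
    (hy : y ∈ Submodule.span ℂ (Set.range (fun q : ι × ι => u q.1 q.2) ∪ Set.range e)) :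
    x * y ∈ Submodule.span ℂ (Set.range (fun q : ι × ι => u q.1 q.2) ∪ Set.range e) := by
  have hxy := Submodule.mul_mem_mul hx hy
  rw [Submodule.span_mul_span] at hxy
  refine Submodule.span_le.mpr ?_ hxy
  rintro _ ⟨s, (⟨⟨c, d⟩, rfl⟩ | ⟨k, rfl⟩), t, (⟨⟨c', d'⟩, rfl⟩ | ⟨l, rfl⟩), rfl⟩
  · change u c d * u c' d' ∈ _
    by_cases hd : d = c'
    · subst hd
      rw [h.u_mul_u]
      exact Submodule.smul_mem _ _ (Submodule.subset_span (Or.inl ⟨(c, d'), rfl⟩))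
    · rw [h.u_mul_u_of_ne _ _ _ _ hd]
      exact Submodule.zero_mem _
  · change u c d * e l ∈ _
    rw [h.u_mul_e]
    exact Submodule.zero_mem _
  · change e k * u c' d' ∈ _
    rw [h.e_mul_u]
    exact Submodule.zero_mem _
  · change e k * e l ∈ _
    by_cases hk : k = l
    · rw [hk, h.e_mul_e]
      exact Submodule.subset_span (Or.inr ⟨l, rfl⟩)
    · rw [h.e_mul_e_of_ne k l hk]
      exact Submodule.zero_mem _

/-- A system that lies in a subalgebra, and spans it, decomposes the subalgebra. -/
theorem isMatrixUnitDecomposition (h : IsMatrixUnitSystem u w e) {S : Subalgebra ℂ A}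
    {u' : ι → ι → S} {e' : κ → S} (hu : ∀ c d, (u' c d : A) = u c d) (he : ∀ k, (e' k : A) = e k)
    (hS : ∀ x ∈ S, x ∈ Submodule.span ℂ (Set.range (fun q : ι × ι => u q.1 q.2) ∪ Set.range e)) :
    IsMatrixUnitDecomposition u' w e' where
  w_ne_zero := h.w_ne_zero
  u_ne_zero c d h0 := h.u_ne_zero c d (by rw [← hu, h0]; rfl)
  u_mul_u c d f := Subtype.ext (by simpa [hu] using h.u_mul_u c d f)
  u_mul_u_of_ne c d d' f hd := Subtype.ext (by simpa [hu] using h.u_mul_u_of_ne c d d' f hd)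
  e_ne_zero k h0 := h.e_ne_zero k (by rw [← he, h0]; rfl)
  e_mul_e k := Subtype.ext (by simpa [he] using h.e_mul_e k)
  e_mul_e_of_ne k l hk := Subtype.ext (by simpa [he] using h.e_mul_e_of_ne k l hk)
  e_mul_u k c d := Subtype.ext (by simpa [hu, he] using h.e_mul_u k c d)
  u_mul_e k c d := Subtype.ext (by simpa [hu, he] using h.u_mul_e k c d)
  span_eq_top := by
    refine eq_top_iff.mpr fun x _ => ?_
    have hx := hS x x.2
    have hT : Set.range (fun q : ι × ι => u q.1 q.2) ∪ Set.range e =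
        S.val.toLinearMap '' (Set.range (fun q : ι × ι => u' q.1 q.2) ∪ Set.range e') := by
      rw [Set.image_union, ← Set.range_comp, ← Set.range_comp]
      exact congrArg₂ _ (congrArg _ (funext fun q => (hu _ _).symm))
        (congrArg _ (funext fun k => (he k).symm))
    rw [hT, Submodule.span_image] at hx
    obtain ⟨y, hy, hxy⟩ := hx
    exact (Subtype.ext hxy : y = x) ▸ hy

end IsMatrixUnitSystem

namespace IsMatrixUnitDecomposition

variable {ι κ : Type*} [Fintype ι] {u : ι → ι → A} {w : ι → ℂ} {e : κ → A}
  (h : IsMatrixUnitDecomposition u w e)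
include h

omit [Fintype ι] in
theorem mul_mem_of_generators {T : Set A} {P : Submodule ℂ A} (hP : P = Submodule.span ℂ T)
    (hT : ∀ x ∈ T, (∀ c d, u c d * x ∈ P) ∧ (∀ c d, x * u c d ∈ P) ∧ (∀ k, e k * x ∈ P) ∧
      ∀ k, x * e k ∈ P) (a : A) {x : A} (hx : x ∈ P) : a * x ∈ P ∧ x * a ∈ P := by
  have ha : a ∈ Submodule.span ℂ (Set.range (fun q : ι × ι => u q.1 q.2) ∪ Set.range e) := by
    rw [h.span_eq_top]; exact Submodule.mem_top
  constructor
  · have h1 : a * x ∈ Submodule.span ℂ (Set.range (fun q : ι × ι => u q.1 q.2) ∪ Set.range e) *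
        Submodule.span ℂ T := Submodule.mul_mem_mul ha (hP ▸ hx)
    rw [Submodule.span_mul_span] at h1
    refine Submodule.span_le.mpr ?_ h1
    rintro _ ⟨s, (⟨⟨c, d⟩, rfl⟩ | ⟨k, rfl⟩), t, ht, rfl⟩
    · exact (hT t ht).1 c d
    · exact (hT t ht).2.2.1 k
  · have h1 : x * a ∈ Submodule.span ℂ T *
        Submodule.span ℂ (Set.range (fun q : ι × ι => u q.1 q.2) ∪ Set.range e) :=
      Submodule.mul_mem_mul (hP ▸ hx) ha
    rw [Submodule.span_mul_span] at h1
    refine Submodule.span_le.mpr ?_ h1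
    rintro _ ⟨t, ht, s, (⟨⟨c, d⟩, rfl⟩ | ⟨k, rfl⟩), rfl⟩
    · exact (hT t ht).2.1 c d
    · exact (hT t ht).2.2.2 k

/-- Compressing between two units isolates a single coefficient. Linear independence of the units
and minimality of the ideal they span both rest on this. -/
theorem u_mul_sum_mul_u (a : ι → ι → ℂ) (c d f g : ι) :
    u f c * (∑ c', ∑ d', a c' d' • u c' d') * u d g = (w c * w d * a c d) • u f g := by
  classical
  have h1 : ∀ c' d', u f c * (a c' d' • u c' d') * u d g =
      if c' = c then (if d' = d then (w c * w d * a c d) • u f g else 0) else 0 := by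
    intro c' d'
    split_ifs with h1 h2
    · subst h1; subst h2
      rw [mul_smul_comm, h.u_mul_u, smul_mul_assoc, smul_mul_assoc, h.u_mul_u, smul_smul,
        smul_smul]
      congr 1; ring
    · rw [mul_assoc, smul_mul_assoc, h.u_mul_u_of_ne _ _ _ _ h2, smul_zero, mul_zero]
    · rw [mul_smul_comm, h.u_mul_u_of_ne _ _ _ _ (Ne.symm h1), smul_zero, zero_mul]
  simp only [Finset.mul_sum, Finset.sum_mul, h1]
  simp

omit [Fintype ι] in
theorem mem_span_e {k : κ} {x : A} :
    x ∈ TwoSidedIdeal.span {e k} ↔ x ∈ Submodule.span ℂ {e k} := by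
  classical
  constructor
  · refine TwoSidedIdeal.mem_of_mem_span_singleton _ ?_ ?_ (Submodule.mem_span_singleton_self _)
    all_goals
      intro a x hx
      have := h.mul_mem_of_generators (T := {e k}) rfl (by
        rintro _ rfl
        refine ⟨fun c d => ?_, fun c d => ?_, fun l => ?_, fun l => ?_⟩
        · rw [h.u_mul_e]; exact zero_mem _
        · rw [h.e_mul_u]; exact zero_mem _
        · by_cases hl : l = k
          · rw [hl, h.e_mul_e]; exact Submodule.mem_span_singleton_self _
          · rw [h.e_mul_e_of_ne _ _ hl]; exact zero_mem _
        · by_cases hl : l = k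
          · rw [hl, h.e_mul_e]; exact Submodule.mem_span_singleton_self _
          · rw [h.e_mul_e_of_ne _ _ (Ne.symm hl)]; exact zero_mem _) a hx
    · exact this.1
    · exact this.2
  · intro hx
    obtain ⟨c, rfl⟩ := Submodule.mem_span_singleton.mp hx
    exact TwoSidedIdeal.smul_mem' _ _ (TwoSidedIdeal.subset_span rfl)

theorem u_mem_of_sum_mem {I : TwoSidedIdeal A} {a : ι → ι → ℂ} {c d : ι} (hcd : a c d ≠ 0)
    (hI : ∑ c, ∑ d, a c d • u c d ∈ I) (f g : ι) : u f g ∈ I := by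
  refine I.mem_of_smul_mem (mul_ne_zero (mul_ne_zero (h.w_ne_zero c) (h.w_ne_zero d)) hcd) ?_
  rw [← h.u_mul_sum_mul_u]
  exact I.mul_mem_right _ _ (I.mul_mem_left _ _ hI)

theorem mem_span_sum_u {J x : A} (hJ : J = ∑ c, ∑ d, u c d) :
    x ∈ TwoSidedIdeal.span {J} ↔
      x ∈ Submodule.span ℂ (Set.range fun q : ι × ι => u q.1 q.2) := by
  classical
  constructor
  · have hT := h.mul_mem_of_generators
      (P := Submodule.span ℂ (Set.range fun q : ι × ι => u q.1 q.2)) rfl (by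
        rintro _ ⟨⟨c', d'⟩, rfl⟩
        refine ⟨fun c d => ?_, fun c d => ?_, fun l => ?_, fun l => ?_⟩
        · by_cases hd : d = c'
          · rw [hd, h.u_mul_u]
            exact Submodule.smul_mem _ _ (Submodule.subset_span ⟨(c, d'), rfl⟩)
          · rw [h.u_mul_u_of_ne _ _ _ _ hd]; exact zero_mem _
        · by_cases hd : d' = c
          · rw [← hd, h.u_mul_u]
            exact Submodule.smul_mem _ _ (Submodule.subset_span ⟨(c', d), rfl⟩)
          · rw [h.u_mul_u_of_ne _ _ _ _ hd]; exact zero_mem _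
        · rw [h.e_mul_u]; exact zero_mem _
        · rw [h.u_mul_e]; exact zero_mem _)
    refine TwoSidedIdeal.mem_of_mem_span_singleton _ (fun a x hx => (hT a hx).1)
      (fun a x hx => (hT a hx).2) ?_
    rw [hJ]
    exact Submodule.sum_mem _ fun c _ => Submodule.sum_mem _ fun d _ =>
      Submodule.subset_span ⟨(c, d), rfl⟩
  · intro hx
    induction hx using Submodule.span_induction with
    | mem x hx =>
      obtain ⟨⟨c, d⟩, rfl⟩ := hx
      refine h.u_mem_of_sum_mem (a := fun _ _ => 1) (c := c) (d := d) one_ne_zero ?_ c d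
      simp only [one_smul, ← hJ]
      exact TwoSidedIdeal.subset_span rfl
    | zero => exact zero_mem _
    | add x y _ _ hx hy => exact add_mem hx hy
    | smul c x _ hx => exact TwoSidedIdeal.smul_mem' _ _ hx

theorem linearIndependent_u : LinearIndependent ℂ fun q : ι × ι => u q.1 q.2 := by
  rw [Fintype.linearIndependent_iff]
  rintro a ha ⟨c, d⟩
  rw [Fintype.sum_prod_type] at ha
  have := h.u_mul_sum_mul_u (fun c d => a (c, d)) c d c d
  rw [ha, mul_zero, zero_mul, eq_comm, smul_eq_zero_iff_left (h.u_ne_zero c d)] at this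
  exact (mul_eq_zero.mp this).resolve_left (mul_ne_zero (h.w_ne_zero c) (h.w_ne_zero d))

theorem isAtom_span [Nonempty ι] {J : A} (hJ : J = ∑ c, ∑ d, u c d) :
    IsAtom (TwoSidedIdeal.span {J}) := by
  obtain ⟨c₀⟩ := ‹Nonempty ι›
  rw [isAtom_iff_le_of_ge]
  constructor
  · intro h0
    have : u c₀ c₀ ∈ TwoSidedIdeal.span {J} :=
      (h.mem_span_sum_u hJ).mpr (Submodule.subset_span ⟨(c₀, c₀), rfl⟩)
    rw [h0, TwoSidedIdeal.mem_bot] at this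
    exact h.u_ne_zero _ _ this
  · intro I hI hle
    obtain ⟨x, hx, hx0⟩ : ∃ x ∈ I, x ≠ 0 := by
      by_contra! hcon
      exact hI (le_bot_iff.mp fun x hx => (TwoSidedIdeal.mem_bot _).mpr (hcon x hx))
    obtain ⟨a, rfl⟩ := (Submodule.mem_span_range_iff_exists_fun ℂ).mp
      ((h.mem_span_sum_u hJ).mp (hle hx))
    obtain ⟨⟨c, d⟩, hcd⟩ : ∃ q, a q ≠ 0 := by
      by_contra! hcon
      exact hx0 (by simp [hcon])
    rw [Fintype.sum_prod_type] at hx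
    -- One nonzero coefficient of one element of I already forces every unit, hence J, into I.
    have hu := h.u_mem_of_sum_mem (a := fun c d => a (c, d)) (c := c) (d := d) hcd hx
    rw [TwoSidedIdeal.span_le]
    rintro _ rfl
    rw [hJ]
    exact sum_mem fun c _ => sum_mem fun d _ => hu c d

omit [Fintype ι] in
theorem iSup_span_eq_top {t : Option κ → Submodule ℂ A}
    (h0 : t none = Submodule.span ℂ (Set.range fun q : ι × ι => u q.1 q.2))
    (h1 : ∀ k, t (some k) = Submodule.span ℂ {e k}) : ⨆ i, t i = ⊤ := by
  rw [eq_top_iff, ← h.span_eq_top, Submodule.span_le]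
  rintro _ (⟨q, rfl⟩ | ⟨k, rfl⟩)
  · refine le_iSup t none ?_
    rw [h0]
    exact Submodule.subset_span ⟨q, rfl⟩
  · refine le_iSup t (some k) ?_
    rw [h1]
    exact Submodule.mem_span_singleton_self _

theorem iSupIndep_span {t : Option κ → Submodule ℂ A}
    (h0 : t none = Submodule.span ℂ (Set.range fun q : ι × ι => u q.1 q.2))
    (h1 : ∀ k, t (some k) = Submodule.span ℂ {e k}) : iSupIndep t := by
  classical
  have hone : ∀ c d, (∑ f, (w f)⁻¹ • u f f) * u c d = u c d := by
    intro c d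
    rw [Finset.sum_mul, Finset.sum_eq_single c]
    · rw [smul_mul_assoc, h.u_mul_u, inv_smul_smul₀ (h.w_ne_zero c)]
    · intro f _ hf
      rw [smul_mul_assoc, h.u_mul_u_of_ne _ _ _ _ hf, smul_zero]
    · simp
  -- The projection onto a summand is left multiplication by its identity element: the normalised
  -- sum of diagonal units for the primary one, e k for the others.
  refine iSupIndep_of_projections t
    (fun i => LinearMap.mulLeft ℂ (i.elim (∑ f, (w f)⁻¹ • u f f) e)) ?_ ?_
  · rintro (_ | k) x hx
    · rw [h0] at hx
      induction hx using Submodule.span_induction with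
      | mem x hx => obtain ⟨q, rfl⟩ := hx; exact hone _ _
      | zero => exact map_zero _
      | add x y _ _ hx hy => rw [map_add, hx, hy]
      | smul c x _ hx => rw [map_smul, hx]
    · rw [h1] at hx
      obtain ⟨c, rfl⟩ := Submodule.mem_span_singleton.mp hx
      rw [map_smul]
      exact congrArg _ (h.e_mul_e k)
  · rintro i (_ | k) hij x hx
    · rw [h0] at hx
      obtain ⟨l, rfl⟩ := Option.ne_none_iff_exists'.mp hij.symm
      induction hx using Submodule.span_induction with
      | mem x hx => obtain ⟨q, rfl⟩ := hx; exact h.e_mul_u _ _ _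
      | zero => exact map_zero _
      | add x y _ _ hx hy => rw [map_add, hx, hy, add_zero]
      | smul c x _ hx => rw [map_smul, hx, smul_zero]
    · rw [h1] at hx
      obtain ⟨c, rfl⟩ := Submodule.mem_span_singleton.mp hx
      rw [map_smul]
      rcases i with _ | l
      · have : (∑ f, (w f)⁻¹ • u f f) * e k = 0 := by
          rw [Finset.sum_mul]
          exact Finset.sum_eq_zero fun f _ => by rw [smul_mul_assoc, h.u_mul_e, smul_zero]
        exact (congrArg _ this).trans (smul_zero _)
      · have : e l * e k = 0 := h.e_mul_e_of_ne _ _ fun hlk => hij (by rw [hlk])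
        exact (congrArg _ this).trans (smul_zero _)

end IsMatrixUnitDecomposition

end MatrixUnits

/-! ### Fourier analysis on (Z/p)^m -/

section Fourier

variable {p m : ℕ} [Fact p.Prime] {A : Type*} [Ring A] [Algebra ℂ A]

/-- The component at the character `a ↦ ψ (α ⬝ a)` of a representation `D` of `(ZMod p) ^ m`. -/
noncomputable def fourierComponent (ψ : AddChar (ZMod p) ℂ) (D : (Fin m → ZMod p) → A)
    (α : Fin m → ZMod p) : A :=
  ((p : ℂ) ^ m)⁻¹ • ∑ a, ψ (α ⬝ᵥ a) • D a

theorem AddChar.sum_dotProduct {ψ : AddChar (ZMod p) ℂ} (hψ : ψ ≠ 1) (α : Fin m → ZMod p) :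
    ∑ a, ψ (α ⬝ᵥ a) = if α = 0 then (p : ℂ) ^ m else 0 := by
  let χ : AddChar (Fin m → ZMod p) ℂ :=
    { toFun := fun a => ψ (α ⬝ᵥ a)
      map_zero_eq_one' := by simp
      map_add_eq_mul' := fun a b => by rw [dotProduct_add, AddChar.map_add_eq_mul] }
  split_ifs with h
  · subst h
    simp
  · refine AddChar.sum_eq_zero_of_ne_one (ψ := χ) fun hχ => h ?_
    by_contra hα
    obtain ⟨j, hj⟩ := Function.ne_iff.mp hα
    refine hψ (DFunLike.ext _ _ fun x => ?_)
    -- Since α j ≠ 0, a vector supported at j gives α ⬝ a any prescribed value x; a trivial χ would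
    -- make ψ trivial.
    have h1 := DFunLike.congr_fun hχ (Pi.single j ((α j)⁻¹ * x))
    have h2 : ψ (α ⬝ᵥ Pi.single j ((α j)⁻¹ * x)) = 1 := h1
    rw [dotProduct_single, mul_inv_cancel_left₀ hj] at h2
    rw [h2, AddChar.one_apply]

variable {ψ : AddChar (ZMod p) ℂ} {D : (Fin m → ZMod p) → A}

/-- Substituting b ↦ a + b in the sum. The component is weighted by ψ(α ⬝ a), not its conjugate, so
D a acts by ψ(−α ⬝ a). -/
theorem mul_fourierComponent (hD : ∀ a b, D (a + b) = D a * D b) (a α : Fin m → ZMod p) :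
    D a * fourierComponent ψ D α = ψ (-(α ⬝ᵥ a)) • fourierComponent ψ D α := by
  rw [fourierComponent, mul_smul_comm, smul_comm (ψ _), Finset.mul_sum, Finset.smul_sum (r := ψ _)]
  refine congrArg _ ?_
  refine Fintype.sum_equiv (Equiv.addLeft a) _ _ fun b => ?_
  rw [Equiv.coe_addLeft, mul_smul_comm, ← hD, smul_smul, ← AddChar.map_add_eq_mul, dotProduct_add,
    neg_add_cancel_left]

/-- By orthogonality of characters, the component acts on an eigenvector of D' as projection to its
own character. All orthogonality relations below are instances, with θ = 0 when the translations fix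
v. -/
theorem fourierComponent_mul (D' : (Fin m → ZMod p) → A) (α : Fin m → ZMod p) (v : A)
    (θ : Fin m → ZMod p)
    (hv : ∀ a, D' a * v = ψ (-(θ ⬝ᵥ a)) • v) (hψ : ψ ≠ 1) :
    fourierComponent ψ D' α * v = if α = θ then v else 0 := by
  have hp : (p : ℂ) ^ m ≠ 0 := pow_ne_zero _ (Nat.cast_ne_zero.mpr (Fact.out : p.Prime).ne_zero)
  have h1 : ∀ a, (ψ (α ⬝ᵥ a) • D' a) * v = ψ ((α - θ) ⬝ᵥ a) • v := by
    intro a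
    rw [smul_mul_assoc, hv, smul_smul, ← AddChar.map_add_eq_mul, sub_dotProduct, sub_eq_add_neg]
  rw [fourierComponent, smul_mul_assoc, Finset.sum_mul]
  simp only [h1]
  rw [← Finset.sum_smul, AddChar.sum_dotProduct hψ]
  simp only [sub_eq_zero]
  split_ifs with h
  · rw [smul_smul, inv_mul_cancel₀ hp, one_smul]
  · rw [zero_smul, smul_zero]

theorem mul_fourierComponent_eq_zero {α : Fin m → ZMod p} (hψ : ψ ≠ 1) (hα : α ≠ 0) {v : A}
    (hv : ∀ a, v * D a = v) : v * fourierComponent ψ D α = 0 := by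
  rw [fourierComponent, mul_smul_comm, Finset.mul_sum]
  simp only [mul_smul_comm, hv]
  rw [← Finset.sum_smul, AddChar.sum_dotProduct hψ, if_neg hα, zero_smul, smul_zero]

theorem fourierComponent_mul_eq_zero {α : Fin m → ZMod p} (hψ : ψ ≠ 1) (hα : α ≠ 0) {v : A}
    (hv : ∀ a, D a * v = v) : fourierComponent ψ D α * v = 0 := by
  rw [fourierComponent_mul D α v 0 (by simpa using hv) hψ, if_neg hα]

theorem fourierComponent_mul_self (hψ : ψ ≠ 1) (hD : ∀ a b, D (a + b) = D a * D b)
    (α β : Fin m → ZMod p) : fourierComponent ψ D α * fourierComponent ψ D β =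
      if α = β then fourierComponent ψ D β else 0 :=
  fourierComponent_mul D α _ β (fun a => mul_fourierComponent hD a β) hψ

/-- Fourier inversion; through it the translations lie in the span of the components. -/
theorem sum_fourierComponent (hψ : ψ ≠ 1) (a : Fin m → ZMod p) :
    D a = ∑ α, ψ (-(α ⬝ᵥ a)) • fourierComponent ψ D α := by
  have hp : (p : ℂ) ^ m ≠ 0 := pow_ne_zero _ (Nat.cast_ne_zero.mpr (Fact.out : p.Prime).ne_zero)
  simp only [fourierComponent, Finset.smul_sum, smul_smul]
  rw [Finset.sum_comm]
  have h1 : ∀ b, ∑ α, (ψ (-(α ⬝ᵥ a)) * (((p : ℂ) ^ m)⁻¹ * ψ (α ⬝ᵥ b))) • D b =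
      if b = a then D b else 0 := by
    intro b
    have h2 : ∀ α : Fin m → ZMod p, ψ (-(α ⬝ᵥ a)) * (((p : ℂ) ^ m)⁻¹ * ψ (α ⬝ᵥ b)) =
        ((p : ℂ) ^ m)⁻¹ * ψ ((b - a) ⬝ᵥ α) := by
      intro α
      rw [mul_left_comm, ← AddChar.map_add_eq_mul, sub_dotProduct, dotProduct_comm b,
        dotProduct_comm a, sub_eq_add_neg, add_comm]
    simp only [h2]
    rw [← Finset.sum_smul, ← Finset.mul_sum, AddChar.sum_dotProduct hψ]
    simp only [sub_eq_zero]
    split_ifs with h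
    · rw [inv_mul_cancel₀ hp, one_smul]
    · rw [mul_zero, zero_smul]
  simp only [h1]
  simp

end Fourier

/-! ### Coordinates on elementary abelian sections -/

section Coordinates

universe u

/-- The product `v₁ ^ a₁ ⋯ vₘ ^ aₘ`. -/
def coordProd {G : Type*} [Group G] {p m : ℕ} (v : Fin m → G) (a : Fin m → ZMod p) : G :=
  (List.ofFn fun j => v j ^ (a j).val).prod

theorem map_prod_ofFn_pow {H V : Type*} [Group H] [AddCommGroup V] (π : H → V)
    (hπ : ∀ a b, π (a * b) = π a + π b) :
    ∀ {m : ℕ} (v : Fin m → H) (c : Fin m → ℕ),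
      π (List.ofFn fun j => v j ^ c j).prod = ∑ j, c j • π (v j) := by
  let f : H →* Multiplicative V := MonoidHom.mk' (fun h => Multiplicative.ofAdd (π h)) hπ
  intro m v c
  have h := map_list_prod f (List.ofFn fun j => v j ^ c j)
  rw [List.map_ofFn, List.prod_ofFn] at h
  refine (congrArg Multiplicative.toAdd h).trans ?_
  rw [toAdd_prod]
  refine Finset.sum_congr rfl fun j _ => ?_
  rw [Function.comp_apply, map_pow]
  rfl

variable {G : Type u} [Group G] {p m : ℕ}

theorem coordProd_mem {H : Subgroup G} {v : Fin m → G} (hv : ∀ j, v j ∈ H) (a : Fin m → ZMod p) :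
    coordProd v a ∈ H :=
  Subgroup.list_prod_mem _ fun x hx => by
    obtain ⟨j, rfl⟩ := List.mem_ofFn.mp hx
    exact pow_mem (hv j) _

theorem coe_coordProd {H : Subgroup G} (v : Fin m → H) (a : Fin m → ZMod p) :
    ((coordProd v a : H) : G) = coordProd (fun j => (v j : G)) a := by
  rw [coordProd, coordProd, Subgroup.val_list_prod, List.map_ofFn]
  rfl

variable [Fact p.Prime]

theorem exists_linear_coordinates [Finite G] (H N : Subgroup G) [N.Normal]
    (hcomm : ∀ a ∈ H, ∀ b ∈ H, a * b = b * a) (hexp : ∀ a ∈ H, a ^ p ∈ N)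
    (hidx : N.relIndex H = p ^ m) :
    ∃ (V : Type u) (_ : AddCommGroup V) (_ : Module (ZMod p) V) (π : H → V),
      Function.Surjective π ∧ (∀ a b, π (a * b) = π a + π b) ∧ (∀ a, π a = 0 ↔ (a : G) ∈ N) ∧
      Finite V ∧ Nat.card V = p ^ m ∧ ∀ (v : Fin m → H) (a : Fin m → ZMod p),
        π (coordProd v a) = ∑ j, a j • π (v j) := by
  obtain ⟨V, _, _, π, h1, h2, h3, h4⟩ := exists_zmod_module_quotient (p := p) (N.subgroupOf H)
    (fun a b => by
      rw [show b * a = a * b from Subtype.ext (hcomm _ b.2 _ a.2), inv_mul_cancel]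
      exact one_mem _) (fun a => hexp a a.2)
  have hcard : Nat.card V = p ^ m := h4.trans hidx
  refine ⟨V, _, ‹_›, π, h1, h2, h3, ?_, hcard, fun v a => ?_⟩
  · exact Nat.finite_of_card_ne_zero (by
      rw [hcard]; exact pow_ne_zero _ (Fact.out : p.Prime).ne_zero)
  · rw [coordProd, map_prod_ofFn_pow π h2]
    refine Finset.sum_congr rfl fun j _ => ?_
    rw [← Nat.cast_smul_eq_nsmul (ZMod p), ZMod.natCast_zmod_val]

/-- The products `v₁ ^ a₁ ⋯ vₘ ^ aₘ` with `a` in `(ZMod p) ^ m` represent each element of `H / N`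
exactly once, and multiply as the `a` add. -/
structure IsCoordinateSystem (p : ℕ) (H N : Subgroup G) (v : Fin m → G) : Prop where
  coordProd_mem : ∀ a : Fin m → ZMod p, coordProd v a ∈ H
  coordProd_add : ∀ a b : Fin m → ZMod p,
    coordProd v a * coordProd v b * (coordProd v (a + b))⁻¹ ∈ N
  exists_coordProd : ∀ g ∈ H, ∃ a : Fin m → ZMod p, g * (coordProd v a)⁻¹ ∈ N
  eq_of_coordProd : ∀ a b : Fin m → ZMod p, coordProd v a * (coordProd v b)⁻¹ ∈ N → a = b
  coordProd_zero : coordProd v (0 : Fin m → ZMod p) = 1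
  mem : ∀ j, v j ∈ H
  notMem : ∀ j, v j ∉ N

/-- Generators of `H` modulo `N` give coordinates on the elementary abelian group `H / N`. -/
theorem isCoordinateSystem [Finite G] {H N : Subgroup G} [N.Normal]
    (hcomm : ∀ a ∈ H, ∀ b ∈ H, a * b = b * a) (hexp : ∀ a ∈ H, a ^ p ∈ N)
    (hidx : N.relIndex H = p ^ m) {v : Fin m → G}
    (hv : Subgroup.closure (Set.range v) ⊔ N = H) : IsCoordinateSystem p H N v := by
  have hvH : ∀ j, v j ∈ H := fun j => by
    rw [← hv]
    exact (le_sup_left : _ ≤ Subgroup.closure (Set.range v) ⊔ N)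
      (Subgroup.subset_closure ⟨j, rfl⟩)
  have hNH : N ≤ H := hv ▸ le_sup_right
  obtain ⟨V, _, _, π, hπ, hmul, h0, _, hcard, hprod⟩ :=
    exists_linear_coordinates (p := p) H N hcomm hexp hidx
  let vH : Fin m → H := fun j => ⟨v j, hvH j⟩
  have hcoe : ∀ a : Fin m → ZMod p, ((coordProd vH a : H) : G) = coordProd v a :=
    fun a => coe_coordProd vH a
  let T : (Fin m → ZMod p) →ₗ[ZMod p] V := Fintype.linearCombination (ZMod p) (fun j => π (vH j))
  have hT : ∀ a, T a = π (coordProd vH a) := fun a => (hprod vH a).symm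
  have hπ1 : π 1 = 0 := (h0 1).mpr (one_mem _)
  have hinv : ∀ a, π a⁻¹ = -π a := fun a => by
    have := hmul a⁻¹ a
    rw [inv_mul_cancel, hπ1] at this
    exact eq_neg_of_add_eq_zero_left this.symm
  have hsurj : Function.Surjective T := by
    -- The elements of H whose image lies in the range of T form a subgroup containing the v j and
    -- N, hence all of H. Thus T is onto, and equal cardinalities make it bijective.
    let S : Subgroup G :=
      { carrier := {g | ∃ hg : g ∈ H, π ⟨g, hg⟩ ∈ LinearMap.range T}
        one_mem' := ⟨one_mem _, 0, by rw [map_zero]; exact hπ1.symm⟩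
        mul_mem' := by
          rintro a b ⟨ha, ha'⟩ ⟨hb, hb'⟩
          refine ⟨mul_mem ha hb, ?_⟩
          have := hmul ⟨a, ha⟩ ⟨b, hb⟩
          exact this ▸ add_mem ha' hb'
        inv_mem' := by
          rintro a ⟨ha, ha'⟩
          refine ⟨inv_mem ha, ?_⟩
          have := hinv ⟨a, ha⟩
          exact this ▸ neg_mem ha' }
    have hHS : H ≤ S := by
      rw [← hv]
      refine sup_le ((Subgroup.closure_le _).mpr ?_) ?_
      · rintro _ ⟨j, rfl⟩
        refine ⟨hvH j, Pi.single j 1, ?_⟩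
        simp [T, vH, Fintype.linearCombination_apply_single]
      · intro g hg
        exact ⟨hNH hg, 0, (map_zero T).trans ((h0 ⟨g, hNH hg⟩).mpr hg).symm⟩
    intro w
    obtain ⟨g, rfl⟩ := hπ w
    obtain ⟨_, hg⟩ := hHS g.2
    exact hg
  have hinj : Function.Injective T := by
    have hc : Nat.card (Fin m → ZMod p) = Nat.card V := by
      rw [hcard, Nat.card_fun, Nat.card_zmod, Nat.card_fin]
    exact ((Nat.bijective_iff_surjective_and_card T).mpr ⟨hsurj, hc⟩).1
  refine ⟨fun a => coordProd_mem hvH a, fun a b => ?_, fun g hg => ?_, fun a b hab => ?_, ?_, hvH,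
    fun j hj => ?_⟩
  · rw [← hcoe, ← hcoe, ← hcoe]
    refine (h0 (coordProd vH a * coordProd vH b * (coordProd vH (a + b))⁻¹)).mp ?_
    rw [hmul, hmul, hinv, ← hT, ← hT, ← hT, map_add, add_neg_cancel]
  · obtain ⟨a, ha⟩ := hsurj (π ⟨g, hg⟩)
    refine ⟨a, ?_⟩
    rw [← hcoe]
    refine (h0 (⟨g, hg⟩ * (coordProd vH a)⁻¹)).mp ?_
    rw [hmul, hinv, ← hT, ha, add_neg_cancel]
  · rw [← hcoe, ← hcoe] at hab
    have := (h0 (coordProd vH a * (coordProd vH b)⁻¹)).mpr hab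
    rw [hmul, hinv, ← hT, ← hT, ← sub_eq_add_neg, sub_eq_zero] at this
    exact hinj this
  · simp [coordProd]
  · have h1 : T (Pi.single j 1) = 0 := by
      have h2 : π (vH j) = 0 := (h0 (vH j)).mpr hj
      simpa [T, Fintype.linearCombination_apply_single] using h2
    have h2 := hinj (h1.trans (map_zero T).symm)
    simpa using congrFun h2 j

/-- Lifts of a basis of H/N, which is a vector space of dimension m. -/
theorem exists_generators [Finite G] {H N : Subgroup G} [N.Normal] (hNH : N ≤ H)
    (hcomm : ∀ a ∈ H, ∀ b ∈ H, a * b = b * a) (hexp : ∀ a ∈ H, a ^ p ∈ N)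
    (hidx : N.relIndex H = p ^ m) : ∃ v : Fin m → G, Subgroup.closure (Set.range v) ⊔ N = H := by
  obtain ⟨V, _, _, π, hπ, hmul, h0, _, hcard, hprod⟩ :=
    exists_linear_coordinates (p := p) H N hcomm hexp hidx
  have : FiniteDimensional (ZMod p) V := Module.Finite.of_finite
  have hdim : Module.finrank (ZMod p) V = m := by
    have := Module.natCard_eq_pow_finrank (K := ZMod p) (V := V)
    rw [hcard, Nat.card_zmod] at this
    exact (Nat.pow_right_injective (Fact.out : p.Prime).two_le this).symm
  let B := Module.finBasisOfFinrankEq (ZMod p) V hdim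
  choose s hs using hπ
  have hπ1 : π 1 = 0 := (h0 1).mpr (one_mem _)
  refine ⟨fun j => (s (B j) : G), le_antisymm (sup_le ((Subgroup.closure_le _).mpr ?_) hNH) ?_⟩
  · rintro _ ⟨j, rfl⟩
    exact (s (B j)).2
  · intro g hg
    let gH : H := ⟨g, hg⟩
    have h1 : π (coordProd (fun j => s (B j)) (B.repr (π gH))) = π gH := by
      rw [hprod]
      simp only [hs]
      exact B.sum_repr _
    set q := coordProd (fun j => s (B j)) (B.repr (π gH)) with hq
    have h2 : π (q⁻¹ * gH) = 0 := by
      have := hmul q (q⁻¹ * gH)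
      rw [mul_inv_cancel_left, h1] at this
      simpa using this
    have h3 : (q : G)⁻¹ * g ∈ N := (h0 _).mp h2
    have h4 : (q : G) ∈ Subgroup.closure (Set.range fun j => (s (B j) : G)) := by
      rw [hq, coe_coordProd]
      refine coordProd_mem (fun j => Subgroup.subset_closure ?_) _
      exact ⟨j, rfl⟩
    rw [← mul_inv_cancel_left (q : G) g]
    exact mul_mem (Subgroup.mem_sup_left h4) (Subgroup.mem_sup_right h3)

end Coordinates

/-! ### Translations and all-ones blocks on conjugacy classes -/

section ClassMatrices

variable {G : Type*} [Group G]

/-- Membership in a conjugacy class. -/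
def InClass (c : ConjClasses G) (x : G) : Prop := x ∈ c.carrier

theorem inClass_iff {c : ConjClasses G} {x : G} : InClass c x ↔ ConjClasses.mk x = c :=
  ConjClasses.mem_carrier_iff_mk_eq

theorem InClass.eq {c d : ConjClasses G} {x : G} (hc : InClass c x) (hd : InClass d x) : c = d :=
  (inClass_iff.mp hc).symm.trans (inClass_iff.mp hd)

theorem inClass_mk (x : G) : InClass (ConjClasses.mk x) x := inClass_iff.mpr rfl

theorem exists_inClass (c : ConjClasses G) : ∃ x, InClass c x := by
  obtain ⟨x, rfl⟩ := ConjClasses.mk_surjective c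
  exact ⟨x, inClass_mk x⟩

theorem InClass.isConj {c : ConjClasses G} {x : G} (hx : InClass c x) {y : G} :
    InClass c y ↔ IsConj x y := by
  rw [inClass_iff] at hx
  rw [inClass_iff, ← hx, ConjClasses.mk_eq_mk_iff_isConj, isConj_comm]

/-- The class `c` is stable under left multiplication by elements of `H`. -/
def ShiftStable (H : Subgroup G) (c : ConjClasses G) : Prop :=
  ∀ g ∈ H, ∀ x, InClass c x → InClass c (g * x)

theorem ShiftStable.iff {H : Subgroup G} {c : ConjClasses G} (hH : ShiftStable H c) {g : G}
    (hg : g ∈ H) (x : G) : InClass c (g * x) ↔ InClass c x := by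
  refine ⟨fun h => ?_, hH g hg x⟩
  have := hH g⁻¹ (inv_mem hg) _ h
  rwa [inv_mul_cancel_left] at this

open Classical in
/-- The matrix of left multiplication by `g`, restricted to rows in `c`. -/
noncomputable def classShift (c : ConjClasses G) (g : G) : Matrix G G ℂ :=
  Matrix.of fun x y => if InClass c x ∧ y = g * x then 1 else 0

open Classical in
/-- The all-ones matrix restricted to rows in `c` and columns in `d`. -/
noncomputable def classBlock (c d : ConjClasses G) : Matrix G G ℂ :=
  Matrix.of fun x y => if InClass c x ∧ InClass d y then 1 else 0

open Classical in
theorem classShift_apply (c : ConjClasses G) (g x y : G) :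
    classShift c g x y = if InClass c x ∧ y = g * x then 1 else 0 := rfl

open Classical in
theorem classBlock_apply (c d : ConjClasses G) (x y : G) :
    classBlock c d x y = if InClass c x ∧ InClass d y then 1 else 0 := rfl

open Classical in
theorem adjacencyMatrix_apply (b : ConjClasses G) (x y : G) :
    adjacencyMatrix b x y = if InClass b (y * x⁻¹) then 1 else 0 := rfl

theorem dualIdempotentMatrix_eq (c : ConjClasses G) : dualIdempotentMatrix c = classShift c 1 := by
  classical
  ext x y
  rw [dualIdempotentMatrix, Matrix.diagonal_apply, adjacencyMatrix_apply, classShift_apply]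
  by_cases h : x = y
  · subst h; simp
  · simp [h, Ne.symm h]

variable [Fintype G]

open Classical in
theorem classShift_mul_apply (c : ConjClasses G) (g : G) (M : Matrix G G ℂ) (x y : G) :
    (classShift c g * M) x y = if InClass c x then M (g * x) y else 0 := by
  rw [Matrix.mul_apply]
  simp only [classShift_apply, ite_and, ite_mul, one_mul, zero_mul]
  split_ifs <;> simp

open Classical in
theorem mul_classShift_apply (c : ConjClasses G) (g : G) (M : Matrix G G ℂ) (x y : G) :
    (M * classShift c g) x y = if InClass c (g⁻¹ * y) then M x (g⁻¹ * y) else 0 := by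
  rw [Matrix.mul_apply]
  simp only [classShift_apply, mul_ite, mul_one, mul_zero]
  rw [Finset.sum_eq_single (g⁻¹ * y)]
  · simp
  · intro w _ hw
    rw [if_neg]
    rintro ⟨-, rfl⟩
    simp at hw
  · simp

/-- The order is reversed because matrix rows are sources: x is sent to g x and then to h (g x).
Stability of the class keeps g x inside c. -/
theorem classShift_mul_classShift {H : Subgroup G} {c : ConjClasses G} (hH : ShiftStable H c)
    {g : G} (hg : g ∈ H) (h : G) : classShift c g * classShift c h = classShift c (h * g) := by
  classical
  ext x y
  rw [classShift_mul_apply, classShift_apply, classShift_apply]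
  simp only [hH.iff hg, mul_assoc]
  by_cases hx : InClass c x <;> simp [hx]

theorem classShift_one_mul (c : ConjClasses G) (g : G) :
    classShift c 1 * classShift c g = classShift c g := by
  classical
  ext x y
  rw [classShift_mul_apply, classShift_apply, classShift_apply]
  by_cases hx : InClass c x <;> simp [hx]

theorem classShift_mul_one {H : Subgroup G} {c : ConjClasses G} (hH : ShiftStable H c)
    {g : G} (hg : g ∈ H) : classShift c g * classShift c 1 = classShift c g := by
  rw [classShift_mul_classShift hH hg, one_mul]

theorem classShift_one_mul_of_ne {c d : ConjClasses G} (hcd : c ≠ d) (g : G) :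
    classShift c 1 * classShift d g = 0 := by
  classical
  ext x y
  rw [classShift_mul_apply, classShift_apply, Matrix.zero_apply, one_mul]
  split_ifs with h1 h2
  · exact absurd (h1.eq h2.1) hcd
  · rfl
  · rfl

theorem classShift_mul_classBlock {H : Subgroup G} {c : ConjClasses G} (hH : ShiftStable H c)
    {g : G} (hg : g ∈ H) (d : ConjClasses G) :
    classShift c g * classBlock c d = classBlock c d := by
  classical
  ext x y
  rw [classShift_mul_apply, classBlock_apply, classBlock_apply]
  simp only [hH.iff hg]
  by_cases hx : InClass c x <;> simp [hx]

theorem classBlock_mul_classShift {H : Subgroup G} {c : ConjClasses G} (hH : ShiftStable H c)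
    {g : G} (hg : g ∈ H) (d : ConjClasses G) :
    classBlock d c * classShift c g = classBlock d c := by
  classical
  ext x y
  rw [mul_classShift_apply, classBlock_apply, classBlock_apply]
  simp only [hH.iff (inv_mem hg)]
  by_cases hx : InClass c y <;> simp [hx]

theorem classBlock_mul_classShift_one (c d : ConjClasses G) :
    classBlock d c * classShift c 1 = classBlock d c := by
  classical
  ext x y
  rw [mul_classShift_apply, classBlock_apply, classBlock_apply, inv_one, one_mul]
  by_cases hx : InClass c y <;> simp [hx]

theorem classShift_one_mul_classBlock_of_ne {c d : ConjClasses G} (hcd : c ≠ d)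
    (f : ConjClasses G) : classShift c 1 * classBlock d f = 0 := by
  classical
  ext x y
  rw [classShift_mul_apply, classBlock_apply, Matrix.zero_apply, one_mul]
  split_ifs with h1 h2
  · exact absurd (h1.eq h2.1) hcd
  · rfl
  · rfl

theorem classBlock_mul_classShift_one_of_ne {c d : ConjClasses G} (hcd : c ≠ d)
    (f : ConjClasses G) : classBlock f d * classShift c 1 = 0 := by
  classical
  ext x y
  rw [mul_classShift_apply, classBlock_apply, Matrix.zero_apply, inv_one, one_mul]
  split_ifs with h1 h2
  · exact absurd (h1.eq h2.2) hcd
  · rfl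
  · rfl

/-- The size of a conjugacy class, as a complex number. -/
noncomputable def classSize (c : ConjClasses G) : ℂ := Nat.card {x // InClass c x}

omit [Group G] [Fintype G] in
theorem Nat.cast_card_subtype_ne_zero [Finite G] {P : G → Prop} (h : ∃ x, P x) :
    (Nat.card {x // P x} : ℂ) ≠ 0 := by
  obtain ⟨x, hx⟩ := h
  have : Nonempty {x // P x} := ⟨⟨x, hx⟩⟩
  exact Nat.cast_ne_zero.mpr Nat.card_pos.ne'

theorem classSize_ne_zero (c : ConjClasses G) : classSize c ≠ 0 :=
  Nat.cast_card_subtype_ne_zero (exists_inClass c)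

omit [Fintype G] in
theorem classBlock_ne_zero (c d : ConjClasses G) : classBlock c d ≠ 0 := by
  classical
  obtain ⟨x, hx⟩ := exists_inClass c
  obtain ⟨y, hy⟩ := exists_inClass d
  intro h
  have := congrFun (congrFun h x) y
  simp [classBlock_apply, hx, hy] at this

theorem classBlock_mul_classBlock (c d f : ConjClasses G) :
    classBlock c d * classBlock d f = classSize d • classBlock c f := by
  classical
  ext x y
  rw [Matrix.mul_apply, Matrix.smul_apply, classBlock_apply]
  have h : ∀ w, classBlock c d x w * classBlock d f w y =
      if InClass d w then (if InClass c x ∧ InClass f y then 1 else 0) else 0 := by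
    intro w
    rw [classBlock_apply, classBlock_apply]
    by_cases h1 : InClass d w <;> by_cases h2 : InClass c x <;> by_cases h3 : InClass f y <;>
      simp [h1, h2, h3]
  simp only [h]
  rw [← Finset.sum_filter, Finset.sum_const, classSize, Nat.card_eq_fintype_card,
    Fintype.card_subtype, nsmul_eq_mul, smul_eq_mul]

theorem classBlock_mul_classBlock_of_ne {c d d' f : ConjClasses G} (h : d ≠ d') :
    classBlock c d * classBlock d' f = 0 := by
  rw [← classBlock_mul_classShift_one d c, mul_assoc, classShift_one_mul_classBlock_of_ne h,
    mul_zero]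

variable [DecidableEq G]

theorem coe_dualIdem (c : ConjClasses G) : (dualIdem c : Matrix G G ℂ) = classShift c 1 :=
  dualIdempotentMatrix_eq c

theorem coe_allOnes_apply (x y : G) : (allOnes G : Matrix G G ℂ) x y = 1 := by
  classical
  rw [allOnes, AddSubmonoidClass.coe_finsetSum, Matrix.sum_apply]
  have : ∀ c : ConjClasses G, (adj c : Matrix G G ℂ) x y =
      if c = ConjClasses.mk (y * x⁻¹) then 1 else 0 := by
    intro c
    refine (adjacencyMatrix_apply c x y).trans ?_
    simp only [inClass_iff, eq_comm]
  simp [this]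

theorem coe_dualIdem_mul_allOnes_mul_dualIdem (c d : ConjClasses G) :
    ((dualIdem c * allOnes G * dualIdem d : terwilliger G) : Matrix G G ℂ) = classBlock c d := by
  classical
  ext x y
  rw [MulMemClass.coe_mul, MulMemClass.coe_mul, coe_dualIdem, coe_dualIdem, mul_classShift_apply,
    classShift_mul_apply, coe_allOnes_apply, classBlock_apply, inv_one, one_mul]
  by_cases h1 : InClass c x <;> by_cases h2 : InClass d y <;> simp [h1, h2]

theorem sum_coe_dualIdem : ∑ c : ConjClasses G, classShift c 1 = (1 : Matrix G G ℂ) := by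
  classical
  ext x y
  rw [Matrix.sum_apply, Matrix.one_apply, Finset.sum_eq_single (ConjClasses.mk x)]
  · rw [classShift_apply, one_mul]
    simp [inClass_mk, eq_comm]
  · intro c _ hc
    rw [classShift_apply, if_neg]
    rintro ⟨h, -⟩
    exact hc (inClass_iff.mp h).symm
  · simp

open Classical in
omit [DecidableEq G] in
theorem block_apply (c d b : ConjClasses G) (x y : G) :
    (classShift c 1 * adjacencyMatrix b * classShift d 1) x y =
      if InClass c x ∧ InClass d y ∧ InClass b (y * x⁻¹) then 1 else 0 := by
  rw [mul_classShift_apply, classShift_mul_apply, adjacencyMatrix_apply, inv_one, one_mul, one_mul]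
  by_cases h1 : InClass c x <;> by_cases h2 : InClass d y <;> simp [h1, h2]

end ClassMatrices

/-! ### Fourier components on a single class -/

section Components

theorem mul_fourierComponent_eq {p m : ℕ} [Fact p.Prime] {A : Type*} [Ring A] [Algebra ℂ A]
    (ψ : AddChar (ZMod p) ℂ) (D : (Fin m → ZMod p) → A) (α : Fin m → ZMod p) (v : A) :
    v * fourierComponent ψ D α = fourierComponent ψ (fun a => v * D a) α := by
  simp only [fourierComponent, mul_smul_comm, Finset.mul_sum]

theorem fourierComponent_mul_eq {p m : ℕ} [Fact p.Prime] {A : Type*} [Ring A] [Algebra ℂ A]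
    (ψ : AddChar (ZMod p) ℂ) (D : (Fin m → ZMod p) → A) (α : Fin m → ZMod p) (v : A) :
    fourierComponent ψ D α * v = fourierComponent ψ (fun a => D a * v) α := by
  simp only [fourierComponent, smul_mul_assoc, Finset.sum_mul]

variable {G : Type*} [Group G] [Fintype G]

open Classical in
/-- The average of the restricted shifts by central elements. -/
noncomputable def centralMean (c : ConjClasses G) : Matrix G G ℂ :=
  (Nat.card (Subgroup.center G) : ℂ)⁻¹ • ∑ z : Subgroup.center G, classShift c (z : G)

theorem card_center_ne_zero : (Nat.card (Subgroup.center G) : ℂ) ≠ 0 :=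
  Nat.cast_ne_zero.mpr Nat.card_pos.ne'

variable {c : ConjClasses G}

theorem classShift_mul_centralMean (hZ : ShiftStable (Subgroup.center G) c) {z : G}
    (hz : z ∈ Subgroup.center G) : classShift c z * centralMean c = centralMean c := by
  classical
  rw [centralMean, mul_smul_comm, Finset.mul_sum]
  congr 1
  refine Fintype.sum_equiv (Equiv.mulRight ⟨z, hz⟩) _ _ fun w => ?_
  rw [classShift_mul_classShift hZ hz]
  rfl

theorem centralMean_mul_classShift (hZ : ShiftStable (Subgroup.center G) c) {z : G}
    (hz : z ∈ Subgroup.center G) : centralMean c * classShift c z = centralMean c := by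
  classical
  rw [centralMean, smul_mul_assoc, Finset.sum_mul]
  congr 1
  refine Fintype.sum_equiv (Equiv.mulLeft ⟨z, hz⟩) _ _ fun w => ?_
  rw [classShift_mul_classShift hZ w.2]
  rfl

theorem classShift_commute_centralMean {H : Subgroup G} (hH : ShiftStable H c)
    (hZ : ShiftStable (Subgroup.center G) c) {g : G} (hg : g ∈ H) :
    classShift c g * centralMean c = centralMean c * classShift c g := by
  classical
  rw [centralMean, smul_mul_assoc, mul_smul_comm, Finset.sum_mul, Finset.mul_sum]
  congr 1
  refine Finset.sum_congr rfl fun w _ => ?_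
  rw [classShift_mul_classShift hZ w.2, classShift_mul_classShift hH hg,
    Subgroup.mem_center_iff.mp w.2]

theorem mul_centralMean_of_forall {v : Matrix G G ℂ}
    (hv : ∀ w ∈ Subgroup.center G, v * classShift c w = v) : v * centralMean c = v := by
  classical
  rw [centralMean, mul_smul_comm, Finset.mul_sum]
  have hw : ∀ w : Subgroup.center G, v * classShift c w = v := fun w => hv w w.2
  simp only [hw]
  rw [Finset.sum_const, Finset.card_univ, ← Nat.card_eq_fintype_card, ← Nat.cast_smul_eq_nsmul ℂ,
    inv_smul_smul₀ card_center_ne_zero]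

theorem centralMean_mul_of_forall {v : Matrix G G ℂ}
    (hv : ∀ w ∈ Subgroup.center G, classShift c w * v = v) : centralMean c * v = v := by
  classical
  rw [centralMean, smul_mul_assoc, Finset.sum_mul]
  have hw : ∀ w : Subgroup.center G, classShift c w * v = v := fun w => hv w w.2
  simp only [hw]
  rw [Finset.sum_const, Finset.card_univ, ← Nat.card_eq_fintype_card, ← Nat.cast_smul_eq_nsmul ℂ,
    inv_smul_smul₀ card_center_ne_zero]

theorem centralMean_mul_centralMean (hZ : ShiftStable (Subgroup.center G) c) :
    centralMean c * centralMean c = centralMean c :=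
  centralMean_mul_of_forall fun _ => classShift_mul_centralMean hZ

theorem centralMean_eq_sum_coordProd {p k : ℕ} {z : Fin k → G} [NeZero p]
    (hz : IsCoordinateSystem p (Subgroup.center G) ⊥ z)
    (hk : Nat.card (Subgroup.center G) = p ^ k) (c : ConjClasses G) :
    centralMean c =
      ((p : ℂ) ^ k)⁻¹ • ∑ a : Fin k → ZMod p, classShift c (coordProd z a) := by
  classical
  rw [centralMean, hk, Nat.cast_pow]
  refine congrArg _ (Eq.symm ?_)
  let f : (Fin k → ZMod p) → Subgroup.center G := fun a => ⟨coordProd z a, hz.coordProd_mem a⟩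
  have hf : Function.Bijective f := by
    refine ⟨fun a b h => ?_, fun w => ?_⟩
    · refine hz.eq_of_coordProd a b (Subgroup.mem_bot.mpr ?_)
      rw [mul_inv_eq_one]
      exact congrArg Subtype.val h
    · obtain ⟨a, ha⟩ := hz.exists_coordProd w w.2
      exact ⟨a, Subtype.ext (mul_inv_eq_one.mp (Subgroup.mem_bot.mp ha)).symm⟩
  exact hf.sum_comp fun w : Subgroup.center G => classShift c (w : G)

theorem classShift_mul_eq_of_comm {H : Subgroup G} (hH : ShiftStable H c)
    (hcomm : ∀ a ∈ H, ∀ b ∈ H, a * b = b * a) {g h : G} (hg : g ∈ H) (hh : h ∈ H) :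
    classShift c (g * h) = classShift c g * classShift c h := by
  rw [classShift_mul_classShift hH hg, hcomm g hg h hh]

open Classical in
theorem centralMean_apply (x y : G) : centralMean c x y =
    if InClass c x ∧ y * x⁻¹ ∈ Subgroup.center G then (Nat.card (Subgroup.center G) : ℂ)⁻¹
    else 0 := by
  rw [centralMean, Matrix.smul_apply, Matrix.sum_apply, smul_eq_mul]
  simp only [classShift_apply]
  by_cases hx : InClass c x
  · by_cases hy : y * x⁻¹ ∈ Subgroup.center G
    · rw [Finset.sum_eq_single ⟨y * x⁻¹, hy⟩]
      · simp [hx, hy]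
      · rintro w - hw
        rw [if_neg]
        rintro ⟨-, rfl⟩
        exact hw (Subtype.ext (by simp))
      · simp
    · rw [Finset.sum_eq_zero, mul_zero, if_neg (fun h => hy h.2)]
      rintro w -
      rw [if_neg]
      rintro ⟨-, rfl⟩
      exact hy (by simp)
  · simp [hx]

omit [Fintype G] in
theorem ShiftStable.mono {H K : Subgroup G} (h : H ≤ K) (hK : ShiftStable K c) : ShiftStable H c :=
  fun g hg => hK g (h hg)

section Central

variable [DecidableEq G] {p k : ℕ} [Fact p.Prime] {z : Fin k → G}

/-- The component of the central shifts on `c` at the character of `Z(G)` with exponents `α`. -/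
noncomputable def centralComponent (ψ : AddChar (ZMod p) ℂ) (z : Fin k → G) (c : ConjClasses G)
    (α : Fin k → ZMod p) : Matrix G G ℂ :=
  fourierComponent ψ (fun a => classShift c (coordProd z a)) α

omit [DecidableEq G] in
theorem IsCoordinateSystem.classShift_add (hz : IsCoordinateSystem p (Subgroup.center G) ⊥ z)
    (hZ : ShiftStable (Subgroup.center G) c) (a b : Fin k → ZMod p) :
    classShift c (coordProd z (a + b)) =
      classShift c (coordProd z a) * classShift c (coordProd z b) := by
  rw [← classShift_mul_eq_of_comm hZ (fun a _ b hb => Subgroup.mem_center_iff.mp hb a)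
    (hz.coordProd_mem a) (hz.coordProd_mem b)]
  congr 1
  exact (mul_inv_eq_one.mp (Subgroup.mem_bot.mp (hz.coordProd_add a b))).symm

theorem centralComponent_zero (hz : IsCoordinateSystem p (Subgroup.center G) ⊥ z)
    (hk : Nat.card (Subgroup.center G) = p ^ k) (ψ : AddChar (ZMod p) ℂ) :
    centralComponent ψ z c 0 = centralMean c := by
  rw [centralMean_eq_sum_coordProd hz hk, centralComponent, fourierComponent]
  simp only [zero_dotProduct, AddChar.map_zero_eq_one, one_smul]

/-- Only the identity translation has diagonal entries, so an entry (x, x) with x in c sees just the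
term a = 0. -/
theorem centralComponent_ne_zero (hz : IsCoordinateSystem p (Subgroup.center G) ⊥ z)
    (ψ : AddChar (ZMod p) ℂ) (α : Fin k → ZMod p) : centralComponent ψ z c α ≠ 0 := by
  classical
  obtain ⟨x, hx⟩ := exists_inClass c
  intro h
  have h1 := congrFun (congrFun h x) x
  rw [centralComponent, fourierComponent, Matrix.smul_apply, Matrix.sum_apply,
    Finset.sum_eq_single 0] at h1
  · rw [Matrix.smul_apply, classShift_apply, hz.coordProd_zero] at h1
    simp [hx, (Fact.out : p.Prime).ne_zero] at h1
  · intro a _ ha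
    rw [Matrix.smul_apply, classShift_apply, if_neg, smul_zero]
    rintro ⟨-, h2⟩
    refine ha (hz.eq_of_coordProd a 0 (Subgroup.mem_bot.mpr ?_))
    rw [hz.coordProd_zero, inv_one, mul_one]
    simpa using h2
  · simp

theorem classShift_one_mul_centralComponent (ψ : AddChar (ZMod p) ℂ) (α : Fin k → ZMod p) :
    classShift c 1 * centralComponent ψ z c α = centralComponent ψ z c α := by
  rw [centralComponent, mul_fourierComponent_eq]
  simp only [classShift_one_mul]

theorem centralComponent_mul_classShift_one (hz : IsCoordinateSystem p (Subgroup.center G) ⊥ z)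
    (hZ : ShiftStable (Subgroup.center G) c) (ψ : AddChar (ZMod p) ℂ) (α : Fin k → ZMod p) :
    centralComponent ψ z c α * classShift c 1 = centralComponent ψ z c α := by
  rw [centralComponent, fourierComponent_mul_eq]
  simp only [classShift_mul_one hZ (hz.coordProd_mem _)]

theorem classShift_mem_span_centralComponent {ψ : AddChar (ZMod p) ℂ} (hψ : ψ ≠ 1)
    (hz : IsCoordinateSystem p (Subgroup.center G) ⊥ z) {w : G} (hw : w ∈ Subgroup.center G) :
    classShift c w ∈ Submodule.span ℂ (Set.range (centralComponent ψ z c)) := by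
  obtain ⟨a, ha⟩ := hz.exists_coordProd w hw
  rw [mul_inv_eq_one.mp (Subgroup.mem_bot.mp ha),
    sum_fourierComponent (D := fun a => classShift c (coordProd z a)) hψ a]
  exact Submodule.sum_mem _ fun α _ => Submodule.smul_mem _ _ (Submodule.subset_span ⟨α, rfl⟩)

end Central

section Derived

variable [DecidableEq G] {p n : ℕ} [Fact p.Prime] {h : Fin n → G}

/-- The component of the shifts by `G'`, averaged over `Z(G)`, on `c` at the character of
`G' / Z(G)` with exponents `γ`. -/
noncomputable def derivedComponent (ψ : AddChar (ZMod p) ℂ) (h : Fin n → G) (c : ConjClasses G)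
    (γ : Fin n → ZMod p) : Matrix G G ℂ :=
  fourierComponent ψ (fun a => classShift c (coordProd h a) * centralMean c) γ

variable (hh : IsCoordinateSystem p (commutator G) (Subgroup.center G) h)
  (hcomm : ∀ a ∈ commutator G, ∀ b ∈ commutator G, a * b = b * a)
  (hZG : Subgroup.center G ≤ commutator G)
  (hc : ShiftStable (commutator G) c)

omit [DecidableEq G] in
include hcomm hZG hc in
-- The mean absorbs central translations, so the product depends only on the coset of g modulo Z(G).
theorem classShift_mul_centralMean_congr {g g' : G} (hg : g ∈ commutator G)
    (hgg' : g' * g⁻¹ ∈ Subgroup.center G) :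
    classShift c g' * centralMean c = classShift c g * centralMean c := by
  have : g' = g * (g' * g⁻¹) := by
    rw [Subgroup.mem_center_iff.mp hgg' g, inv_mul_cancel_right]
  rw [this, classShift_mul_eq_of_comm hc hcomm hg (hZG hgg'), mul_assoc,
    classShift_mul_centralMean (hc.mono hZG) hgg']

omit [DecidableEq G] in
include hcomm hZG hc hh in
-- `coordProd h` is additive only modulo Z(G); multiplying by the mean removes the defect and gives
-- a genuine multiplicative family on (Z/p)^n.
theorem IsCoordinateSystem.classShift_mul_centralMean_add (a b : Fin n → ZMod p) :
    classShift c (coordProd h (a + b)) * centralMean c =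
      classShift c (coordProd h a) * centralMean c *
        (classShift c (coordProd h b) * centralMean c) := by
  have h1 := hh.coordProd_mem a
  have h2 := hh.coordProd_mem b
  rw [← classShift_mul_centralMean_congr hcomm hZG hc (hh.coordProd_mem (a + b))
    (hh.coordProd_add a b), classShift_mul_eq_of_comm hc hcomm h1 h2]
  rw [mul_assoc, mul_assoc, ← mul_assoc (centralMean c),
    ← classShift_commute_centralMean hc (hc.mono hZG) h2, mul_assoc,
    centralMean_mul_centralMean (hc.mono hZG)]

include hcomm hZG hc hh in
-- Central translations act trivially here, which is why these components are orthogonal to those at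
-- nontrivial characters of Z(G).
theorem classShift_mul_derivedComponent (ψ : AddChar (ZMod p) ℂ) (γ : Fin n → ZMod p) {w : G}
    (hw : w ∈ Subgroup.center G) :
    classShift c w * derivedComponent ψ h c γ = derivedComponent ψ h c γ := by
  rw [derivedComponent, mul_fourierComponent_eq]
  congr 1
  funext a
  rw [← mul_assoc, ← classShift_mul_eq_of_comm hc hcomm (hZG hw) (hh.coordProd_mem a),
    hcomm w (hZG hw) _ (hh.coordProd_mem a),
    classShift_mul_eq_of_comm hc hcomm (hh.coordProd_mem a) (hZG hw), mul_assoc,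
    classShift_mul_centralMean (hc.mono hZG) hw]

include hZG hc in
theorem derivedComponent_mul_classShift (ψ : AddChar (ZMod p) ℂ) (γ : Fin n → ZMod p) {w : G}
    (hw : w ∈ Subgroup.center G) :
    derivedComponent ψ h c γ * classShift c w = derivedComponent ψ h c γ := by
  rw [derivedComponent, fourierComponent_mul_eq]
  congr 1
  funext a
  rw [mul_assoc, centralMean_mul_classShift (hc.mono hZG) hw]

include hZG hc hh in
theorem derivedComponent_mul_classBlock {ψ : AddChar (ZMod p) ℂ} (hψ : ψ ≠ 1)
    {γ : Fin n → ZMod p} (hγ : γ ≠ 0) (d : ConjClasses G) :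
    derivedComponent ψ h c γ * classBlock c d = 0 := by
  classical
  refine fourierComponent_mul_eq_zero hψ hγ fun a => ?_
  have h1 : centralMean c * classBlock c d = classBlock c d :=
    centralMean_mul_of_forall fun w hw => classShift_mul_classBlock (hc.mono hZG) hw d
  rw [mul_assoc, h1, classShift_mul_classBlock hc (hh.coordProd_mem a)]

include hZG hc hh in
theorem classBlock_mul_derivedComponent {ψ : AddChar (ZMod p) ℂ} (hψ : ψ ≠ 1)
    {γ : Fin n → ZMod p} (hγ : γ ≠ 0) (d : ConjClasses G) :
    classBlock d c * derivedComponent ψ h c γ = 0 := by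
  classical
  refine mul_fourierComponent_eq_zero hψ hγ fun a => ?_
  rw [← mul_assoc, classBlock_mul_classShift hc (hh.coordProd_mem a)]
  exact mul_centralMean_of_forall fun w hw => classBlock_mul_classShift (hc.mono hZG) hw d

omit [Fact p.Prime] in
open Classical in
include hc hh in
theorem classShift_coordProd_mul_centralMean_apply (a : Fin n → ZMod p) (x y : G) :
    (classShift c (coordProd h a) * centralMean c) x y =
      if InClass c x ∧ y * (coordProd h a * x)⁻¹ ∈ Subgroup.center G then
        (Nat.card (Subgroup.center G) : ℂ)⁻¹ else 0 := by
  rw [classShift_mul_apply, centralMean_apply]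
  simp only [hc.iff (hh.coordProd_mem a)]
  by_cases hx : InClass c x <;> simp [hx]

include hc hh in
theorem derivedComponent_ne_zero (ψ : AddChar (ZMod p) ℂ) (γ : Fin n → ZMod p) :
    derivedComponent ψ h c γ ≠ 0 := by
  classical
  obtain ⟨x, hx⟩ := exists_inClass c
  intro h0
  have h1 := congrFun (congrFun h0 x) x
  rw [derivedComponent, fourierComponent, Matrix.smul_apply, Matrix.sum_apply,
    Finset.sum_eq_single 0] at h1
  · rw [Matrix.smul_apply, classShift_coordProd_mul_centralMean_apply hh hc,
      hh.coordProd_zero] at h1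
    simp [hx, (Fact.out : p.Prime).ne_zero] at h1
  · intro a _ ha
    rw [Matrix.smul_apply, classShift_coordProd_mul_centralMean_apply hh hc, if_neg, smul_zero]
    rintro ⟨-, h2⟩
    rw [mul_inv_rev, mul_inv_cancel_left] at h2
    refine ha (hh.eq_of_coordProd a 0 ?_)
    rw [hh.coordProd_zero, inv_one, mul_one]
    exact (Subgroup.inv_mem_iff _).mp h2
  · simp

include hZG hc hh in
/-- The zero component is a multiple of the all-ones block, when `c` is a coset of `G'`. -/
theorem derivedComponent_zero (hcl : ∀ x y, InClass c x → InClass c y → y * x⁻¹ ∈ commutator G)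
    (ψ : AddChar (ZMod p) ℂ) :
    derivedComponent ψ h c 0 =
      (((p : ℂ) ^ n)⁻¹ * (Nat.card (Subgroup.center G) : ℂ)⁻¹) • classBlock c c := by
  classical
  ext x y
  rw [derivedComponent, fourierComponent, Matrix.smul_apply, Matrix.sum_apply, Matrix.smul_apply,
    classBlock_apply]
  simp only [zero_dotProduct, AddChar.map_zero_eq_one, one_smul,
    classShift_coordProd_mul_centralMean_apply hh hc]
  by_cases hx : InClass c x
  · by_cases hy : InClass c y
    -- Exactly one coordinate vector represents the coset of y x⁻¹ modulo Z(G), so exactly one term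
    -- contributes to the entry.
    · obtain ⟨a, ha⟩ := hh.exists_coordProd _ (hcl x y hx hy)
      rw [Finset.sum_eq_single a]
      · rw [if_pos ⟨hx, by rwa [mul_inv_rev, ← mul_assoc]⟩, if_pos ⟨hx, hy⟩]
        simp
      · intro b _ hb
        rw [if_neg]
        rintro ⟨-, h2⟩
        rw [mul_inv_rev, ← mul_assoc] at h2
        refine hb (hh.eq_of_coordProd b a ?_)
        have h3 := mul_mem (inv_mem h2) ha
        simpa [mul_assoc] using h3
      · simp
    · rw [Finset.sum_eq_zero, if_neg (fun h => hy h.2), smul_zero, smul_zero]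
      intro b _
      rw [if_neg]
      rintro ⟨-, h2⟩
      have h3 := hc _ (mul_mem (hZG h2) (hh.coordProd_mem b)) x hx
      rw [mul_assoc, inv_mul_cancel_right] at h3
      exact hy h3
  · simp [hx]

include hcomm hZG hc hh in
theorem classShift_mul_centralMean_mem_span {ψ : AddChar (ZMod p) ℂ} (hψ : ψ ≠ 1) {g : G}
    (hg : g ∈ commutator G) : classShift c g * centralMean c ∈
      Submodule.span ℂ (Set.range (derivedComponent ψ h c)) := by
  obtain ⟨a, ha⟩ := hh.exists_coordProd g hg
  rw [classShift_mul_centralMean_congr hcomm hZG hc (hh.coordProd_mem a) ha,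
    sum_fourierComponent (D := fun a => classShift c (coordProd h a) * centralMean c) hψ a]
  exact Submodule.sum_mem _ fun α _ => Submodule.smul_mem _ _ (Submodule.subset_span ⟨α, rfl⟩)

end Derived

end Components

/-! ### The explicit generators are Fourier components -/

section Generators

/-- The identification of `{0, …, p - 1} ^ m` with `(ZMod p) ^ m`. -/
def tupleEquiv (p m : ℕ) [NeZero p] : (Fin m → Fin p) ≃ (Fin m → ZMod p) where
  toFun a j := ((a j : ℕ) : ZMod p)
  invFun b j := ⟨(b j).val, ZMod.val_lt _⟩
  left_inv a := funext fun j => Fin.ext (ZMod.val_cast_of_lt (a j).2)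
  right_inv b := funext fun j => ZMod.natCast_zmod_val (b j)

theorem val_tupleEquiv {p m : ℕ} [NeZero p] (a : Fin m → Fin p) (j : Fin m) :
    (tupleEquiv p m a j).val = a j := ZMod.val_cast_of_lt (a j).2

theorem tupleEquiv_ne_zero_iff {p m : ℕ} [NeZero p] (a : Fin m → Fin p) :
    tupleEquiv p m a ≠ 0 ↔ ∃ j, (a j : ℕ) ≠ 0 := by
  rw [Function.ne_iff]
  refine exists_congr fun j => not_congr ?_
  rw [← val_tupleEquiv, Pi.zero_apply, ZMod.val_eq_zero]

theorem zmodChar_dotProduct {p m : ℕ} [NeZero p] {ζ : ℂ} (hζ : ζ ^ p = 1) (α a : Fin m → Fin p) :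
    AddChar.zmodChar p hζ (tupleEquiv p m α ⬝ᵥ tupleEquiv p m a) =
      ∏ j, ζ ^ ((α j : ℕ) * (a j : ℕ)) := by
  have h : tupleEquiv p m α ⬝ᵥ tupleEquiv p m a =
      ((∑ j, (α j : ℕ) * (a j : ℕ) : ℕ) : ZMod p) := by
    rw [dotProduct, Nat.cast_sum]
    exact Finset.sum_congr rfl fun j _ => (Nat.cast_mul _ _).symm
  rw [h, AddChar.zmodChar_apply', Finset.prod_pow_eq_pow_sum]

theorem mul_prod_ofFn_eq {G A : Type*} [Group G] [Ring A] [Algebra ℂ A] {H : Subgroup G}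
    {D : G → A} (hD : ∀ g ∈ H, ∀ h ∈ H, D (g * h) = D g * D h) {ε : A} (hε : D 1 * ε = ε) :
    ∀ {m : ℕ} (f : Fin m → A) (s : Fin m → ℂ) (g : Fin m → G), (∀ j, g j ∈ H) →
      (∀ j, ε * f j = s j • (D (g j) * ε)) →
      ε * (List.ofFn f).prod = (∏ j, s j) • (D (List.ofFn g).prod * ε) := by
  intro m
  induction m with
  | zero => intro f s g _ _; simp [hε]
  | succ m ih =>
    intro f s g hg hf
    have hmem : (List.ofFn fun j : Fin m => g j.succ).prod ∈ H :=
      Subgroup.list_prod_mem _ fun x hx => by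
        obtain ⟨j, rfl⟩ := List.mem_ofFn.mp hx
        exact hg _
    rw [List.ofFn_succ, List.ofFn_succ, List.prod_cons, List.prod_cons, ← mul_assoc, hf,
      smul_mul_assoc, mul_assoc, ih (fun j => f j.succ) (fun j => s j.succ) (fun j => g j.succ)
      (fun j => hg _) (fun j => hf _), mul_smul_comm, smul_smul, ← Fin.prod_univ_succ,
      hD _ (hg 0) _ hmem, mul_assoc]

/-- Once one factor absorbs ε, it can be inserted in front of the whole product. This handles
factors with exponent zero, which carry no mean. -/
theorem mul_list_prod_eq_of_mem {A : Type*} [Ring A] {ε : A} (l : List A)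
    (hcomm : ∀ x ∈ l, ε * x = x * ε) (hmem : ∃ x ∈ l, ε * x = x) : ε * l.prod = l.prod := by
  induction l with
  | nil => obtain ⟨x, hx, -⟩ := hmem; simp at hx
  | cons y l ih =>
    rw [List.prod_cons, ← mul_assoc]
    obtain ⟨x, hx, hxe⟩ := hmem
    rcases List.mem_cons.mp hx with rfl | hx
    · rw [hxe]
    · rw [hcomm y (List.mem_cons_self ..), mul_assoc,
        ih (fun x hx => hcomm x (List.mem_cons_of_mem _ hx)) ⟨x, hx, hxe⟩]

variable {G : Type*} [Group G] [Fintype G]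

theorem block_mk_of_mem_center {c : ConjClasses G} {w : G} (hZ : ShiftStable (Subgroup.center G) c)
    (hw : w ∈ Subgroup.center G) :
    classShift c 1 * adjacencyMatrix (ConjClasses.mk w) * classShift c 1 = classShift c w := by
  classical
  ext x y
  rw [block_apply, classShift_apply]
  have h : InClass (ConjClasses.mk w) (y * x⁻¹) ↔ y = w * x := by
    rw [(inClass_mk w).isConj, ← mul_inv_eq_iff_eq_mul, isConj_iff]
    constructor
    · rintro ⟨u, hu⟩
      rw [← hu, Subgroup.mem_center_iff.mp hw, mul_inv_cancel_right]
    · intro h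
      exact ⟨1, by rw [h]; group⟩
  rw [h]
  by_cases hx : InClass c x
  · by_cases hy : y = w * x
    · simp [hy, hx, hZ w hw x hx]
    · simp [hy]
  · simp [hx]

/-- The class of g is the coset gZ(G), so the block is a sum of |Z(G)| = p^k translations; the mean
divides by p^k. -/
theorem IsCaminaShape.block_mk_of_mem_commutator {p n k : ℕ} (hS : IsCaminaShape G p n k)
    {c : ConjClasses G} {g : G} (hc : ShiftStable (commutator G) c)
    (hg : g ∈ commutator G) (hgZ : g ∉ Subgroup.center G) :
    classShift c 1 * adjacencyMatrix (ConjClasses.mk g) * classShift c 1 =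
      ((p : ℂ) ^ k) • (classShift c g * centralMean c) := by
  classical
  have hcard := card_center_ne_zero (G := G)
  ext x y
  rw [block_apply, Matrix.smul_apply, classShift_mul_apply, centralMean_apply,
    ← Nat.cast_pow, ← hS.card_center]
  have h : InClass (ConjClasses.mk g) (y * x⁻¹) ↔ y * (g * x)⁻¹ ∈ Subgroup.center G := by
    rw [(inClass_mk g).isConj, hS.isConj_inner g hg hgZ, mul_inv_rev, mul_assoc]
  rw [h]
  by_cases hx : InClass c x
  · by_cases hy : y * (g * x)⁻¹ ∈ Subgroup.center G
    · have h1 : InClass c (g * x) := hc g hg x hx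
      have h2 : InClass c y := by
        have := hc _ (hS.center_le hy) _ h1
        rwa [inv_mul_cancel_right] at this
      simp only [hx, hy, h1, h2, and_self, if_true, smul_eq_mul]
      rw [mul_inv_cancel₀ hcard]
    · simp only [hy, and_false, if_false, ite_self, smul_zero]
  · simp [hx]

variable [DecidableEq G]

theorem classShift_one_mul_pow {c : ConjClasses G} {w : G}
    (hZ : ShiftStable (Subgroup.center G) c) (hw : w ∈ Subgroup.center G) (m : ℕ) :
    classShift c 1 * classShift c w ^ m = classShift c (w ^ m) := by
  induction m with
  | zero => simp
  | succ m ih =>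
    rw [pow_succ, ← mul_assoc, ih, classShift_mul_classShift hZ (pow_mem hw m), pow_succ']

theorem classShift_one_mul_smul_pow {H : Subgroup G} {c : ConjClasses G} {g : G}
    (hH : ShiftStable H c) (hZ : ShiftStable (Subgroup.center G) c) (hg : g ∈ H) (q : ℂ) (m : ℕ) :
    classShift c 1 * (q • (classShift c g * centralMean c)) ^ (m + 1) =
      q ^ (m + 1) • (classShift c (g ^ (m + 1)) * centralMean c) := by
  induction m with
  | zero => simp [← mul_assoc, classShift_one_mul]
  | succ m ih =>
    rw [pow_succ, ← mul_assoc, ih, smul_mul_smul_comm, ← pow_succ, mul_assoc,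
      ← mul_assoc (centralMean c), ← classShift_commute_centralMean hH hZ hg, mul_assoc,
      centralMean_mul_centralMean hZ, ← mul_assoc, classShift_mul_classShift hH (pow_mem hg _),
      ← pow_succ']

theorem coe_block (c b : ConjClasses G) : (terwilliger G).val (block c b) =
    classShift c 1 * adjacencyMatrix b * classShift c 1 := by
  rw [block, map_mul, map_mul]
  exact congrArg₂ _ (congrArg₂ _ (coe_dualIdem c) rfl) (coe_dualIdem c)

theorem coe_blockPow (c b : ConjClasses G) (m : ℕ) : (terwilliger G).val (blockPow c b m) =
    classShift c 1 * (classShift c 1 * adjacencyMatrix b * classShift c 1) ^ m := by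
  rw [blockPow, map_mul, map_pow, coe_block]
  exact congrArg₂ _ (coe_dualIdem c) rfl

theorem coe_centralGenerator {p k : ℕ} [Fact p.Prime] {ζ : ℂ} (hζ : ζ ^ p = 1) {z : Fin k → G}
    (hz : IsCoordinateSystem p (Subgroup.center G) ⊥ z) (hk : k ≠ 0) {c : ConjClasses G}
    (hZ : ShiftStable (Subgroup.center G) c) (α : Fin k → Fin p) :
    (terwilliger G).val (centralGenerator ζ z c α) =
      centralComponent (AddChar.zmodChar p hζ) z c (tupleEquiv p k α) := by
  rw [centralGenerator, map_smul, map_sum, centralComponent, fourierComponent, one_div]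
  refine congrArg _ ?_
  refine Fintype.sum_equiv (tupleEquiv p k) _ _ fun a => ?_
  have hf : ∀ j, (terwilliger G).val (ζ ^ ((α j : ℕ) * (a j : ℕ)) •
      blockPow c (ConjClasses.mk (z j)) (a j)) =
      ζ ^ ((α j : ℕ) * (a j : ℕ)) • classShift c (z j ^ (a j : ℕ)) := by
    intro j
    rw [map_smul, coe_blockPow, block_mk_of_mem_center hZ (hz.mem j),
      classShift_one_mul_pow hZ (hz.mem j)]
  have hl : ∀ j, classShift c 1 * (ζ ^ ((α j : ℕ) * (a j : ℕ)) • classShift c (z j ^ (a j : ℕ))) =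
      ζ ^ ((α j : ℕ) * (a j : ℕ)) • classShift c (z j ^ (a j : ℕ)) := fun j => by
    rw [mul_smul_comm, classShift_one_mul]
  have hr : ∀ j, (ζ ^ ((α j : ℕ) * (a j : ℕ)) • classShift c (z j ^ (a j : ℕ))) * classShift c 1 =
      ζ ^ ((α j : ℕ) * (a j : ℕ)) • classShift c (z j ^ (a j : ℕ)) := fun j => by
    rw [smul_mul_assoc, classShift_mul_one hZ (pow_mem (hz.mem j) _)]
  rw [map_list_prod, List.map_ofFn, Function.comp_def]
  simp only [hf]
  rw [← mul_list_prod_eq_of_mem (ε := classShift c 1)]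
  · rw [mul_prod_ofFn_eq (H := Subgroup.center G) (D := classShift c) (fun g hg h hh =>
      classShift_mul_eq_of_comm hZ (fun a _ b hb => Subgroup.mem_center_iff.mp hb a) hg hh)
      (classShift_one_mul c 1) _ (fun j => ζ ^ ((α j : ℕ) * (a j : ℕ)))
      (fun j => z j ^ (a j : ℕ)) (fun j => pow_mem (hz.mem j) _)
      (fun j => by rw [hl, ← smul_mul_assoc, hr]), zmodChar_dotProduct, coordProd]
    simp only [val_tupleEquiv]
    rw [classShift_mul_one hZ]
    exact Subgroup.list_prod_mem _ fun x hx => by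
      obtain ⟨j, rfl⟩ := List.mem_ofFn.mp hx
      exact pow_mem (hz.mem j) _
  · intro x hx
    obtain ⟨j, rfl⟩ := List.mem_ofFn.mp hx
    rw [hl, hr]
  -- An empty product would be the identity of T(G) instead of E_c^*; k ≠ 0 supplies a factor that
  -- absorbs E_c^*.
  · exact ⟨_, List.mem_ofFn.mpr ⟨⟨0, Nat.pos_of_ne_zero hk⟩, rfl⟩, hl _⟩

theorem IsCaminaShape.coe_prod_derived {p n k : ℕ} [Fact p.Prime] (hS : IsCaminaShape G p n k)
    {ζ : ℂ} (hζ : ζ ^ p = 1) {h : Fin n → G}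
    (hh : IsCoordinateSystem p (commutator G) (Subgroup.center G) h) {c : ConjClasses G}
    (hc : ShiftStable (commutator G) c) (γ a : Fin n → Fin p) (ha : ∃ j, (a j : ℕ) ≠ 0) :
    (terwilliger G).val (List.ofFn fun j : Fin n =>
      (ζ ^ ((γ j : ℕ) * (a j : ℕ)) / (p : ℂ) ^ ((a j : ℕ) * k)) •
        blockPow c (ConjClasses.mk (h j)) (a j)).prod =
      AddChar.zmodChar p hζ (tupleEquiv p n γ ⬝ᵥ tupleEquiv p n a) •
        (classShift c (coordProd h (tupleEquiv p n a)) * centralMean c) := by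
  have hZ := hc.mono hS.center_le
  have hp : (p : ℂ) ≠ 0 := Nat.cast_ne_zero.mpr (Fact.out : p.Prime).ne_zero
  set s : Fin n → ℂ := fun j => ζ ^ ((γ j : ℕ) * (a j : ℕ)) with hs
  have hmean : classShift c 1 * centralMean c = centralMean c :=
    classShift_mul_centralMean hZ (one_mem _)
  have hmean' : centralMean c * classShift c 1 = centralMean c :=
    centralMean_mul_classShift hZ (one_mem _)
  have hf : ∀ j, (terwilliger G).val ((ζ ^ ((γ j : ℕ) * (a j : ℕ)) / (p : ℂ) ^ ((a j : ℕ) * k)) •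
      blockPow c (ConjClasses.mk (h j)) (a j)) = if (a j : ℕ) = 0 then s j • classShift c 1 else
        s j • (classShift c (h j ^ (a j : ℕ)) * centralMean c) := by
    intro j
    rw [map_smul, coe_blockPow, hS.block_mk_of_mem_commutator hc (hh.mem j) (hh.notMem j)]
    split_ifs with h0
    · simp [h0, hs]
    · obtain ⟨m, hm⟩ := Nat.exists_eq_succ_of_ne_zero h0
      rw [hs]
      simp only [hm, Nat.succ_eq_add_one]
      -- The block is p^k times an element, so its a_j-th power carries p^(a_j k), which the
      -- denominator cancels.
      rw [classShift_one_mul_smul_pow hc hZ (hh.mem j), smul_smul, ← pow_mul,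
        mul_comm k, div_mul_cancel₀ _ (pow_ne_zero _ hp)]
  have hcommute : ∀ j, classShift c (h j ^ (a j : ℕ)) * centralMean c =
      centralMean c * classShift c (h j ^ (a j : ℕ)) := fun j =>
    classShift_commute_centralMean hc hZ (pow_mem (hh.mem j) _)
  have hl : ∀ j, centralMean c * (if (a j : ℕ) = 0 then s j • classShift c 1 else
      s j • (classShift c (h j ^ (a j : ℕ)) * centralMean c)) =
      s j • (classShift c (h j ^ (a j : ℕ)) * centralMean c) := by
    intro j
    split_ifs with h0
    · rw [h0, pow_zero, hmean, mul_smul_comm, hmean']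
    · rw [hcommute, mul_smul_comm, ← mul_assoc, centralMean_mul_centralMean hZ]
  have hr : ∀ j, (if (a j : ℕ) = 0 then s j • classShift c 1 else
      s j • (classShift c (h j ^ (a j : ℕ)) * centralMean c)) * centralMean c =
      s j • (classShift c (h j ^ (a j : ℕ)) * centralMean c) := by
    intro j
    split_ifs with h0
    · rw [h0, pow_zero, smul_mul_assoc]
    · rw [smul_mul_assoc, mul_assoc, centralMean_mul_centralMean hZ]
  rw [map_list_prod, List.map_ofFn, Function.comp_def]
  simp only [hf]
  -- A factor with a_j = 0 is E_c^* without the mean. Since a ≠ 0, some other factor has the mean,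
  -- and it commutes with everything.
  rw [← mul_list_prod_eq_of_mem (ε := centralMean c)]
  · rw [mul_prod_ofFn_eq (H := commutator G) (D := classShift c) (fun g hg g' hg' =>
      classShift_mul_eq_of_comm hc hS.comm hg hg') hmean _ s
      (fun j => h j ^ (a j : ℕ)) (fun j => pow_mem (hh.mem j) _) hl, zmodChar_dotProduct, coordProd]
    simp only [val_tupleEquiv, hs]
  · intro x hx
    obtain ⟨j, rfl⟩ := List.mem_ofFn.mp hx
    rw [hl, hr]
  · obtain ⟨j, hj⟩ := ha
    refine ⟨_, List.mem_ofFn.mpr ⟨j, rfl⟩, ?_⟩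
    rw [hl, if_neg hj]

theorem IsCaminaShape.val_sum_block {p n k : ℕ} (hS : IsCaminaShape G p n k)
    [Fintype (Subgroup.center G)] {c : ConjClasses G} (hZ : ShiftStable (Subgroup.center G) c) :
    (terwilliger G).val (∑ z : Subgroup.center G, block c (ConjClasses.mk (z : G))) =
      (p : ℂ) ^ k • centralMean c := by
  rw [map_sum, centralMean, ← Nat.cast_pow, ← hS.card_center, smul_inv_smul₀ card_center_ne_zero]
  refine (Finset.sum_congr rfl fun z _ => ?_).trans
    (Finset.sum_congr (Finset.ext fun z => by simp) fun z _ => rfl)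
  rw [coe_block, block_mk_of_mem_center hZ z.2]

theorem IsCaminaShape.val_sum_prod_derived {p n k : ℕ} [Fact p.Prime] (hS : IsCaminaShape G p n k)
    [Fintype (NonzeroTuple p n)]
    {ζ : ℂ} (hζ : ζ ^ p = 1) {h : Fin n → G}
    (hh : IsCoordinateSystem p (commutator G) (Subgroup.center G) h) {c : ConjClasses G}
    (hc : ShiftStable (commutator G) c) (γ : Fin n → Fin p) :
    (terwilliger G).val (∑ a : NonzeroTuple p n, (p : ℂ) ^ k •
        (List.ofFn fun j : Fin n =>
          (ζ ^ ((γ j : ℕ) * (a.1 j : ℕ)) / (p : ℂ) ^ ((a.1 j : ℕ) * k)) •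
            blockPow c (ConjClasses.mk (h j)) (a.1 j)).prod) =
      (p : ℂ) ^ k • ∑ a : {a : Fin n → ZMod p // a ≠ 0},
        AddChar.zmodChar p hζ (tupleEquiv p n γ ⬝ᵥ a.1) •
        (classShift c (coordProd h a.1) * centralMean c) := by
  rw [map_sum, Finset.smul_sum]
  refine Fintype.sum_equiv
    ((tupleEquiv p n).subtypeEquiv fun a => (tupleEquiv_ne_zero_iff a).symm) _ _ fun a => ?_
  rw [map_smul, hS.coe_prod_derived hζ hh hc γ a.1 a.2]
  rfl

theorem IsCaminaShape.coe_derivedGenerator {p n k : ℕ} [Fact p.Prime] (hS : IsCaminaShape G p n k)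
    {ζ : ℂ} (hζ : ζ ^ p = 1) {h : Fin n → G}
    (hh : IsCoordinateSystem p (commutator G) (Subgroup.center G) h) {c : ConjClasses G}
    (hc : ShiftStable (commutator G) c) (γ : Fin n → Fin p) :
    (terwilliger G).val (derivedGenerator k ζ h c γ) =
      derivedComponent (AddChar.zmodChar p hζ) h c (tupleEquiv p n γ) := by
  have hZ := hc.mono hS.center_le
  have hp : (p : ℂ) ≠ 0 := Nat.cast_ne_zero.mpr (Fact.out : p.Prime).ne_zero
  have hpk := pow_ne_zero k hp
  rw [derivedGenerator, map_smul, map_add, hS.val_sum_block hZ,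
    hS.val_sum_prod_derived hζ hh hc γ]
  -- The term a = 0 of the Fourier sum is the mean, supplied by the sum over the centre. The
  -- prefactors agree since p^(−n−k) p^k = p^(−n).
  rw [derivedComponent, fourierComponent,
    Fintype.sum_eq_add_sum_subtype_ne _ (0 : Fin n → ZMod p)]
  rw [hh.coordProd_zero, dotProduct_zero, AddChar.map_zero_eq_one, one_smul,
    classShift_mul_centralMean hZ (one_mem _)]
  rw [← smul_add, smul_smul, one_div, pow_add, mul_inv, mul_assoc,
    inv_mul_cancel₀ hpk, mul_one]

end Generators

/-! ### Constant blocks and the multiplication table -/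

section Components

variable {G : Type*} [Group G]

theorem InnerClass.mem (i : InnerClass G) {x : G} (hx : InClass i.1 x) :
    x ∈ commutator G ∧ x ∉ Subgroup.center G := i.2 hx

theorem OuterClass.notMem (t : OuterClass G) {x : G} (hx : InClass t.1 x) : x ∉ commutator G :=
  t.2 hx

namespace IsCaminaShape

variable {p n k : ℕ} (hS : IsCaminaShape G p n k)
include hS

theorem mul_inv_mem_center (i : InnerClass G) {x y : G} (hx : InClass i.1 x) (hy : InClass i.1 y) :
    y * x⁻¹ ∈ Subgroup.center G :=
  (hS.isConj_inner x (i.mem hx).1 (i.mem hx).2 y).mp (hx.isConj.mp hy)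

theorem mul_inv_mem_commutator (t : OuterClass G) {x y : G} (hx : InClass t.1 x)
    (hy : InClass t.1 y) : y * x⁻¹ ∈ commutator G :=
  (hS.isConj_outer x (t.notMem hx) y).mp (hx.isConj.mp hy)

theorem shiftStable_inner (i : InnerClass G) : ShiftStable (Subgroup.center G) i.1 :=
  fun g hg x hx => hx.isConj.mpr <|
    (hS.isConj_inner x (i.mem hx).1 (i.mem hx).2 _).mpr (by rwa [mul_inv_cancel_right])

theorem shiftStable_outer (t : OuterClass G) : ShiftStable (commutator G) t.1 :=
  fun g hg x hx => hx.isConj.mpr <|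
    (hS.isConj_outer x (t.notMem hx) _).mpr (by rwa [mul_inv_cancel_right])

theorem shiftStable_outer_center (t : OuterClass G) : ShiftStable (Subgroup.center G) t.1 :=
  (hS.shiftStable_outer t).mono hS.center_le

theorem class_cases (c : ConjClasses G) : (∃ z ∈ Subgroup.center G, ∀ x, InClass c x ↔ x = z) ∨
    (∃ i : InnerClass G, i.1 = c) ∨ ∃ t : OuterClass G, t.1 = c := by
  obtain ⟨x, hx⟩ := exists_inClass c
  by_cases hG : x ∈ commutator G
  · by_cases hZ : x ∈ Subgroup.center G
    · refine Or.inl ⟨x, hZ, fun y => ?_⟩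
      rw [hx.isConj, isConj_iff]
      refine ⟨?_, fun h => ⟨1, by rw [h]; group⟩⟩
      rintro ⟨u, rfl⟩
      rw [Subgroup.mem_center_iff.mp hZ, mul_inv_cancel_right]
    · refine Or.inr (Or.inl ⟨⟨c, fun y hy => ?_⟩, rfl⟩)
      have h := (hS.isConj_inner x hG hZ y).mp (hx.isConj.mp hy)
      have hy' : y = y * x⁻¹ * x := (inv_mul_cancel_right y x).symm
      constructor
      · rw [hy']; exact mul_mem (hS.center_le h) hG
      · intro hyZ
        refine hZ ?_
        have := mul_mem (inv_mem h) hyZ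
        rwa [mul_inv_rev, inv_inv, inv_mul_cancel_right] at this
  · refine Or.inr (Or.inr ⟨⟨c, fun y hy hyG => hG ?_⟩, rfl⟩)
    have h := (hS.isConj_outer x hG y).mp (hx.isConj.mp hy)
    have := mul_mem (inv_mem h) hyG
    rwa [mul_inv_rev, inv_inv, inv_mul_cancel_right] at this

omit hS in
-- The right side is y'y⁻¹ times a conjugate of (x'x⁻¹)⁻¹, so it lies in any normal subgroup
-- containing both quotients.
theorem mul_inv_mul_inv_eq (x x' y y' : G) : (y' * x'⁻¹) * (y * x⁻¹)⁻¹ =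
    (y' * y⁻¹) * ((y * x'⁻¹) * (x' * x⁻¹)⁻¹ * (y * x'⁻¹)⁻¹) := by
  group

omit hS in
theorem mul_inv_mem_commutator_of_isConj {x x' : G} (h : IsConj x x') :
    x' * x⁻¹ ∈ commutator G := by
  obtain ⟨u, rfl⟩ := isConj_iff.mp h
  exact Subgroup.commutator_mem_commutator (Subgroup.mem_top u) (Subgroup.mem_top x)

theorem mul_inv_mem_center_of_isConj {x x' : G} (hx : x ∈ commutator G) (h : IsConj x x') :
    x' * x⁻¹ ∈ Subgroup.center G := by
  by_cases hZ : x ∈ Subgroup.center G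
  · obtain ⟨u, rfl⟩ := isConj_iff.mp h
    rw [Subgroup.mem_center_iff.mp hZ, mul_inv_cancel_right, mul_inv_cancel]
    exact one_mem _
  · exact (hS.isConj_inner x hx hZ x').mp h

/-- Away from the diagonal, the blocks of the scheme are constant. -/
theorem isConj_mul_inv {c d : ConjClasses G} (hcd : c ≠ d) {x x' y y' : G} (hx : InClass c x)
    (hx' : InClass c x') (hy : InClass d y) (hy' : InClass d y') :
    IsConj (y * x⁻¹) (y' * x'⁻¹) := by
  have hxy : ¬ IsConj x y := fun h => hcd ((hx.isConj.mpr h).eq hy)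
  have hxx := hx.isConj.mp hx'
  have hyy := hy.isConj.mp hy'
  by_cases hG : y * x⁻¹ ∈ commutator G
  · have hxG : x ∈ commutator G := by
      by_contra hxG
      exact hxy ((hS.isConj_outer x hxG y).mpr hG)
    have hyG : y ∈ commutator G := by
      have := mul_mem hG hxG
      rwa [inv_mul_cancel_right] at this
    by_cases hZ : y * x⁻¹ ∈ Subgroup.center G
    · have hxZ : x ∈ Subgroup.center G := by
        by_contra hxZ
        exact hxy ((hS.isConj_inner x hxG hxZ y).mpr hZ)
      have hyZ : y ∈ Subgroup.center G := by
        have := mul_mem hZ hxZ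
        rwa [inv_mul_cancel_right] at this
      obtain ⟨u, rfl⟩ := isConj_iff.mp hxx
      obtain ⟨v, rfl⟩ := isConj_iff.mp hyy
      rw [Subgroup.mem_center_iff.mp hxZ, mul_inv_cancel_right, Subgroup.mem_center_iff.mp hyZ,
        mul_inv_cancel_right]
    · rw [hS.isConj_inner _ hG hZ, mul_inv_mul_inv_eq]
      refine mul_mem (hS.mul_inv_mem_center_of_isConj hyG hyy) ?_
      exact (inferInstance : (Subgroup.center G).Normal).conj_mem _
        (inv_mem (hS.mul_inv_mem_center_of_isConj hxG hxx)) _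
  · rw [hS.isConj_outer _ hG, mul_inv_mul_inv_eq]
    refine mul_mem (mul_inv_mem_commutator_of_isConj hyy) ?_
    exact (inferInstance : (commutator G).Normal).conj_mem _
      (inv_mem (mul_inv_mem_commutator_of_isConj hxx)) _

end IsCaminaShape

/-- The blocks away from the diagonal are multiples of the all-ones blocks. -/
theorem IsCaminaShape.exists_block_eq_smul [Fintype G] {p n k : ℕ} (hS : IsCaminaShape G p n k)
    {c d : ConjClasses G} (h : c ≠ d ∨ ∃ z, ∀ x, InClass c x ↔ x = z) (b : ConjClasses G) :
    ∃ q : ℂ, classShift c 1 * adjacencyMatrix b * classShift d 1 = q • classBlock c d := by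
  classical
  have key : ∀ x x' y y', InClass c x → InClass c x' → InClass d y → InClass d y' →
      InClass b (y * x⁻¹) → InClass b (y' * x'⁻¹) := by
    intro x x' y y' hx hx' hy hy' hb
    by_cases hcd : c = d
    · obtain ⟨z, hz⟩ := h.resolve_left (not_not_intro hcd)
      subst hcd
      rw [hz] at hx hx' hy hy'
      rw [hx, hy] at hb
      rwa [hx', hy']
    · exact hb.isConj.mpr (hS.isConj_mul_inv hcd hx hx' hy hy')
  obtain ⟨x₀, hx₀⟩ := exists_inClass c
  obtain ⟨y₀, hy₀⟩ := exists_inClass d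
  refine ⟨if InClass b (y₀ * x₀⁻¹) then 1 else 0, ?_⟩
  ext x y
  rw [block_apply, Matrix.smul_apply, classBlock_apply]
  by_cases hx : InClass c x
  · by_cases hy : InClass d y
    · have : InClass b (y * x⁻¹) ↔ InClass b (y₀ * x₀⁻¹) :=
        ⟨key _ _ _ _ hx hx₀ hy hy₀, key _ _ _ _ hx₀ hx hy₀ hy⟩
      simp only [hx, hy, this, true_and, and_self, if_true, smul_eq_mul, mul_one]
    · simp only [hy, false_and, and_false, if_false, smul_zero]
  · simp only [hx, false_and, if_false, smul_zero]

/-- A diagonal block vanishes unless the class meets the differences. -/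
theorem block_eq_zero [Fintype G] {c b : ConjClasses G}
    (h : ∀ x y, InClass c x → InClass c y → ¬ InClass b (y * x⁻¹)) :
    classShift c 1 * adjacencyMatrix b * classShift c 1 = 0 := by
  classical
  ext x y
  rw [block_apply, Matrix.zero_apply, if_neg]
  rintro ⟨hx, hy, hb⟩
  exact h x y hx hy hb

/-- On a class that is a coset of the centre the mean over the centre is an all-ones block. -/
theorem IsCaminaShape.centralMean_inner [Fintype G] {p n k : ℕ} (hS : IsCaminaShape G p n k)
    (i : InnerClass G) :
    centralMean i.1 = ((Nat.card (Subgroup.center G) : ℂ)⁻¹) • classBlock i.1 i.1 := by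
  classical
  ext x y
  rw [centralMean_apply, Matrix.smul_apply, classBlock_apply]
  have hxy : InClass i.1 x ∧ y * x⁻¹ ∈ Subgroup.center G ↔ InClass i.1 x ∧ InClass i.1 y := by
    refine and_congr_right fun hx => ⟨fun h => ?_, fun h => hS.mul_inv_mem_center i hx h⟩
    have := hS.shiftStable_inner i _ h x hx
    rwa [inv_mul_cancel_right] at this
  simp only [hxy, smul_eq_mul, mul_ite, mul_one, mul_zero]

/-- The indices of the components outside the primary one. -/
abbrev ComponentIndex (G : Type*) [Group G] (p n k : ℕ) : Type _ :=
  InnerClass G × NonzeroTuple p k ⊕ OuterClass G × NonzeroTuple p k ⊕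
    OuterClass G × NonzeroTuple p n

section Matrices

variable [Fintype G] [DecidableEq G] {p n k : ℕ} [Fact p.Prime]

/-- The idempotents outside the primary component, as matrices. -/
noncomputable def componentMatrix (ψ : AddChar (ZMod p) ℂ) (z : Fin k → G) (h : Fin n → G) :
    ComponentIndex G p n k → Matrix G G ℂ
  | .inl q => centralComponent ψ z q.1.1 (tupleEquiv p k q.2.1)
  | .inr (.inl q) => centralComponent ψ z q.1.1 (tupleEquiv p k q.2.1)
  | .inr (.inr q) => derivedComponent ψ h q.1.1 (tupleEquiv p n q.2.1)

/-- The class in which a component lives. -/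
def ComponentIndex.class : ComponentIndex G p n k → ConjClasses G
  | .inl q => q.1.1
  | .inr (.inl q) => q.1.1
  | .inr (.inr q) => q.1.1

variable (hS : IsCaminaShape G p n k) {ψ : AddChar (ZMod p) ℂ} (hψ : ψ ≠ 1) {z : Fin k → G}
  {h : Fin n → G} (hz : IsCoordinateSystem p (Subgroup.center G) ⊥ z)
  (hh : IsCoordinateSystem p (commutator G) (Subgroup.center G) h)

theorem NonzeroTuple.tupleEquiv_ne_zero {m : ℕ} (a : NonzeroTuple p m) :
    tupleEquiv p m a.1 ≠ 0 := (tupleEquiv_ne_zero_iff _).mpr a.2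

include hS

include hh in
theorem classShift_mul_componentMatrix (q : ComponentIndex G p n k) :
    classShift q.class 1 * componentMatrix ψ z h q = componentMatrix ψ z h q := by
  rcases q with q | q | q
  · exact classShift_one_mul_centralComponent _ _
  · exact classShift_one_mul_centralComponent _ _
  · exact classShift_mul_derivedComponent hh hS.comm hS.center_le (hS.shiftStable_outer _) _ _
      (one_mem _)

include hz in
theorem componentMatrix_mul_classShift (q : ComponentIndex G p n k) :
    componentMatrix ψ z h q * classShift q.class 1 = componentMatrix ψ z h q := by
  rcases q with q | q | q
  · exact centralComponent_mul_classShift_one hz (hS.shiftStable_inner _) _ _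
  · exact centralComponent_mul_classShift_one hz (hS.shiftStable_outer_center _) _ _
  · exact derivedComponent_mul_classShift hS.center_le (hS.shiftStable_outer _) _ _ (one_mem _)

omit hS in
include hψ hz in
theorem centralComponent_mul_of_classShift_mul {c : ConjClasses G} {α : Fin k → ZMod p}
    (hα : α ≠ 0) {v : Matrix G G ℂ} (hv : ∀ w ∈ Subgroup.center G, classShift c w * v = v) :
    centralComponent ψ z c α * v = 0 :=
  fourierComponent_mul_eq_zero hψ hα fun a => hv _ (hz.coordProd_mem a)

omit hS in
include hψ hz in
theorem mul_centralComponent_of_mul_classShift {c : ConjClasses G} {α : Fin k → ZMod p}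
    (hα : α ≠ 0) {v : Matrix G G ℂ} (hv : ∀ w ∈ Subgroup.center G, v * classShift c w = v) :
    v * centralComponent ψ z c α = 0 :=
  mul_fourierComponent_eq_zero hψ hα fun a => hv _ (hz.coordProd_mem a)

include hψ hz hh

theorem componentMatrix_mul_classBlock (q : ComponentIndex G p n k) (d : ConjClasses G) :
    componentMatrix ψ z h q * classBlock q.class d = 0 := by
  rcases q with q | q | q
  · exact centralComponent_mul_of_classShift_mul hψ hz q.2.tupleEquiv_ne_zero
      fun w hw => classShift_mul_classBlock (hS.shiftStable_inner _) hw d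
  · exact centralComponent_mul_of_classShift_mul hψ hz q.2.tupleEquiv_ne_zero
      fun w hw => classShift_mul_classBlock (hS.shiftStable_outer_center _) hw d
  · exact derivedComponent_mul_classBlock hh hS.center_le (hS.shiftStable_outer _) hψ
      q.2.tupleEquiv_ne_zero d

theorem classBlock_mul_componentMatrix (q : ComponentIndex G p n k) (d : ConjClasses G) :
    classBlock d q.class * componentMatrix ψ z h q = 0 := by
  rcases q with q | q | q
  · exact mul_centralComponent_of_mul_classShift hψ hz q.2.tupleEquiv_ne_zero
      fun w hw => classBlock_mul_classShift (hS.shiftStable_inner _) hw d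
  · exact mul_centralComponent_of_mul_classShift hψ hz q.2.tupleEquiv_ne_zero
      fun w hw => classBlock_mul_classShift (hS.shiftStable_outer_center _) hw d
  · exact classBlock_mul_derivedComponent hh hS.center_le (hS.shiftStable_outer _) hψ
      q.2.tupleEquiv_ne_zero d

omit hψ in
theorem componentMatrix_mul_of_ne {q r : ComponentIndex G p n k} (hqr : q.class ≠ r.class) :
    componentMatrix ψ z h q * componentMatrix ψ z h r = 0 := by
  rw [← componentMatrix_mul_classShift hS hz q, ← classShift_mul_componentMatrix hS hh r, mul_assoc,
    ← mul_assoc (classShift q.class 1), classShift_one_mul_of_ne hqr, zero_mul, mul_zero]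

theorem isMatrixUnitSystem : IsMatrixUnitSystem (classBlock (G := G)) classSize
    (componentMatrix ψ z h) where
  w_ne_zero := classSize_ne_zero
  u_ne_zero := classBlock_ne_zero
  u_mul_u := classBlock_mul_classBlock
  u_mul_u_of_ne _ _ _ _ hd := classBlock_mul_classBlock_of_ne hd
  e_ne_zero q := by
    rcases q with q | q | q
    · exact centralComponent_ne_zero hz _ _
    · exact centralComponent_ne_zero hz _ _
    · exact derivedComponent_ne_zero hh (hS.shiftStable_outer _) _ _
  e_mul_e q := by
    rcases q with q | q | q
    · exact (fourierComponent_mul_self hψ (hz.classShift_add (hS.shiftStable_inner _)) _ _).trans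
        (if_pos rfl)
    · exact (fourierComponent_mul_self hψ
        (hz.classShift_add (hS.shiftStable_outer_center _)) _ _).trans (if_pos rfl)
    · exact (fourierComponent_mul_self hψ (hh.classShift_mul_centralMean_add hS.comm hS.center_le
        (hS.shiftStable_outer _)) _ _).trans (if_pos rfl)
  e_mul_e_of_ne q r hqr := by
    by_cases hc : q.class = r.class
    swap
    · exact componentMatrix_mul_of_ne hS hz hh hc
    have hne : ∀ (i : InnerClass G) (t : OuterClass G), i.1 ≠ t.1 := fun i t hit => by
      obtain ⟨x, hx⟩ := exists_inClass i.1
      exact t.notMem (hit ▸ hx) (i.mem hx).1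
    have hinj : ∀ {m : ℕ} {a b : NonzeroTuple p m}, tupleEquiv p m a.1 = tupleEquiv p m b.1 →
        a = b := fun hab => Subtype.ext ((tupleEquiv p _).injective hab)
    rcases q with ⟨c, α⟩ | ⟨c, α⟩ | ⟨c, α⟩ <;> rcases r with ⟨d, β⟩ | ⟨d, β⟩ | ⟨d, β⟩
    · obtain rfl : c = d := Subtype.ext hc
      refine (fourierComponent_mul_self hψ (hz.classShift_add (hS.shiftStable_inner c)) _ _).trans
        (if_neg fun hab => hqr ?_)
      rw [show α = β from hinj hab]
    · exact absurd hc (hne c d)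
    · exact absurd hc (hne c d)
    · exact absurd hc.symm (hne d c)
    · obtain rfl : c = d := Subtype.ext hc
      refine (fourierComponent_mul_self hψ
        (hz.classShift_add (hS.shiftStable_outer_center c)) _ _).trans (if_neg fun hab => hqr ?_)
      rw [show α = β from hinj hab]
    · obtain rfl : c = d := Subtype.ext hc
      -- X and Y components on the same outer class: central translations fix the Y component, so a
      -- nontrivial central character kills it.
      exact centralComponent_mul_of_classShift_mul hψ hz α.tupleEquiv_ne_zero fun w hw =>
        classShift_mul_derivedComponent hh hS.comm hS.center_le (hS.shiftStable_outer c) _ _ hw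
    · exact absurd hc.symm (hne d c)
    · obtain rfl : c = d := Subtype.ext hc
      exact mul_centralComponent_of_mul_classShift hψ hz β.tupleEquiv_ne_zero fun w hw =>
        derivedComponent_mul_classShift hS.center_le (hS.shiftStable_outer c) _ _ hw
    · obtain rfl : c = d := Subtype.ext hc
      refine (fourierComponent_mul_self hψ (hh.classShift_mul_centralMean_add hS.comm hS.center_le
        (hS.shiftStable_outer c)) _ _).trans (if_neg fun hab => hqr ?_)
      rw [show α = β from hinj hab]
  e_mul_u q c d := by
    by_cases hc : q.class = c
    · exact hc ▸ componentMatrix_mul_classBlock hS hψ hz hh q d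
    · rw [← componentMatrix_mul_classShift hS hz q, mul_assoc,
        classShift_one_mul_classBlock_of_ne hc, mul_zero]
  u_mul_e q c d := by
    by_cases hc : d = q.class
    · exact hc ▸ classBlock_mul_componentMatrix hS hψ hz hh q c
    · rw [← classShift_mul_componentMatrix hS hh q, ← mul_assoc,
        classBlock_mul_classShift_one_of_ne (Ne.symm hc), zero_mul]

end Matrices

end Components

/-! ### The components span the Terwilliger algebra -/

section Span

variable {G : Type*} [Group G] [Fintype G] [DecidableEq G] {p n k : ℕ} [Fact p.Prime]

/-- The span of the all-ones blocks and of the idempotents outside the primary component. -/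
noncomputable def componentSpan (ψ : AddChar (ZMod p) ℂ) (z : Fin k → G) (h : Fin n → G) :
    Submodule ℂ (Matrix G G ℂ) :=
  Submodule.span ℂ (Set.range (fun q : ConjClasses G × ConjClasses G => classBlock q.1 q.2) ∪
    Set.range (componentMatrix ψ z h))

theorem classBlock_mem_componentSpan (ψ : AddChar (ZMod p) ℂ) (z : Fin k → G) (h : Fin n → G)
    (c d : ConjClasses G) : classBlock c d ∈ componentSpan ψ z h :=
  Submodule.subset_span (Or.inl ⟨(c, d), rfl⟩)

theorem componentMatrix_mem_componentSpan (ψ : AddChar (ZMod p) ℂ) (z : Fin k → G) (h : Fin n → G)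
    (q : ComponentIndex G p n k) : componentMatrix ψ z h q ∈ componentSpan ψ z h :=
  Submodule.subset_span (Or.inr ⟨q, rfl⟩)

theorem exists_nonzeroTuple {m : ℕ} {a : Fin m → ZMod p} (ha : a ≠ 0) :
    ∃ b : NonzeroTuple p m, tupleEquiv p m b.1 = a :=
  ⟨⟨(tupleEquiv p m).symm a, (tupleEquiv_ne_zero_iff _).mp (by rwa [Equiv.apply_symm_apply])⟩,
    Equiv.apply_symm_apply _ _⟩

namespace IsCaminaShape

variable (hS : IsCaminaShape G p n k) {ψ : AddChar (ZMod p) ℂ} (hψ : ψ ≠ 1) {z : Fin k → G}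
  {h : Fin n → G} (hz : IsCoordinateSystem p (Subgroup.center G) ⊥ z)
  (hh : IsCoordinateSystem p (commutator G) (Subgroup.center G) h)
include hS

include hh in
theorem derivedComponent_mem (t : OuterClass G) (γ : Fin n → ZMod p) :
    derivedComponent ψ h t.1 γ ∈ componentSpan ψ z h := by
  by_cases hγ : γ = 0
  · rw [hγ, derivedComponent_zero hh hS.center_le (hS.shiftStable_outer t)
      fun x y => hS.mul_inv_mem_commutator t]
    exact Submodule.smul_mem _ _ (classBlock_mem_componentSpan ψ z h _ _)
  · obtain ⟨b, rfl⟩ := exists_nonzeroTuple (p := p) hγ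
    exact componentMatrix_mem_componentSpan ψ z h (.inr (.inr (t, b)))

include hz in
theorem centralComponent_inner_mem (i : InnerClass G) (α : Fin k → ZMod p) :
    centralComponent ψ z i.1 α ∈ componentSpan ψ z h := by
  by_cases hα : α = 0
  · rw [hα, centralComponent_zero hz hS.card_center, hS.centralMean_inner]
    exact Submodule.smul_mem _ _ (classBlock_mem_componentSpan ψ z h _ _)
  · obtain ⟨b, rfl⟩ := exists_nonzeroTuple (p := p) hα
    exact componentMatrix_mem_componentSpan ψ z h (.inl (i, b))

include hh hψ in
theorem classShift_mul_centralMean_mem (t : OuterClass G) {g : G} (hg : g ∈ commutator G) :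
    classShift t.1 g * centralMean t.1 ∈ componentSpan ψ z h := by
  refine Submodule.span_le.mpr ?_ (classShift_mul_centralMean_mem_span hh hS.comm hS.center_le
    (hS.shiftStable_outer t) hψ hg)
  rintro _ ⟨γ, rfl⟩
  exact hS.derivedComponent_mem hh t γ

include hz hh hψ

/-- At α = 0 the component is the mean over Z(G), not an all-ones block; it is recovered from the
characters of G'/Z(G), including the trivial one. -/
theorem centralComponent_outer_mem (t : OuterClass G) (α : Fin k → ZMod p) :
    centralComponent ψ z t.1 α ∈ componentSpan ψ z h := by
  by_cases hα : α = 0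
  · rw [hα, centralComponent_zero hz hS.card_center,
      ← classShift_mul_centralMean (hS.shiftStable_outer_center t) (one_mem _)]
    exact hS.classShift_mul_centralMean_mem hψ hh t (one_mem _)
  · obtain ⟨b, rfl⟩ := exists_nonzeroTuple (p := p) hα
    exact componentMatrix_mem_componentSpan ψ z h (.inr (.inl (t, b)))

/-- Off the diagonal and on singleton classes the block is constant. On a coset of Z(G) or G' it
vanishes unless b meets that subgroup; otherwise it is a translation or a multiple of an averaged
one, and Fourier inversion applies. -/
theorem block_mem (c d b : ConjClasses G) :
    classShift c 1 * adjacencyMatrix b * classShift d 1 ∈ componentSpan ψ z h := by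
  have hconst : (c ≠ d ∨ ∃ z, ∀ x, InClass c x ↔ x = z) →
      classShift c 1 * adjacencyMatrix b * classShift d 1 ∈ componentSpan ψ z h := fun hcd => by
    obtain ⟨q, hq⟩ := hS.exists_block_eq_smul hcd b
    rw [hq]
    exact Submodule.smul_mem _ _ (classBlock_mem_componentSpan ψ z h _ _)
  by_cases hcd : c = d
  swap
  · exact hconst (Or.inl hcd)
  subst hcd
  rcases hS.class_cases c with ⟨w, -, hw⟩ | ⟨i, rfl⟩ | ⟨t, rfl⟩
  · exact hconst (Or.inr ⟨w, hw⟩)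
  · by_cases hb : ∃ w ∈ Subgroup.center G, InClass b w
    · obtain ⟨w, hw, hwb⟩ := hb
      rw [← inClass_iff.mp hwb, block_mk_of_mem_center (hS.shiftStable_inner i) hw]
      refine Submodule.span_le.mpr ?_ (classShift_mem_span_centralComponent hψ hz hw)
      rintro _ ⟨α, rfl⟩
      exact hS.centralComponent_inner_mem hz i α
    · rw [block_eq_zero fun x y hx hy hxy => hb ⟨_, hS.mul_inv_mem_center i hx hy, hxy⟩]
      exact Submodule.zero_mem _
  · by_cases hb : ∃ w ∈ commutator G, InClass b w
    · obtain ⟨w, hw, hwb⟩ := hb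
      rw [← inClass_iff.mp hwb]
      by_cases hwZ : w ∈ Subgroup.center G
      · rw [block_mk_of_mem_center (hS.shiftStable_outer_center t) hwZ]
        refine Submodule.span_le.mpr ?_ (classShift_mem_span_centralComponent hψ hz hwZ)
        rintro _ ⟨α, rfl⟩
        exact hS.centralComponent_outer_mem hψ hz hh t α
      · rw [hS.block_mk_of_mem_commutator (hS.shiftStable_outer t) hw hwZ]
        exact Submodule.smul_mem _ _ (hS.classShift_mul_centralMean_mem hψ hh t hw)
    · rw [block_eq_zero fun x y hx hy hxy => hb ⟨_, hS.mul_inv_mem_commutator t hx hy, hxy⟩]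
      exact Submodule.zero_mem _

theorem adjacencyMatrix_mem (b : ConjClasses G) :
    adjacencyMatrix b ∈ componentSpan ψ z h := by
  have hb : adjacencyMatrix b =
      ∑ c, ∑ d, classShift c 1 * adjacencyMatrix b * classShift d 1 := by
    simp only [← Finset.mul_sum, ← Finset.sum_mul, sum_coe_dualIdem, one_mul, mul_one]
  rw [hb]
  exact Submodule.sum_mem _ fun c _ => Submodule.sum_mem _ fun d _ =>
    hS.block_mem hψ hz hh c d b

omit [Fintype G] [Fact p.Prime] hS hψ hz hh in
theorem adjacencyMatrix_mk_one : (adjacencyMatrix (ConjClasses.mk (1 : G))) = 1 := by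
  classical
  ext x y
  rw [adjacencyMatrix_apply, (inClass_mk 1).isConj, isConj_one_right, Matrix.one_apply]
  simp only [mul_inv_eq_one, eq_comm]

theorem mem_componentSpan_of_mem_terwilliger {x : Matrix G G ℂ} (hx : x ∈ terwilliger G) :
    x ∈ componentSpan ψ z h := by
  have hone : (1 : Matrix G G ℂ) ∈ componentSpan ψ z h :=
    adjacencyMatrix_mk_one (G := G) ▸ hS.adjacencyMatrix_mem hψ hz hh _
  let S : Subalgebra ℂ (Matrix G G ℂ) := (componentSpan ψ z h).toSubalgebra hone
    fun x y hx hy => (isMatrixUnitSystem hS hψ hz hh).mul_mem_span hx hy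
  have hle : terwilliger G ≤ S := by
    refine Algebra.adjoin_le (Set.union_subset ?_ ?_)
    · refine Submodule.span_le (p := componentSpan ψ z h).mpr ?_
      rintro _ ⟨b, rfl⟩
      exact hS.adjacencyMatrix_mem hψ hz hh b
    · refine Submodule.span_le (p := componentSpan ψ z h).mpr ?_
      rintro _ ⟨c, rfl⟩
      -- E_c^* is its own diagonal block of the identity matrix, the adjacency matrix of the class
      -- of 1.
      have := hS.block_mem hψ hz hh c c (ConjClasses.mk 1)
      rwa [adjacencyMatrix_mk_one, mul_one, classShift_one_mul,
        ← dualIdempotentMatrix_eq] at this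
  exact hle hx

end IsCaminaShape

/-- The idempotents outside the primary component, as elements of the Terwilliger algebra. -/
noncomputable def componentGenerator (ζ : ℂ) (z : Fin k → G) (h : Fin n → G) :
    ComponentIndex G p n k → terwilliger G
  | .inl q => centralGenerator ζ z q.1.1 q.2.1
  | .inr (.inl q) => centralGenerator ζ z q.1.1 q.2.1
  | .inr (.inr q) => derivedGenerator k ζ h q.1.1 q.2.1

theorem zmodChar_ne_one {ζ : ℂ} (hζ : IsPrimitiveRoot ζ p) :
    AddChar.zmodChar p hζ.pow_eq_one ≠ 1 := by
  intro h1
  have h2 : AddChar.zmodChar p hζ.pow_eq_one ((1 : ℕ) : ZMod p) = 1 := by rw [h1]; rfl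
  rw [AddChar.zmodChar_apply', pow_one] at h2
  exact hζ.ne_one (Fact.out : p.Prime).one_lt h2

omit [Fintype G] [DecidableEq G] [Fact p.Prime] in
theorem IsCaminaShape.card_center_exponent_ne_zero (hS : IsCaminaShape G p n k) : k ≠ 0 := by
  rintro rfl
  refine hS.center_ne_bot (Subgroup.card_eq_one.mp ?_)
  rw [hS.card_center, pow_zero]

theorem IsCaminaShape.isMatrixUnitDecomposition (hS : IsCaminaShape G p n k) {ζ : ℂ}
    (hζ : IsPrimitiveRoot ζ p) {z : Fin k → G} {h : Fin n → G}
    (hz : IsCoordinateSystem p (Subgroup.center G) ⊥ z)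
    (hh : IsCoordinateSystem p (commutator G) (Subgroup.center G) h) :
    IsMatrixUnitDecomposition
      (fun c d : ConjClasses G => dualIdem c * allOnes G * dualIdem d) classSize
      (componentGenerator (p := p) ζ z h) := by
  have hψ := zmodChar_ne_one hζ
  refine (isMatrixUnitSystem hS hψ hz hh).isMatrixUnitDecomposition
    coe_dualIdem_mul_allOnes_mul_dualIdem ?_
    fun x hx => hS.mem_componentSpan_of_mem_terwilliger hψ hz hh hx
  rintro (⟨i, α⟩ | ⟨t, β⟩ | ⟨s, γ⟩)
  · exact coe_centralGenerator hζ.pow_eq_one hz hS.card_center_exponent_ne_zero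
      (hS.shiftStable_inner i) α.1
  · exact coe_centralGenerator hζ.pow_eq_one hz hS.card_center_exponent_ne_zero
      (hS.shiftStable_outer_center t) β.1
  · exact hS.coe_derivedGenerator hζ.pow_eq_one hh (hS.shiftStable_outer s) γ.1

theorem allOnes_eq_sum : allOnes G =
    ∑ c : ConjClasses G, ∑ d : ConjClasses G, dualIdem c * allOnes G * dualIdem d := by
  have h1 : ∑ c : ConjClasses G, dualIdem c = (1 : terwilliger G) := by
    refine Subtype.ext ?_
    rw [AddSubmonoidClass.coe_finsetSum, OneMemClass.coe_one, ← sum_coe_dualIdem]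
    exact Finset.sum_congr rfl fun c _ => coe_dualIdem c
  simp only [← Finset.mul_sum, ← Finset.sum_mul, h1, one_mul, mul_one]

end Span

/-! ### The ideal decomposition -/

section Decomposition

/-- The summands, split into the primary component and the others. -/
def summandIndexEquiv (G : Type*) [Group G] (p n k : ℕ) :
    SummandIndex G p n k ≃ Option (ComponentIndex G p n k) where
  toFun
    | .primary => none
    | .W i α => some (.inl (i, α))
    | .X t β => some (.inr (.inl (t, β)))
    | .Y s γ => some (.inr (.inr (s, γ)))
  invFun
    | none => .primary
    | some (.inl q) => .W q.1 q.2
    | some (.inr (.inl q)) => .X q.1 q.2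
    | some (.inr (.inr q)) => .Y q.1 q.2
  left_inv q := by cases q <;> rfl
  right_inv q := by rcases q with _ | q | q | q <;> rfl

variable {G : Type*} [Group G] [Fintype G] [DecidableEq G] {p n k : ℕ}

theorem mem_idealSpace {I : TwoSidedIdeal (terwilliger G)} {x : terwilliger G} :
    x ∈ idealSpace I ↔ x ∈ I := TwoSidedIdeal.mem_asIdeal

theorem summand_some [Fact p.Prime] (ζ : ℂ) (z : Fin k → G) (h : Fin n → G)
    (q : ComponentIndex G p n k) : summand ζ z h ((summandIndexEquiv G p n k).symm (some q)) =
      TwoSidedIdeal.span {componentGenerator ζ z h q} := by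
  rcases q with q | q | q <;> rfl

namespace IsCaminaShape

variable [Fact p.Prime] (hS : IsCaminaShape G p n k) {ζ : ℂ} (hζ : IsPrimitiveRoot ζ p)
include hS

omit [DecidableEq G] in
theorem exists_generatesCenter : ∃ z : Fin k → G, GeneratesCenter z := by
  obtain ⟨z, hz⟩ := exists_generators (p := p) (m := k) (H := Subgroup.center G) (N := ⊥) bot_le
    (fun a _ b hb => Subgroup.mem_center_iff.mp hb a)
    (fun a ha => Subgroup.mem_bot.mpr (hS.pow_center a ha))
    (by rw [Subgroup.relIndex_bot_left, hS.card_center])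
  exact ⟨z, by rwa [sup_bot_eq] at hz⟩

omit [DecidableEq G] in
theorem exists_generatesDerivedModCenter : ∃ h : Fin n → G, GeneratesDerivedModCenter h :=
  exists_generators (p := p) hS.center_le hS.comm hS.pow_derived hS.card_derived

omit [DecidableEq G] in
theorem isCoordinateSystem_center {z : Fin k → G} (hz : GeneratesCenter z) :
    IsCoordinateSystem p (Subgroup.center G) ⊥ z :=
  isCoordinateSystem (fun a _ b hb => Subgroup.mem_center_iff.mp hb a)
    (fun a ha => Subgroup.mem_bot.mpr (hS.pow_center a ha))
    (by rw [Subgroup.relIndex_bot_left, hS.card_center]) (by rw [sup_bot_eq]; exact hz)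

omit [DecidableEq G] in
theorem isCoordinateSystem_derived {h : Fin n → G} (hh : GeneratesDerivedModCenter h) :
    IsCoordinateSystem p (commutator G) (Subgroup.center G) h :=
  isCoordinateSystem hS.comm hS.pow_derived hS.card_derived hh

include hζ

theorem isAtom_primaryComponent : IsAtom (primaryComponent G) := by
  -- The primary component does not involve generators, but the decomposition from which minimality
  -- is read does; any choice serves.
  obtain ⟨z, hz⟩ := hS.exists_generatesCenter
  obtain ⟨h, hh⟩ := hS.exists_generatesDerivedModCenter
  exact (hS.isMatrixUnitDecomposition hζ (hS.isCoordinateSystem_center hz)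
    (hS.isCoordinateSystem_derived hh)).isAtom_span allOnes_eq_sum

theorem idealSpace_primaryComponent : idealSpace (primaryComponent G) =
    Submodule.span ℂ (Set.range fun q : ConjClasses G × ConjClasses G =>
      dualIdem q.1 * allOnes G * dualIdem q.2) := by
  obtain ⟨z, hz⟩ := hS.exists_generatesCenter
  obtain ⟨h, hh⟩ := hS.exists_generatesDerivedModCenter
  ext x
  rw [mem_idealSpace]
  exact (hS.isMatrixUnitDecomposition hζ (hS.isCoordinateSystem_center hz)
    (hS.isCoordinateSystem_derived hh)).mem_span_sum_u allOnes_eq_sum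

theorem finrank_primaryComponent :
    Module.finrank ℂ (idealSpace (primaryComponent G)) = Nat.card (ConjClasses G) ^ 2 := by
  obtain ⟨z, hz⟩ := hS.exists_generatesCenter
  obtain ⟨h, hh⟩ := hS.exists_generatesDerivedModCenter
  rw [hS.idealSpace_primaryComponent hζ,
    finrank_span_eq_card (hS.isMatrixUnitDecomposition hζ (hS.isCoordinateSystem_center hz)
    (hS.isCoordinateSystem_derived hh)).linearIndependent_u, Fintype.card_prod, ← sq,
    Nat.card_eq_fintype_card]

variable {z : Fin k → G} {h : Fin n → G} (hz : GeneratesCenter z)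
  (hh : GeneratesDerivedModCenter h)
include hz hh

theorem idealSpace_span_componentGenerator (q : ComponentIndex G p n k) :
    idealSpace (TwoSidedIdeal.span {componentGenerator ζ z h q}) =
      Submodule.span ℂ {componentGenerator ζ z h q} := by
  ext x
  rw [mem_idealSpace]
  exact (hS.isMatrixUnitDecomposition hζ (hS.isCoordinateSystem_center hz)
    (hS.isCoordinateSystem_derived hh)).mem_span_e

theorem finrank_span_componentGenerator (q : ComponentIndex G p n k) :
    Module.finrank ℂ (idealSpace (TwoSidedIdeal.span {componentGenerator ζ z h q})) = 1 := by
  rw [hS.idealSpace_span_componentGenerator hζ hz hh]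
  exact finrank_span_singleton ((hS.isMatrixUnitDecomposition hζ (hS.isCoordinateSystem_center hz)
    (hS.isCoordinateSystem_derived hh)).e_ne_zero q)

theorem isInternalSum_summand : IsInternalSum (summand (p := p) (n := n) (k := k) ζ z h) := by
  have hD := hS.isMatrixUnitDecomposition hζ (hS.isCoordinateSystem_center hz)
    (hS.isCoordinateSystem_derived hh)
  let t : Option (ComponentIndex G p n k) → Submodule ℂ (terwilliger G) := fun o =>
    idealSpace (summand ζ z h ((summandIndexEquiv G p n k).symm o))
  have h0 : t none = _ := hS.idealSpace_primaryComponent hζ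
  have h1 : ∀ q, t (some q) = _ := fun q => (congrArg idealSpace (summand_some ζ z h q)).trans
    (hS.idealSpace_span_componentGenerator hζ hz hh q)
  have ht : (fun i => idealSpace (summand ζ z h i)) = t ∘ summandIndexEquiv G p n k :=
    funext fun i => by simp only [t, Function.comp_apply, Equiv.symm_apply_apply]
  constructor
  · rw [ht]
    exact (hD.iSupIndep_span h0 h1).comp (summandIndexEquiv G p n k).injective
  · rw [ht, ← hD.iSup_span_eq_top h0 h1]
    exact (summandIndexEquiv G p n k).iSup_comp

end IsCaminaShape

end Decomposition

theorem theorem5 {G : Type*} [Group G] [Fintype G] [DecidableEq G] [Group.IsNilpotent G]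
    (p n k : ℕ) [Fact p.Prime] (hp : IsPGroup p G) (hG : IsCaminaGroup G)
    (hclass : Group.nilpotencyClass G = 3)
    (hn₂ : (commutator G).index = p ^ (2 * n))
    (hn₁ : (Subgroup.center G).relIndex (commutator G) = p ^ n)
    (hk : Nat.card (Subgroup.center G) = p ^ k)
    (ζ : ℂ) (hζ : IsPrimitiveRoot ζ p) :
    -- the ranges of the indices `i`, and of `t` and `s`
    Nat.card (InnerClass G) = p ^ n - 1 ∧
    Nat.card (OuterClass G) = p ^ (2 * n) - 1 ∧
    -- `V` is a minimal two-sided ideal, of dimension the square of the number of classes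
    IsAtom (primaryComponent G) ∧
    Module.finrank ℂ (idealSpace (primaryComponent G)) = Nat.card (ConjClasses G) ^ 2 ∧
    -- generators as required exist
    (∃ z : Fin k → G, GeneratesCenter z) ∧
    (∃ h : Fin n → G, GeneratesDerivedModCenter h) ∧
    -- and for every choice of them the decomposition holds
    ∀ (z : Fin k → G) (h : Fin n → G), GeneratesCenter z → GeneratesDerivedModCenter h →
      (∀ (i : InnerClass G) (α : NonzeroTuple p k),
        Module.finrank ℂ (idealSpace (summand (n := n) ζ z h (.W i α))) = 1) ∧
      (∀ (t : OuterClass G) (β : NonzeroTuple p k),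
        Module.finrank ℂ (idealSpace (summand (n := n) ζ z h (.X t β))) = 1) ∧
      (∀ (s : OuterClass G) (γ : NonzeroTuple p n),
        Module.finrank ℂ (idealSpace (summand (k := k) ζ z h (.Y s γ))) = 1) ∧
      IsInternalSum (summand (p := p) (n := n) (k := k) ζ z h) := by
  have hS := hG.isCaminaShape hp hclass hn₂ hn₁ hk
  refine ⟨hS.card_innerClass, hS.card_outerClass, hS.isAtom_primaryComponent hζ,
    hS.finrank_primaryComponent hζ, hS.exists_generatesCenter,
    hS.exists_generatesDerivedModCenter, fun z h hz hh => ⟨fun i α => ?_, fun t β => ?_,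
    fun s γ => ?_, hS.isInternalSum_summand hζ hz hh⟩⟩
  · exact hS.finrank_span_componentGenerator hζ hz hh (.inl (i, α))
  · exact hS.finrank_span_componentGenerator hζ hz hh (.inr (.inl (t, β)))
  · exact hS.finrank_span_componentGenerator hζ hz hh (.inr (.inr (s, γ)))
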